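/- Let $M$ be a smooth manifold (finite-dimensional, Hausdorff, $\sigma$-compact, without boundary), $q_B:B\to M$ a smooth real vector bundle of finite rank, and let $\Delta_M\subset TM$ and $C\subset B$ be smooth vector subbundles, with quotient projection $\pi:B\to B/C$. Recall that $TB$ is a double vector bundle: besides $TB\to B$ it carries the vector bundle structure $Tq_B:TB\to TM$, whose operations are the tangent maps of the fibrewise operations of $B$. A *linear distribution* on $B$ with side bundle $\Delta_M$ and core bundle $C$ is a distribution $\Delta\subset TB$ (a smooth vector subbundle of $TB\to B$) such that $Tq_B(\Delta)=\Delta_M$, $Tq_B:\Delta\to\Delta_M$ is a smooth vector subbundle of the restriction of $TB\to TM$ to $\Delta_M$, and, for all $m \in M$, a vector $c\in B_m$ lies in $C_m$ if and only if $\frac{d}{dt}\big|_{t=0}(t c)\in T_{0_m}B$ lies in $\Delta$. For a section $b$ of $B$ let $b^{\uparrow}(u)=\frac{d}{dt}\big|_{t=0}(u+t\,b(q_B(u)))$ be its vertical lift. A *linear section* of $\Delta$ covering $x\in\Gamma(\Delta_M)$ is a smooth vector field $X$ on $B$ with values in $\Delta$ which is a vector bundle morphism from $B\to M$ to $TB\to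 TM$ over $x:M\to TM$. Then, for every linear distribution $\Delta$ with side bundle $\Delta_M$ and core bundle $C$, every $x\in\Gamma(\Delta_M)$ is covered by a linear section $X$ of $\Delta$; for each such $X$ the formula $L_X(b)^{\uparrow}=[X,b^{\uparrow}]$ defines a map $L_X:\Gamma(B)\to\Gamma(B)$; and $$D^{\Delta}_x(b):=\pi\circ L_X(b)$$ does not depend on the choice of $X$. The map $\Delta\mapsto D^\Delta$ is a bijection from the set of linear distributions on $B$ with side bundle $\Delta_M$ and core bundle $C$ onto the set of additive maps $D:\Gamma(B)\to\Gamma(\Delta_M^*\otimes(B/C))$ satisfying $$D_x(fb)=f\,D_x(b)+(\mathcal L_xf)\,\pi(b)\qquad\text{for all } x\in\Gamma(\Delta_M),\ b\in\Gamma(B),\ f\in C^\infty(M).$$ Moreover, let $\nabla$ be a smooth connection on $B$, and call $\nabla$ *adapted* to $\Delta$ if the decomposition $\sigma_\nabla:TM\oplus B\oplus B\to TB$ that it defines, $$\sigma_\nabla(v,s(m),c)=Ts(v)-\tfrac{d}{dt}\Big|_{t=0}\big(s(m)+t\,\nabla_vs\big)+\tfrac{d}{dt}\Big|_{t=0}\big(s(m)+t\,c\big)\qquad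 (m\in M,\ v\in T_mM,\ s\in\Gamma(B),\ c\in B_m),$$ maps $\Delta_M\oplus B\oplus C$ onto $\Delta$. Then, for every linear distribution $\Delta$ with side bundle $\Delta_M$ and core bundle $C$, $\nabla$ is adapted to $\Delta$ if and only if $\pi\circ\nabla_x=D^\Delta_x$ for all $x\in\Gamma(\Delta_M)$. -/

import Mathlib

open Bundle Set
open scoped Manifold ContDiff Topology

noncomputable section

namespace LinDist

/-! ### Smooth vector subbundles, smooth sections of quotients -/

section Subbundle

variable {EN HN N : Type*} [NormedAddCommGroup EN] [NormedSpace ℝ EN] [TopologicalSpace HN]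
  (J : ModelWithCorners ℝ EN HN) [TopologicalSpace N] [ChartedSpace HN N]
  (F : Type*) [NormedAddCommGroup F] [NormedSpace ℝ F]
  (V : N → Type*) [TopologicalSpace (TotalSpace F V)]
  [∀ x, AddCommGroup (V x)] [∀ x, Module ℝ (V x)] [∀ x, TopologicalSpace (V x)]
  [FiberBundle F V] [VectorBundle ℝ F V]

/-- A family of subspaces `S x` of the fibres `V x` is a smooth vector subbundle of `V`: around each
point there are finitely many smooth local sections of `V` forming a basis of `S x` for all `x`
in a neighbourhood of the point. -/
def IsSmoothSubbundle (S : ∀ x, Submodule ℝ (V x)) : Prop :=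
  ∀ x₀ : N, ∃ U : Set N, IsOpen U ∧ x₀ ∈ U ∧ ∃ (k : ℕ) (s : Fin k → ∀ x, V x),
    (∀ i, ContMDiffOn J (J.prod 𝓘(ℝ, F)) ∞ (fun x => TotalSpace.mk' F x (s i x)) U) ∧
    ∀ x ∈ U, LinearIndependent ℝ (fun i => s i x) ∧
      Submodule.span ℝ (range fun i => s i x) = S x

variable {V} in
/-- A section of the quotient bundle `V / C` is smooth: locally, it is the image under the
projection `V → V / C` of a smooth section of `V`. -/
def IsSmoothQuotSection (C : ∀ x, Submodule ℝ (V x)) (σ : ∀ x, V x ⧸ C x) : Prop :=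
  ∀ x₀ : N, ∃ U : Set N, IsOpen U ∧ x₀ ∈ U ∧ ∃ s : ∀ x, V x,
    ContMDiffOn J (J.prod 𝓘(ℝ, F)) ∞ (fun x => TotalSpace.mk' F x (s x)) U ∧
    ∀ x ∈ U, (C x).mkQ (s x) = σ x

end Subbundle

variable {E H M : Type*} [NormedAddCommGroup E] [NormedSpace ℝ E] [TopologicalSpace H]
  (I : ModelWithCorners ℝ E H) [TopologicalSpace M] [ChartedSpace H M]
  (F : Type*) [NormedAddCommGroup F] [NormedSpace ℝ F]
  {B : M → Type*} [TopologicalSpace (TotalSpace F B)]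
  [∀ m, AddCommGroup (B m)] [∀ m, Module ℝ (B m)] [∀ m, TopologicalSpace (B m)]
  [FiberBundle F B] [VectorBundle ℝ F B]

/-! ### The tangent double vector bundle `(TB; TM, B; M)` -/

section TangentDouble

variable (B) in
/-- The total space of the vector bundle `TB → B`. -/
abbrev TTot : Type _ := TangentBundle (I.prod 𝓘(ℝ, F)) (TotalSpace F B)

variable (B) in
/-- The projection `T q_B : TB → TM` of the second vector bundle structure of `TB`. -/
def tproj : TTot I F B → TangentBundle I M :=
  tangentMap (I.prod 𝓘(ℝ, F)) I (TotalSpace.proj : TotalSpace F B → M)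

/-- `IsTSum w₁ w₂ w` says that `w = w₁ + w₂` for the vector bundle structure `TB → TM`. The addition
of this vector bundle is `T(+) : T(B ×_M B) = TB ×_{TM} TB → TB`, the tangent map of the fibrewise
addition of `B`; the fibre product `B ×_M B` is the total space of `B ⊕ B`. -/
def IsTSum (w₁ w₂ w : TTot I F B) : Prop :=
  ∃ u : TangentBundle (I.prod 𝓘(ℝ, F × F)) (TotalSpace (F × F) (B ×ᵇ B)),
    tangentMap (I.prod 𝓘(ℝ, F × F)) (I.prod 𝓘(ℝ, F))
      (fun p : TotalSpace (F × F) (B ×ᵇ B) => (⟨p.1, p.2.1⟩ : TotalSpace F B)) u = w₁ ∧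
    tangentMap (I.prod 𝓘(ℝ, F × F)) (I.prod 𝓘(ℝ, F))
      (fun p : TotalSpace (F × F) (B ×ᵇ B) => (⟨p.1, p.2.2⟩ : TotalSpace F B)) u = w₂ ∧
    tangentMap (I.prod 𝓘(ℝ, F × F)) (I.prod 𝓘(ℝ, F))
      (fun p : TotalSpace (F × F) (B ×ᵇ B) => (⟨p.1, p.2.1 + p.2.2⟩ : TotalSpace F B)) u = w

/-- Multiplication by the scalar `r` in the vector bundle `TB → TM`: the tangent map of the
fibrewise multiplication by `r` on `B`. -/
def tsmul (r : ℝ) : TTot I F B → TTot I F B :=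
  tangentMap (I.prod 𝓘(ℝ, F)) (I.prod 𝓘(ℝ, F))
    (fun e : TotalSpace F B => (⟨e.1, r • e.2⟩ : TotalSpace F B))

/-- The vertical vector `d/dt|_{t=0} (b + t c)`, tangent to `B` at `b`, for `b, c ∈ B_m`. -/
def verticalLift (e : TotalSpace F B) (c : B e.1) : TangentSpace (I.prod 𝓘(ℝ, F)) e :=
  mfderiv 𝓘(ℝ, ℝ) (I.prod 𝓘(ℝ, F))
    (fun t : ℝ => (⟨e.1, e.2 + t • c⟩ : TotalSpace F B)) 0 (1 : ℝ)

/-- The vertical vector field `b^↑` on `B` given by a section `b`. -/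
def verticalField (b : ∀ m, B m) (e : TotalSpace F B) : TangentSpace (I.prod 𝓘(ℝ, F)) e :=
  verticalLift I F e (b e.1)

end TangentDouble

/-! ### Linear distributions -/

section Smooth

variable [IsManifold I ∞ M] [ContMDiffVectorBundle ∞ F B I]

/-- A linear distribution `Δ` on `B` with side bundle `ΔM ⊆ TM` and core bundle `C ⊆ B`, i.e. a
distribution `Δ ⊆ TB` such that `(Δ; ΔM, B; M)` is a double vector subbundle of `(TB; TM, B; M)`
with core `C`. -/
structure LinearDistribution (ΔM : ∀ m : M, Submodule ℝ (TangentSpace I m))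
    (C : ∀ m, Submodule ℝ (B m)) where
  /-- The subspaces `Δ_b ⊆ T_b B`. -/
  space : ∀ e : TotalSpace F B, Submodule ℝ (TangentSpace (I.prod 𝓘(ℝ, F)) e)
  /-- `Δ → B` is a smooth vector subbundle of `TB → B`. -/
  subbundle : IsSmoothSubbundle (I.prod 𝓘(ℝ, F)) (E × F)
    (fun e : TotalSpace F B => TangentSpace (I.prod 𝓘(ℝ, F)) e) space
  /-- The projection `T q_B : TB → TM` maps `Δ` into `ΔM`, -/
  proj_mem : ∀ w : TTot I F B, w.2 ∈ space w.1 → (tproj I F B w).2 ∈ ΔM (tproj I F B w).1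
  /-- and onto `ΔM`. -/
  proj_surj : ∀ v : TangentBundle I M, v.2 ∈ ΔM v.1 →
    ∃ w : TTot I F B, w.2 ∈ space w.1 ∧ tproj I F B w = v
  /-- The fibres of `Δ → ΔM` are closed under the addition of `TB → TM`, -/
  add_mem : ∀ w₁ w₂ w : TTot I F B, IsTSum I F w₁ w₂ w →
    w₁.2 ∈ space w₁.1 → w₂.2 ∈ space w₂.1 → w.2 ∈ space w.1
  /-- and under its scalar multiplication. -/
  smul_mem : ∀ (r : ℝ) (w : TTot I F B), w.2 ∈ space w.1 →
    (tsmul I F r w).2 ∈ space (tsmul I F r w).1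
  /-- `Δ → ΔM` is a smooth vector subbundle of the restriction of `TB → TM` to `ΔM`: locally, there
  are smooth fibrewise linear parametrizations `Φ` of its fibres by some `ℝ^k`. -/
  locally_trivial : ∀ v₀ : TangentBundle I M, v₀.2 ∈ ΔM v₀.1 →
    ∃ U : Set (TangentBundle I M), IsOpen U ∧ v₀ ∈ U ∧
    ∃ (k : ℕ) (Φ : TangentBundle I M × (Fin k → ℝ) → TTot I F B),
      ContMDiffOn (I.tangent.prod 𝓘(ℝ, Fin k → ℝ)) (I.prod 𝓘(ℝ, F)).tangent ∞ Φ (U ×ˢ univ) ∧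
      ∀ v ∈ U, v.2 ∈ ΔM v.1 →
        BijOn (fun a => Φ (v, a)) univ {w | w.2 ∈ space w.1 ∧ tproj I F B w = v} ∧
        (∀ a a', IsTSum I F (Φ (v, a)) (Φ (v, a')) (Φ (v, a + a'))) ∧
        ∀ (r : ℝ) a, Φ (v, r • a) = tsmul I F r (Φ (v, a))
  /-- The core of `Δ`, the set of vectors of `Δ` at zeros `0_m` of `B` that are killed by `T q_B`,
  is `C`. -/
  core : ∀ (m : M) (c : B m), c ∈ C m ↔
    verticalLift I F (⟨m, 0⟩ : TotalSpace F B) c ∈ space ⟨m, 0⟩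

variable {I F} {ΔM : ∀ m : M, Submodule ℝ (TangentSpace I m)} {C : ∀ m, Submodule ℝ (B m)}

/-- Sections `x ∈ Γ(ΔM)` of the subbundle `ΔM ⊆ TM`. -/
def SideSection (ΔM : ∀ m : M, Submodule ℝ (TangentSpace I m)) : Type _ :=
  {x : Cₛ^∞⟮I; E, (TangentSpace I : M → Type _)⟯ // ∀ m, x m ∈ ΔM m}

/-- The value `x(m) ∈ ΔM_m` of a section `x` of `ΔM`. -/
def SideSection.val (x : SideSection ΔM) (m : M) : ΔM m := ⟨x.1 m, x.2 m⟩

/-- `X` is a linear section of `Δ → B` covering `x ∈ Γ(ΔM)`: a smooth vector field on `B` with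
values in `Δ` which is a vector bundle morphism from `B → M` to `TB → TM` over `x : M → TM`. -/
structure IsLinearSection (Δ : LinearDistribution I F ΔM C) (x : SideSection ΔM)
    (X : ∀ e : TotalSpace F B, TangentSpace (I.prod 𝓘(ℝ, F)) e) : Prop where
  smooth : ContMDiff (I.prod 𝓘(ℝ, F)) (I.prod 𝓘(ℝ, F)).tangent ∞
    (fun e => (⟨e, X e⟩ : TTot I F B))
  mem : ∀ e, X e ∈ Δ.space e
  covers : ∀ e, tproj I F B ⟨e, X e⟩ = ⟨e.1, x.1 e.1⟩
  map_add : ∀ (m : M) (b b' : B m),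
    IsTSum I F ⟨⟨m, b⟩, X ⟨m, b⟩⟩ ⟨⟨m, b'⟩, X ⟨m, b'⟩⟩ ⟨⟨m, b + b'⟩, X ⟨m, b + b'⟩⟩
  map_smul : ∀ (m : M) (r : ℝ) (b : B m),
    (⟨⟨m, r • b⟩, X ⟨m, r • b⟩⟩ : TTot I F B) = tsmul I F r ⟨⟨m, b⟩, X ⟨m, b⟩⟩

/-- `L` is the derivation `L_X : Γ(B) → Γ(B)` of a linear vector field `X`:
`L_X(b)^↑ = [X, b^↑]`. -/
def IsDerivationOf (X : ∀ e : TotalSpace F B, TangentSpace (I.prod 𝓘(ℝ, F)) e)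
    (L : Cₛ^∞⟮I; F, B⟯ → Cₛ^∞⟮I; F, B⟯) : Prop :=
  ∀ (b : Cₛ^∞⟮I; F, B⟯) (e : TotalSpace F B),
    verticalField I F (L b) e =
      VectorField.mlieBracket (I.prod 𝓘(ℝ, F)) X (verticalField I F b) e

/-! ### Spencer operators -/

variable (F) in
/-- Smooth sections of `ΔM* ⊗ (B/C)`: families of linear maps `ΔM_m → B_m / C_m` that map smooth
sections of `ΔM` to smooth sections of `B / C`. -/
def QuotFormSection (ΔM : ∀ m : M, Submodule ℝ (TangentSpace I m)) (C : ∀ m, Submodule ℝ (B m)) :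
    Type _ :=
  {T : ∀ m, ΔM m →ₗ[ℝ] (B m ⧸ C m) //
    ∀ x : SideSection ΔM, IsSmoothQuotSection I F C (fun m => T m (x.val m))}

/-- The section `f b` of `B`, for a smooth function `f` on `M` and `b ∈ Γ(B)`. -/
def fsmul (f : C^∞⟮I, M; ℝ⟯) (b : Cₛ^∞⟮I; F, B⟯) : Cₛ^∞⟮I; F, B⟯ :=
  ⟨fun m => f m • b m, f.contMDiff.smul_section b.contMDiff⟩

variable (I F) in
/-- Additive operators `D : Γ(B) → Γ(ΔM* ⊗ (B/C))` with
`D_x (f b) = f D_x b + (𝓛_x f) π(b)` for all `x ∈ Γ(ΔM)`, `b ∈ Γ(B)`, `f ∈ C^∞(M)`. -/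
structure SpencerOperator (ΔM : ∀ m : M, Submodule ℝ (TangentSpace I m))
    (C : ∀ m, Submodule ℝ (B m)) where
  toFun : Cₛ^∞⟮I; F, B⟯ → QuotFormSection F ΔM C
  map_add : ∀ b b' m, (toFun (b + b')).1 m = (toFun b).1 m + (toFun b').1 m
  leibniz : ∀ (x : SideSection ΔM) (f : C^∞⟮I, M; ℝ⟯) (b : Cₛ^∞⟮I; F, B⟯) (m : M),
    (toFun (fsmul f b)).1 m (x.val m) =
      f m • (toFun b).1 m (x.val m) + mvfderiv I f m (x.1 m) • (C m).mkQ (b m)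

/-- `D_x b ∈ Γ(B/C)`, evaluated at `m`. -/
def SpencerOperator.eval (D : SpencerOperator I F ΔM C) (x : SideSection ΔM)
    (b : Cₛ^∞⟮I; F, B⟯) (m : M) : B m ⧸ C m :=
  (D.toFun b).1 m (x.val m)

/-! ### Connections adapted to a linear distribution -/

variable [∀ m, IsTopologicalAddGroup (B m)] [∀ m, ContinuousSMul ℝ (B m)]

/-- The decomposition `σ_∇ : TM ⊕ B ⊕ B → TB` of the double vector bundle `TB` given by a connection
`∇` on `B`, namely `σ_∇(v, b, c) = h_∇(v)(b) + c^↑_b`, where `h_∇` is the horizontal lift of `∇`.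
The point `b` of `B_m` is given as the value `s(m)` of a section `s`, and then
`h_∇(v)(b) = Ts(v) - (∇_v s)^↑_b` (which does not depend on the choice of `s`). -/
def decomposition (cov : CovariantDerivative I F B) {m : M} (v : TangentSpace I m)
    (s : Cₛ^∞⟮I; F, B⟯) (c : B m) :
    TangentSpace (I.prod 𝓘(ℝ, F)) (⟨m, s m⟩ : TotalSpace F B) :=
  mfderiv I (I.prod 𝓘(ℝ, F)) (fun m => (⟨m, s m⟩ : TotalSpace F B)) m v
    - verticalLift I F ⟨m, s m⟩ (cov s m v) + verticalLift I F ⟨m, s m⟩ c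

/-- The connection `∇` is adapted to `Δ`: its decomposition of `TB` maps `ΔM ⊕ B ⊕ C` onto `Δ`. -/
def IsAdapted (cov : CovariantDerivative I F B) (Δ : LinearDistribution I F ΔM C) : Prop :=
  ∀ (m : M) (s : Cₛ^∞⟮I; F, B⟯),
    {w | ∃ v ∈ ΔM m, ∃ c ∈ C m, decomposition cov v s c = w} = (Δ.space ⟨m, s m⟩ : Set _)

end Smooth

end LinDist

end

open Bundle Set
open scoped Manifold ContDiff Topology

noncomputable section

/-! Near `m₀`, a chart of `M` and a trivialization of `B` give a vector of `TB` at a point with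
fibre coordinate `b` a horizontal coordinate `y` and a vertical coordinate `u`. The operations of
`TB → TM` keep `y` and act linearly on the pair `(b, u)`. Both sides of the bijection are locally
given by the same kind of data, a smooth bilinear `ℓ`. A linear distribution is `{y ∈ ΔM, u +
ℓ(b)(y) ∈ C}` (`HasLocalForm`), and an operator with the Leibniz rule is `π ∘ (d + ℓ)`
(`HasLocalSymbol`).

The coordinate-free link is `Corresponds`: `Ts(v) - c^↑` lies in `Δ` iff `D_v s = π(c)`. Each of `Δ`
and `D` determines the other, because every vector of `TB` at `s(m)` has the form `Ts(v) - c^↑`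
(`exists_eq_sub_verticalLift`) and every point of `B` lies on a global section. Existence in both
directions is read off from `ℓ`; since the relation does not mention coordinates, the local
constructions agree on overlaps.

The hard step is `LinearDistribution.hasLocalForm`. Surjectivity of `Δ → ΔM` gives vectors over each
`v ∈ ΔM` only at some point of the fibre of `B`, and scaling by `0` moves them to `0_m`. The rank of
`Δ` is constant along the segment from `0_m` to `b`, and the part of `Δ` over `v = 0` is `C` at both
ends, so `Δ_b` also projects onto `ΔM` (`exists_mem_coordSpace`). Smooth lifts at the points of a
constant frame, combined linearly, give `ℓ`.

A linear section `X` over `x` defines `L` by `X(b(m)) = Tb(x) - (L b)^↑`, and a bracket computation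
in coordinates shows `(L b)^↑ = [X, b^↑]` (`IsLinearSection.coords_mlieBracket`). As `X` takes
values in `Δ`, the relation gives `D_x b = π(L b)` for every `X`. Linear sections exist by a
partition of unity. Finally `σ_∇(v, s(m), c) = Ts(v) - (∇_v s - c)^↑`, which turns adaptedness into
`π ∘ ∇ = D`. -/

namespace LinDist

set_option linter.unusedSectionVars false

/-! ### Horizontal and vertical coordinates on `TB` -/

section Coordinates

variable {E H M : Type*} [NormedAddCommGroup E] [NormedSpace ℝ E] [TopologicalSpace H]
  {I : ModelWithCorners ℝ E H} [TopologicalSpace M] [ChartedSpace H M] [IsManifold I ∞ M]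
  {F : Type*} [NormedAddCommGroup F] [NormedSpace ℝ F]
  {B : M → Type*} [TopologicalSpace (TotalSpace F B)]
  [∀ m, AddCommGroup (B m)] [∀ m, Module ℝ (B m)] [∀ m, TopologicalSpace (B m)]
  [FiberBundle F B] [VectorBundle ℝ F B]

variable (F) in
/-- The linear coordinates on the fibre `B m` given by the preferred trivialization at `m₀`. -/
abbrev co (m₀ m : M) : B m →L[ℝ] F := (trivializationAt F B m₀).continuousLinearMapAt ℝ m

variable (F B) in
/-- The inverse of `co F m₀ m`. -/
abbrev coSymm (m₀ m : M) : F →L[ℝ] B m := (trivializationAt F B m₀).symmL ℝ m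

variable (I) in
/-- The linear coordinates on `T_m M` given by the chart at `m₀`. -/
abbrev hco (m₀ m : M) : TangentSpace I m →L[ℝ] E :=
  (trivializationAt E (TangentSpace I : M → Type _) m₀).continuousLinearMapAt ℝ m

variable (F B) in
/-- The second component of the preferred trivialization of `B` at `m₀`. -/
abbrev fcoord (m₀ : M) (e : TotalSpace F B) : F := (trivializationAt F B m₀ e).2

variable (I F) in
/-- The differential of the projection `B → M`. -/
abbrev dq (e : TotalSpace F B) : TangentSpace (I.prod 𝓘(ℝ, F)) e →L[ℝ] TangentSpace I e.1 :=
  mfderiv (I.prod 𝓘(ℝ, F)) I (TotalSpace.proj : TotalSpace F B → M) e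

variable (I F) in
/-- The differential of the fibre coordinates of `B` at `m₀`. -/
abbrev vcoord (m₀ : M) (e : TotalSpace F B) : TangentSpace (I.prod 𝓘(ℝ, F)) e →L[ℝ] F :=
  mvfderiv (I.prod 𝓘(ℝ, F)) (fcoord F B m₀) e

theorem co_apply {m₀ m : M} (hm : m ∈ (trivializationAt F B m₀).baseSet) (b : B m) :
    co F m₀ m b = fcoord F B m₀ ⟨m, b⟩ := by
  rw [Trivialization.continuousLinearMapAt_apply, Trivialization.coe_linearMapAt_of_mem _ hm]

theorem co_coSymm {m₀ m : M} (hm : m ∈ (trivializationAt F B m₀).baseSet) (y : F) :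
    co F m₀ m (coSymm F B m₀ m y) = y :=
  (trivializationAt F B m₀).continuousLinearMapAt_symmL hm y

theorem coSymm_co {m₀ m : M} (hm : m ∈ (trivializationAt F B m₀).baseSet) (b : B m) :
    coSymm F B m₀ m (co F m₀ m b) = b :=
  (trivializationAt F B m₀).symmL_continuousLinearMapAt hm b

variable [ContMDiffVectorBundle ∞ F B I]

theorem contMDiffAt_fcoord {m₀ : M} {e : TotalSpace F B}
    (he : e.1 ∈ (trivializationAt F B m₀).baseSet) :
    ContMDiffAt (I.prod 𝓘(ℝ, F)) 𝓘(ℝ, F) ∞ (fcoord F B m₀) e := by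
  have h := ((trivializationAt F B m₀).contMDiffAt_iff (n := ∞) (IM := I.prod 𝓘(ℝ, F)) (IB := I)
    (f := fun e : TotalSpace F B => e) (x₀ := e)
    ((trivializationAt F B m₀).mem_source.2 he)).1 contMDiffAt_id
  exact h.2

theorem mdifferentiableAt_fcoord {m₀ : M} {e : TotalSpace F B}
    (he : e.1 ∈ (trivializationAt F B m₀).baseSet) :
    MDifferentiableAt (I.prod 𝓘(ℝ, F)) 𝓘(ℝ, F) (fcoord F B m₀) e :=
  (contMDiffAt_fcoord he).mdifferentiableAt (by simp)

theorem hco_eq {m₀ m : M} (hm : m ∈ (chartAt H m₀).source) :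
    hco I m₀ m = mfderiv I 𝓘(ℝ, E) (extChartAt I m₀) m :=
  TangentBundle.continuousLinearMapAt_trivializationAt hm

theorem mem_chart_source_total {e₀ e : TotalSpace F B} :
    e ∈ (chartAt (ModelProd H F) e₀).source ↔
      e.1 ∈ (chartAt H e₀.1).source ∧ e.1 ∈ (trivializationAt F B e₀.1).baseSet := by
  rw [FiberBundle.chartedSpace_chartAt]
  simp only [OpenPartialHomeomorph.trans_source, OpenPartialHomeomorph.prod_source, mem_inter_iff,
    mem_preimage, mem_prod, OpenPartialHomeomorph.refl_source, mem_univ, and_true]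
  refine ⟨fun ⟨h₁, h₂⟩ => ?_, fun ⟨h₁, h₂⟩ => ?_⟩
  · have h₃ := (trivializationAt F B e₀.1).mem_source.1 h₁
    rw [(trivializationAt F B e₀.1).coe_coe, (trivializationAt F B e₀.1).coe_fst h₁] at h₂
    exact ⟨h₂, h₃⟩
  · have h₃ := (trivializationAt F B e₀.1).mem_source.2 h₂
    rw [(trivializationAt F B e₀.1).coe_coe, (trivializationAt F B e₀.1).coe_fst h₃]
    exact ⟨h₃, h₁⟩

/-- The trivialization of `TB → B` at `e₀` in terms of horizontal and vertical coordinates. -/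
theorem hco_total {e₀ e : TotalSpace F B} (h : e.1 ∈ (chartAt H e₀.1).source)
    (h' : e.1 ∈ (trivializationAt F B e₀.1).baseSet) (w : TangentSpace (I.prod 𝓘(ℝ, F)) e) :
    hco (I.prod 𝓘(ℝ, F)) e₀ e w = (hco I e₀.1 e.1 (dq I F e w), vcoord I F e₀.1 e w) := by
  rw [hco_eq (mem_chart_source_total.2 ⟨h, h'⟩), hco_eq h]
  have hfun : (extChartAt (I.prod 𝓘(ℝ, F)) e₀ : TotalSpace F B → E × F) =ᶠ[𝓝 e]
      fun e => ((extChartAt I e₀.1 ∘ TotalSpace.proj) e, fcoord F B e₀.1 e) := by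
    have : ∀ᶠ e' in 𝓝 e, e' ∈ (trivializationAt F B e₀.1).source :=
      (trivializationAt F B e₀.1).open_source.mem_nhds ((trivializationAt F B e₀.1).mem_source.2 h')
    filter_upwards [this] with e' he'
    rw [FiberBundle.extChartAt]
    refine Prod.ext ?_ rfl
    exact congrArg (extChartAt I e₀.1) ((trivializationAt F B e₀.1).coe_fst he')
  have h1 : HasMFDerivAt (I.prod 𝓘(ℝ, F)) 𝓘(ℝ, E)
      (extChartAt I e₀.1 ∘ (TotalSpace.proj : TotalSpace F B → M)) e
      ((mfderiv I 𝓘(ℝ, E) (extChartAt I e₀.1) e.1).comp (dq I F e)) :=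
    (mdifferentiableAt_extChartAt h).hasMFDerivAt.comp e (mdifferentiableAt_proj B).hasMFDerivAt
  have h2 := (mdifferentiableAt_fcoord (I := I) h').hasMFDerivAt
  have h3 : HasMFDerivAt (I.prod 𝓘(ℝ, F)) 𝓘(ℝ, E × F)
      (fun e => ((extChartAt I e₀.1 ∘ TotalSpace.proj) e, fcoord F B e₀.1 e)) e
      (ContinuousLinearMap.prod _ _) := ⟨h1.1.prodMk h2.1, h1.2.prodMk h2.2⟩
  exact DFunLike.congr_fun (h3.congr_of_eventuallyEq hfun).mfderiv w

variable (I F B) in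
/-- The open set of points of `M` covered by the preferred chart and trivialization at `m₀`. -/
def dom (m₀ : M) : Set M := (chartAt H m₀).source ∩ (trivializationAt F B m₀).baseSet

theorem isOpen_dom (m₀ : M) : IsOpen (dom (H := H) F B m₀) :=
  (chartAt H m₀).open_source.inter (trivializationAt F B m₀).open_baseSet

theorem mem_dom_self (m₀ : M) : m₀ ∈ dom (H := H) F B m₀ :=
  ⟨mem_chart_source H m₀, mem_baseSet_trivializationAt F B m₀⟩

theorem hco_coSymm {m₀ m : M} (hm : m ∈ (chartAt H m₀).source) (y : E) :
    hco I m₀ m (coSymm E (TangentSpace I : M → Type _) m₀ m y) = y :=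
  co_coSymm (by simpa using hm) y

theorem coSymm_hco {m₀ m : M} (hm : m ∈ (chartAt H m₀).source) (v : TangentSpace I m) :
    coSymm E (TangentSpace I : M → Type _) m₀ m (hco I m₀ m v) = v :=
  coSymm_co (by simpa using hm) v

/-- The two components form a trivialization of `TB → B`, hence are jointly injective. Identities in
`T_e B` are proved below by comparing them. -/
theorem tangent_ext {m₀ : M} {e : TotalSpace F B} (he : e.1 ∈ dom (H := H) F B m₀)
    {w w' : TangentSpace (I.prod 𝓘(ℝ, F)) e} (h : dq I F e w = dq I F e w')
    (h' : vcoord I F m₀ e w = vcoord I F m₀ e w') : w = w' := by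
  have key := hco_total (I := I) (F := F) (e₀ := (⟨m₀, 0⟩ : TotalSpace F B)) he.1 he.2
  rw [← coSymm_hco (mem_chart_source_total (e₀ := (⟨m₀, 0⟩ : TotalSpace F B)).2 he) w,
    ← coSymm_hco (mem_chart_source_total (e₀ := (⟨m₀, 0⟩ : TotalSpace F B)).2 he) w',
    key, key, h, h']

variable (I F B) in
/-- The vector in `T_e B` with given horizontal and vertical coordinates. -/
def ofCoords (m₀ : M) (e : TotalSpace F B) (p : E × F) : TangentSpace (I.prod 𝓘(ℝ, F)) e :=
  coSymm (E × F) (TangentSpace (I.prod 𝓘(ℝ, F)) : TotalSpace F B → Type _) ⟨m₀, 0⟩ e p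

theorem hco_total_ofCoords {m₀ : M} {e : TotalSpace F B} (he : e.1 ∈ dom (H := H) F B m₀)
    (p : E × F) :
    (hco I m₀ e.1 (dq I F e (ofCoords I F B m₀ e p)), vcoord I F m₀ e (ofCoords I F B m₀ e p)) =
      p := by
  rw [← hco_total (I := I) (F := F) (e₀ := (⟨m₀, 0⟩ : TotalSpace F B)) he.1 he.2]
  exact hco_coSymm (mem_chart_source_total (e₀ := (⟨m₀, 0⟩ : TotalSpace F B)).2 he) p

theorem hco_dq_ofCoords {m₀ : M} {e : TotalSpace F B} (he : e.1 ∈ dom (H := H) F B m₀)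
    (p : E × F) : hco I m₀ e.1 (dq I F e (ofCoords I F B m₀ e p)) = p.1 :=
  congrArg Prod.fst (hco_total_ofCoords he p)

theorem vcoord_ofCoords {m₀ : M} {e : TotalSpace F B} (he : e.1 ∈ dom (H := H) F B m₀)
    (p : E × F) : vcoord I F m₀ e (ofCoords I F B m₀ e p) = p.2 :=
  congrArg Prod.snd (hco_total_ofCoords he p)

theorem dq_ofCoords {m₀ : M} {e : TotalSpace F B} (he : e.1 ∈ dom (H := H) F B m₀)
    (v : TangentSpace I e.1) (u : F) :
    dq I F e (ofCoords I F B m₀ e (hco I m₀ e.1 v, u)) = v := by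
  rw [← coSymm_hco he.1 (dq I F e _), hco_dq_ofCoords he, coSymm_hco he.1]

section ChainRule

variable {E' H' N : Type*} [NormedAddCommGroup E'] [NormedSpace ℝ E'] [TopologicalSpace H']
  {J : ModelWithCorners ℝ E' H'} [TopologicalSpace N] [ChartedSpace H' N]

theorem dq_mfderiv {g : N → TotalSpace F B} {n : N}
    (hg : MDifferentiableAt J (I.prod 𝓘(ℝ, F)) g n) (v : TangentSpace J n) :
    dq I F (g n) (mfderiv J (I.prod 𝓘(ℝ, F)) g n v) = mfderiv J I (fun n => (g n).1) n v :=
  (mfderiv_comp_apply n (mdifferentiableAt_proj B) hg v).symm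

theorem vcoord_mfderiv {g : N → TotalSpace F B} {n : N} {m₀ : M}
    (hg : MDifferentiableAt J (I.prod 𝓘(ℝ, F)) g n)
    (hn : (g n).1 ∈ (trivializationAt F B m₀).baseSet) (v : TangentSpace J n) :
    vcoord I F m₀ (g n) (mfderiv J (I.prod 𝓘(ℝ, F)) g n v) =
      mvfderiv J (fun n => fcoord F B m₀ (g n)) n v :=
  (mfderiv_comp_apply n (mdifferentiableAt_fcoord hn) hg v).symm

theorem contMDiffAt_total_iff {g : N → TotalSpace F B} {n : N} {m₀ : M}
    (hn : (g n).1 ∈ (trivializationAt F B m₀).baseSet) :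
    ContMDiffAt J (I.prod 𝓘(ℝ, F)) ∞ g n ↔ ContMDiffAt J I ∞ (fun n => (g n).1) n ∧
      ContMDiffAt J 𝓘(ℝ, F) ∞ (fun n => fcoord F B m₀ (g n)) n :=
  (trivializationAt F B m₀).contMDiffAt_iff ((trivializationAt F B m₀).mem_source.2 hn)

/-- Smoothness of maps into `TB` in horizontal and vertical coordinates. -/
theorem contMDiffAt_ttot_iff {g : N → TTot I F B} {n : N} {m₀ : M}
    (hn : (g n).1.1 ∈ dom (H := H) F B m₀) :
    ContMDiffAt J (I.prod 𝓘(ℝ, F)).tangent ∞ g n ↔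
      ContMDiffAt J (I.prod 𝓘(ℝ, F)) ∞ (fun n => (g n).1) n ∧
      ContMDiffAt J 𝓘(ℝ, E) ∞ (fun n => hco I m₀ (g n).1.1 (dq I F (g n).1 (g n).2)) n ∧
      ContMDiffAt J 𝓘(ℝ, F) ∞ (fun n => vcoord I F m₀ (g n).1 (g n).2) n := by
  have hs := mem_chart_source_total (e₀ := (⟨m₀, 0⟩ : TotalSpace F B)).2 hn
  set t := trivializationAt (E × F)
    (TangentSpace (I.prod 𝓘(ℝ, F)) : TotalSpace F B → Type _) ⟨m₀, 0⟩ with ht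
  have h1 : ContMDiffAt J (I.prod 𝓘(ℝ, F)).tangent ∞ g n ↔
      ContMDiffAt J (I.prod 𝓘(ℝ, F)) ∞ (fun n => (g n).1) n ∧
      ContMDiffAt J 𝓘(ℝ, E × F) ∞ (fun n => (t (g n)).2) n :=
    t.contMDiffAt_iff (t.mem_source.2 (by simpa [ht] using hs))
  rw [h1]
  refine and_congr_right fun hb => ?_
  have hev : ∀ᶠ n' in 𝓝 n, (g n').1.1 ∈ dom (H := H) F B m₀ :=
    ((FiberBundle.continuous_proj F B).continuousAt.comp hb.continuousAt).eventually
      ((isOpen_dom m₀).mem_nhds hn)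
  have hev' : (fun n => (t (g n)).2) =ᶠ[𝓝 n] fun n =>
      (hco I m₀ (g n).1.1 (dq I F (g n).1 (g n).2), vcoord I F m₀ (g n).1 (g n).2) := by
    filter_upwards [hev] with n' hn'
    rw [← hco_total (I := I) (F := F) (e₀ := (⟨m₀, 0⟩ : TotalSpace F B)) hn'.1 hn'.2]
    have := co_apply (F := E × F) (B := (TangentSpace (I.prod 𝓘(ℝ, F)) : TotalSpace F B → Type _))
      (m₀ := ⟨m₀, 0⟩) (m := (g n').1)
      (by simpa using mem_chart_source_total (e₀ := (⟨m₀, 0⟩ : TotalSpace F B)).2 hn') (g n').2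
    exact this.symm
  rw [hev'.contMDiffAt_iff]
  exact ⟨fun h => ⟨contDiff_fst.contMDiff.contMDiffAt.comp n h,
    contDiff_snd.contMDiff.contMDiffAt.comp n h⟩, fun h => h.1.prodMk_space h.2⟩

end ChainRule

theorem contMDiff_verticalLine (e : TotalSpace F B) (c : B e.1) :
    ContMDiff 𝓘(ℝ, ℝ) (I.prod 𝓘(ℝ, F)) ∞
      (fun t : ℝ => (⟨e.1, e.2 + t • c⟩ : TotalSpace F B)) := by
  intro t
  refine (contMDiffAt_total_iff (mem_baseSet_trivializationAt F B e.1)).2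
    ⟨contMDiffAt_const, ?_⟩
  have : (fun t : ℝ => fcoord F B e.1 ⟨e.1, e.2 + t • c⟩) =
      fun t => co F e.1 e.1 e.2 + t • co F e.1 e.1 c := by
    ext t
    rw [← co_apply (mem_baseSet_trivializationAt F B e.1), map_add, map_smul]
  rw [this]
  exact (ContDiff.contMDiff (by fun_prop)) t

theorem dq_verticalLift (e : TotalSpace F B) (c : B e.1) :
    dq I F e (verticalLift I F e c) = 0 := by
  have h := dq_mfderiv (I := I) ((contMDiff_verticalLine e c).mdifferentiable (by simp) 0) (1 : ℝ)
  -- The line passes at time `0` through `e.2 + 0 • c`, which equals `e.2` only propositionally;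
  -- `dq` is transported along this equality by viewing all tangent spaces as `E × F`.
  have aux : ∀ e' : TotalSpace F B, e' = e → ∀ w : E × F, (dq I F e' w : E) = dq I F e w := by
    rintro _ rfl w
    rfl
  refine (aux ⟨e.1, e.2 + (0 : ℝ) • c⟩ (by simp) _).symm.trans (h.trans ?_)
  exact DFunLike.congr_fun (mfderiv_const (I := 𝓘(ℝ, ℝ)) (I' := I) (c := e.1) (x := (0 : ℝ))) _

/-- Along the line `t ↦ e + t c` the function is affine, so its derivative is the slope. It serves
both for the fibre coordinates and for the vertical component of a linear vector field. -/
theorem mvfderiv_verticalLift {G : Type*} [NormedAddCommGroup G] [NormedSpace ℝ G]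
    {k : TotalSpace F B → G} {e : TotalSpace F B}
    (hk : MDifferentiableAt (I.prod 𝓘(ℝ, F)) 𝓘(ℝ, G) k e) {c : B e.1} {a d : G}
    (h : ∀ t : ℝ, k ⟨e.1, e.2 + t • c⟩ = a + t • d) :
    mvfderiv (I.prod 𝓘(ℝ, F)) k e (verticalLift I F e c) = d := by
  have he : (⟨e.1, e.2 + (0 : ℝ) • c⟩ : TotalSpace F B) = e := by simp
  refine (mfderiv_comp_apply_of_eq (0 : ℝ) hk
    ((contMDiff_verticalLine e c).mdifferentiable (by simp) 0) he (1 : ℝ)).symm.trans ?_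
  have hf : k ∘ (fun t : ℝ => (⟨e.1, e.2 + t • c⟩ : TotalSpace F B)) = fun t => a + t • d :=
    funext h
  rw [hf]
  have hd : HasDerivAt (fun t : ℝ => a + t • d) d 0 := by
    simpa using ((hasDerivAt_id (0 : ℝ)).smul_const d).const_add a
  refine (DFunLike.congr_fun hd.hasFDerivAt.hasMFDerivAt.mfderiv (1 : ℝ)).trans ?_
  exact one_smul ℝ d

theorem vcoord_verticalLift {m₀ : M} {e : TotalSpace F B}
    (he : e.1 ∈ (trivializationAt F B m₀).baseSet) (c : B e.1) :
    vcoord I F m₀ e (verticalLift I F e c) = co F m₀ e.1 c :=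
  mvfderiv_verticalLift (mdifferentiableAt_fcoord he) (a := co F m₀ e.1 e.2) fun t => by
    rw [← co_apply he, map_add, map_smul]

theorem dq_mfderiv_section (s : Cₛ^∞⟮I; F, B⟯) (m : M) (v : TangentSpace I m) :
    dq I F ⟨m, s m⟩ (mfderiv I (I.prod 𝓘(ℝ, F)) (fun m => (⟨m, s m⟩ : TotalSpace F B)) m v) =
      v := by
  rw [dq_mfderiv (g := fun m => (⟨m, s m⟩ : TotalSpace F B))
    (s.contMDiff.mdifferentiable (by simp) m)]
  exact DFunLike.congr_fun (mfderiv_id (I := I) (x := m)) v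

theorem vcoord_mfderiv_section {m₀ m : M} (hm : m ∈ (trivializationAt F B m₀).baseSet)
    (s : Cₛ^∞⟮I; F, B⟯) (v : TangentSpace I m) :
    vcoord I F m₀ ⟨m, s m⟩
        (mfderiv I (I.prod 𝓘(ℝ, F)) (fun m => (⟨m, s m⟩ : TotalSpace F B)) m v) =
      mvfderiv I (fun m => fcoord F B m₀ ⟨m, s m⟩) m v :=
  vcoord_mfderiv (g := fun m => (⟨m, s m⟩ : TotalSpace F B))
    (s.contMDiff.mdifferentiable (by simp) m) hm v

end Coordinates

/-! ### The operations of `TB → TM` in coordinates -/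

section TangentOperations

variable {E H M : Type*} [NormedAddCommGroup E] [NormedSpace ℝ E] [TopologicalSpace H]
  {I : ModelWithCorners ℝ E H} [TopologicalSpace M] [ChartedSpace H M] [IsManifold I ∞ M]
  {F : Type*} [NormedAddCommGroup F] [NormedSpace ℝ F]
  {B : M → Type*} [TopologicalSpace (TotalSpace F B)]
  [∀ m, AddCommGroup (B m)] [∀ m, Module ℝ (B m)] [∀ m, TopologicalSpace (B m)]
  [FiberBundle F B] [VectorBundle ℝ F B] [ContMDiffVectorBundle ∞ F B I]

/-- Base points that agree only propositionally make a direct comparison of tangent vectors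
heterogeneous; comparing coordinates avoids this. -/
theorem ttot_ext {m₀ m : M} (hm : m ∈ dom (H := H) F B m₀) {b b' : B m}
    {w : TangentSpace (I.prod 𝓘(ℝ, F)) (⟨m, b⟩ : TotalSpace F B)}
    {w' : TangentSpace (I.prod 𝓘(ℝ, F)) (⟨m, b'⟩ : TotalSpace F B)} (hb : b = b')
    (h : dq I F ⟨m, b⟩ w = dq I F ⟨m, b'⟩ w')
    (h' : vcoord I F m₀ ⟨m, b⟩ w = vcoord I F m₀ ⟨m, b'⟩ w') :
    (⟨⟨m, b⟩, w⟩ : TTot I F B) = ⟨⟨m, b'⟩, w'⟩ := by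
  subst hb
  rw [tangent_ext hm h h']

theorem eventually_proj_mem {U : Set M} (hU : IsOpen U) {e : TotalSpace F B} (he : e.1 ∈ U) :
    ∀ᶠ e' : TotalSpace F B in 𝓝 e, e'.1 ∈ U :=
  (FiberBundle.continuous_proj F B).continuousAt.eventually (hU.mem_nhds he)

section BundleMaps

variable {G : Type*} [NormedAddCommGroup G] [NormedSpace ℝ G]
  {V : M → Type*} [TopologicalSpace (TotalSpace G V)]
  [∀ m, AddCommGroup (V m)] [∀ m, Module ℝ (V m)] [∀ m, TopologicalSpace (V m)]
  [FiberBundle G V] [VectorBundle ℝ G V] [ContMDiffVectorBundle ∞ G V I]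

theorem mvfderiv_clm_comp {E' H' N : Type*} [NormedAddCommGroup E'] [NormedSpace ℝ E']
    [TopologicalSpace H'] {J : ModelWithCorners ℝ E' H'} [TopologicalSpace N] [ChartedSpace H' N]
    (A : G →L[ℝ] F) {f : N → G} {n : N} (hf : MDifferentiableAt J 𝓘(ℝ, G) f n)
    (v : TangentSpace J n) :
    mvfderiv J (fun n => A (f n)) n v = A (mvfderiv J f n v) := by
  have h := mfderiv_comp_apply n (A.differentiableAt (x := f n)).mdifferentiableAt hf v
  rw [mfderiv_eq_fderiv, A.fderiv] at h
  exact h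

theorem mvfderiv_congr {E' H' N : Type*} [NormedAddCommGroup E'] [NormedSpace ℝ E']
    [TopologicalSpace H'] {J : ModelWithCorners ℝ E' H'} [TopologicalSpace N] [ChartedSpace H' N]
    {f f' : N → G} {n : N} (h : f =ᶠ[𝓝 n] f') (v : TangentSpace J n) :
    mvfderiv J f n v = mvfderiv J f' n v :=
  DFunLike.congr_fun (h.mfderiv_eq (I := J) (I' := 𝓘(ℝ, G))) v

/-- `L` is a bundle map `V → B` over `M` given by the constant `A` in all preferred
trivializations. -/
def IsConstInCoords (L : ∀ m, V m → B m) (A : G →L[ℝ] F) : Prop :=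
  ∀ m₀ : M, ∀ p : TotalSpace G V, p.1 ∈ (trivializationAt G V m₀).baseSet →
    p.1 ∈ (trivializationAt F B m₀).baseSet →
    fcoord F B m₀ ⟨p.1, L p.1 p.2⟩ = A (fcoord G V m₀ p)

variable {L : ∀ m, V m → B m} {A : G →L[ℝ] F}

theorem IsConstInCoords.eventuallyEq (hL : IsConstInCoords (F := F) L A) {m₀ : M}
    {p : TotalSpace G V} (hp : p.1 ∈ (trivializationAt G V m₀).baseSet)
    (hp' : p.1 ∈ (trivializationAt F B m₀).baseSet) :
    (fun p : TotalSpace G V => fcoord F B m₀ ⟨p.1, L p.1 p.2⟩) =ᶠ[𝓝 p]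
      fun p => A (fcoord G V m₀ p) := by
  filter_upwards [eventually_proj_mem (trivializationAt G V m₀).open_baseSet hp,
    eventually_proj_mem (trivializationAt F B m₀).open_baseSet hp'] with p' h h'
  exact hL m₀ p' h h'

theorem IsConstInCoords.contMDiff (hL : IsConstInCoords (F := F) L A) :
    ContMDiff (I.prod 𝓘(ℝ, G)) (I.prod 𝓘(ℝ, F)) ∞
      (fun p : TotalSpace G V => (⟨p.1, L p.1 p.2⟩ : TotalSpace F B)) := by
  intro p
  have hp : p.1 ∈ (trivializationAt F B p.1).baseSet := mem_baseSet_trivializationAt F B p.1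
  have hp' : p.1 ∈ (trivializationAt G V p.1).baseSet := mem_baseSet_trivializationAt G V p.1
  refine (contMDiffAt_total_iff (g := fun p : TotalSpace G V => (⟨p.1, L p.1 p.2⟩ :
    TotalSpace F B)) hp).2 ⟨contMDiffAt_proj V, ?_⟩
  exact (A.contMDiff.contMDiffAt.comp p (contMDiffAt_fcoord (I := I) hp')).congr_of_eventuallyEq
    (hL.eventuallyEq hp' hp)

theorem IsConstInCoords.dq_tangentMap (hL : IsConstInCoords (F := F) L A) (w : TTot I G V) :
    dq I F ⟨w.1.1, L w.1.1 w.1.2⟩ (tangentMap (I.prod 𝓘(ℝ, G)) (I.prod 𝓘(ℝ, F))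
      (fun p : TotalSpace G V => (⟨p.1, L p.1 p.2⟩ : TotalSpace F B)) w).2 = dq I G w.1 w.2 :=
  dq_mfderiv (hL.contMDiff.mdifferentiable (by simp) w.1) w.2

/-- The chain rule for a map that is the constant linear `A` on fibre coordinates. Scalar
multiplication, both projections of `B ⊕ B` and addition are instances. -/
theorem IsConstInCoords.vcoord_tangentMap (hL : IsConstInCoords (F := F) L A) {m₀ : M}
    (w : TTot I G V) (hw : w.1.1 ∈ (trivializationAt G V m₀).baseSet)
    (hw' : w.1.1 ∈ (trivializationAt F B m₀).baseSet) :
    vcoord I F m₀ ⟨w.1.1, L w.1.1 w.1.2⟩ (tangentMap (I.prod 𝓘(ℝ, G)) (I.prod 𝓘(ℝ, F))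
      (fun p : TotalSpace G V => (⟨p.1, L p.1 p.2⟩ : TotalSpace F B)) w).2 =
      A (vcoord I G m₀ w.1 w.2) := by
  refine (vcoord_mfderiv (hL.contMDiff.mdifferentiable (by simp) w.1) hw' w.2).trans ?_
  rw [mvfderiv_congr (hL.eventuallyEq hw hw'), mvfderiv_clm_comp A (mdifferentiableAt_fcoord hw)]

end BundleMaps

theorem fcoord_smul {m₀ m : M} (hm : m ∈ (trivializationAt F B m₀).baseSet) (r : ℝ) (b : B m) :
    fcoord F B m₀ ⟨m, r • b⟩ = r • fcoord F B m₀ ⟨m, b⟩ := by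
  rw [← co_apply hm, map_smul, co_apply hm]

theorem fcoord_add {m₀ m : M} (hm : m ∈ (trivializationAt F B m₀).baseSet) (b b' : B m) :
    fcoord F B m₀ ⟨m, b + b'⟩ = fcoord F B m₀ ⟨m, b⟩ + fcoord F B m₀ ⟨m, b'⟩ := by
  rw [← co_apply hm, map_add, co_apply hm, co_apply hm]

theorem isConstInCoords_smul (r : ℝ) :
    IsConstInCoords (F := F) (G := F) (fun m (b : B m) => r • b)
      (r • ContinuousLinearMap.id ℝ F) :=
  fun _ _ hp _ => fcoord_smul hp _ _

theorem dq_tsmul (r : ℝ) (w : TTot I F B) :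
    dq I F ⟨w.1.1, r • w.1.2⟩ (tsmul I F r w).2 = dq I F w.1 w.2 :=
  (isConstInCoords_smul r).dq_tangentMap w

theorem vcoord_tsmul {m₀ : M} (r : ℝ) (w : TTot I F B)
    (hw : w.1.1 ∈ (trivializationAt F B m₀).baseSet) :
    vcoord I F m₀ ⟨w.1.1, r • w.1.2⟩ (tsmul I F r w).2 = r • vcoord I F m₀ w.1 w.2 :=
  (isConstInCoords_smul r).vcoord_tangentMap w hw hw

theorem isConstInCoords_fst :
    IsConstInCoords (V := B ×ᵇ B) (F := F) (G := F × F) (fun m (b : B m × B m) => b.1)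
      (ContinuousLinearMap.fst ℝ F F) :=
  fun _ _ _ _ => rfl

theorem isConstInCoords_snd :
    IsConstInCoords (V := B ×ᵇ B) (F := F) (G := F × F) (fun m (b : B m × B m) => b.2)
      (ContinuousLinearMap.snd ℝ F F) :=
  fun _ _ _ _ => rfl

theorem isConstInCoords_add :
    IsConstInCoords (V := B ×ᵇ B) (F := F) (G := F × F) (fun m (b : B m × B m) => b.1 + b.2)
      (ContinuousLinearMap.fst ℝ F F + ContinuousLinearMap.snd ℝ F F) :=
  fun _ _ _ hp => fcoord_add hp _ _

theorem IsTSum.exists_base {w₁ w₂ w : TTot I F B} (h : IsTSum I F w₁ w₂ w) :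
    ∃ (m : M) (b b' : B m) (z₁ : TangentSpace (I.prod 𝓘(ℝ, F)) (⟨m, b⟩ : TotalSpace F B))
      (z₂ : TangentSpace (I.prod 𝓘(ℝ, F)) (⟨m, b'⟩ : TotalSpace F B))
      (z : TangentSpace (I.prod 𝓘(ℝ, F)) (⟨m, b + b'⟩ : TotalSpace F B)),
      w₁ = ⟨⟨m, b⟩, z₁⟩ ∧ w₂ = ⟨⟨m, b'⟩, z₂⟩ ∧ w = ⟨⟨m, b + b'⟩, z⟩ := by
  obtain ⟨u, rfl, rfl, rfl⟩ := h
  exact ⟨u.1.1, u.1.2.1, u.1.2.2, _, _, _, rfl, rfl, rfl⟩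

/-- The tangent map of the fibrewise addition fixes the horizontal coordinate and adds the vertical
ones. For the converse, the witness on `B ⊕ B` is the vector with the common horizontal coordinate
and the pair of vertical ones. -/
theorem isTSum_iff {m₀ m : M} (hm : m ∈ dom (H := H) F B m₀) {b b' : B m}
    {z₁ : TangentSpace (I.prod 𝓘(ℝ, F)) (⟨m, b⟩ : TotalSpace F B)}
    {z₂ : TangentSpace (I.prod 𝓘(ℝ, F)) (⟨m, b'⟩ : TotalSpace F B)}
    {z : TangentSpace (I.prod 𝓘(ℝ, F)) (⟨m, b + b'⟩ : TotalSpace F B)} :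
    IsTSum I F ⟨⟨m, b⟩, z₁⟩ ⟨⟨m, b'⟩, z₂⟩ ⟨⟨m, b + b'⟩, z⟩ ↔
      dq I F ⟨m, b⟩ z₁ = dq I F ⟨m, b'⟩ z₂ ∧ dq I F ⟨m, b + b'⟩ z = dq I F ⟨m, b⟩ z₁ ∧
      vcoord I F m₀ ⟨m, b + b'⟩ z = vcoord I F m₀ ⟨m, b⟩ z₁ + vcoord I F m₀ ⟨m, b'⟩ z₂ := by
  have hm2 : m ∈ dom (H := H) (F × F) (B ×ᵇ B) m₀ := ⟨hm.1, hm.2, hm.2⟩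
  constructor
  · rintro ⟨⟨⟨m', c, c'⟩, u⟩, h₁, h₂, h₃⟩
    have e1 : m' = m := congrArg (fun w : TTot I F B => w.1.1) h₁
    subst e1
    have e2 : c = b := by simpa [tangentMap] using congrArg (fun w : TTot I F B => w.1) h₁
    have e3 : c' = b' := by simpa [tangentMap] using congrArg (fun w : TTot I F B => w.1) h₂
    subst e2 e3
    have k₁ := eq_of_heq (TotalSpace.mk.inj h₁).2
    have k₂ := eq_of_heq (TotalSpace.mk.inj h₂).2
    have k₃ := eq_of_heq (TotalSpace.mk.inj h₃).2
    rw [← k₁, ← k₂, ← k₃]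
    have a₁ := isConstInCoords_fst.dq_tangentMap (I := I) (F := F) (B := B) ⟨⟨m', c, c'⟩, u⟩
    have a₂ := isConstInCoords_snd.dq_tangentMap (I := I) (F := F) (B := B) ⟨⟨m', c, c'⟩, u⟩
    have a₃ := isConstInCoords_add.dq_tangentMap (I := I) (F := F) (B := B) ⟨⟨m', c, c'⟩, u⟩
    have v₁ := isConstInCoords_fst.vcoord_tangentMap (I := I) (F := F) (B := B) ⟨⟨m', c, c'⟩, u⟩
      hm2.2 hm.2
    have v₂ := isConstInCoords_snd.vcoord_tangentMap (I := I) (F := F) (B := B) ⟨⟨m', c, c'⟩, u⟩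
      hm2.2 hm.2
    have v₃ := isConstInCoords_add.vcoord_tangentMap (I := I) (F := F) (B := B) ⟨⟨m', c, c'⟩, u⟩
      hm2.2 hm.2
    refine ⟨a₁.trans a₂.symm, a₃.trans a₁.symm, v₃.trans ?_⟩
    exact (congrArg₂ (· + ·) v₁ v₂).symm
  · rintro ⟨h₁, h₂, h₃⟩
    let p : TotalSpace (F × F) (B ×ᵇ B) := ⟨m, b, b'⟩
    let u : TTot I (F × F) (B ×ᵇ B) := ⟨p, ofCoords I (F × F) (B ×ᵇ B) m₀ p
      (hco I m₀ m (dq I F ⟨m, b⟩ z₁), (vcoord I F m₀ ⟨m, b⟩ z₁, vcoord I F m₀ ⟨m, b'⟩ z₂))⟩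
    have hu : dq I (F × F) p u.2 = dq I F ⟨m, b⟩ z₁ := dq_ofCoords (e := p) hm2 _ _
    have hv : vcoord I (F × F) m₀ p u.2 = (vcoord I F m₀ ⟨m, b⟩ z₁, vcoord I F m₀ ⟨m, b'⟩ z₂) :=
      vcoord_ofCoords (e := p) hm2 _
    refine ⟨u, ?_, ?_, ?_⟩
    · refine ttot_ext hm rfl ((isConstInCoords_fst.dq_tangentMap u).trans hu) ?_
      exact (isConstInCoords_fst.vcoord_tangentMap u hm2.2 hm.2).trans (congrArg Prod.fst hv)
    · refine ttot_ext hm rfl ((isConstInCoords_snd.dq_tangentMap u).trans (hu.trans h₁)) ?_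
      exact (isConstInCoords_snd.vcoord_tangentMap u hm2.2 hm.2).trans (congrArg Prod.snd hv)
    · refine ttot_ext hm rfl ((isConstInCoords_add.dq_tangentMap u).trans (hu.trans h₂.symm)) ?_
      refine (isConstInCoords_add.vcoord_tangentMap u hm2.2 hm.2).trans (Eq.trans ?_ h₃.symm)
      exact congrArg (fun q : F × F => q.1 + q.2) hv

end TangentOperations

/-! ### Smooth families of idempotents and smooth subbundles -/

section SmoothFamilies

variable {EN HN N : Type*} [NormedAddCommGroup EN] [NormedSpace ℝ EN] [TopologicalSpace HN]
  {J : ModelWithCorners ℝ EN HN} [TopologicalSpace N] [ChartedSpace HN N]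

/-- A smooth family of endomorphisms that is invertible at a point has a smooth inverse nearby. -/
theorem exists_smooth_inverse {W : Type*} [NormedAddCommGroup W] [NormedSpace ℝ W]
    [CompleteSpace W] {G : N → W →L[ℝ] W} {U : Set N} (hU : IsOpen U)
    (hG : ContMDiffOn J 𝓘(ℝ, W →L[ℝ] W) ∞ G U) {x₀ : N} (hx₀ : x₀ ∈ U) (h : IsUnit (G x₀)) :
    ∃ U' ⊆ U, IsOpen U' ∧ x₀ ∈ U' ∧ ∃ K : N → W →L[ℝ] W,
      ContMDiffOn J 𝓘(ℝ, W →L[ℝ] W) ∞ K U' ∧ ∀ x ∈ U', G x * K x = 1 ∧ K x * G x = 1 := by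
  refine ⟨U ∩ G ⁻¹' {T | IsUnit T}, inter_subset_left,
    hG.continuousOn.isOpen_inter_preimage hU Units.isOpen, ⟨hx₀, h⟩,
    fun x => Ring.inverse (G x), ?_, fun x hx => ⟨Ring.mul_inverse_cancel _ hx.2,
      Ring.inverse_mul_cancel _ hx.2⟩⟩
  intro x hx
  obtain ⟨u, hu⟩ := hx.2
  have h1 : ContDiffAt ℝ ∞ (Ring.inverse : (W →L[ℝ] W) → W →L[ℝ] W) (G x) :=
    hu ▸ contDiffAt_ringInverse ℝ u
  exact (h1.contMDiffAt.comp_contMDiffWithinAt x ((hG x hx.1).mono inter_subset_left))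

variable {F : Type*} [NormedAddCommGroup F] [NormedSpace ℝ F] [FiniteDimensional ℝ F]

/-- A smooth family of injective maps on `ℝ^k` is locally the kernel of a smooth family of
idempotents complementary to it. -/
theorem exists_projector_of_injective {k : ℕ} {S : N → (Fin k → ℝ) →L[ℝ] F} {U : Set N}
    (hU : IsOpen U) (hS : ContMDiffOn J 𝓘(ℝ, (Fin k → ℝ) →L[ℝ] F) ∞ S U) {x₀ : N} (hx₀ : x₀ ∈ U)
    (h : Function.Injective (S x₀)) :
    ∃ U' ⊆ U, IsOpen U' ∧ x₀ ∈ U' ∧ ∃ P : N → F →L[ℝ] F,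
      ContMDiffOn J 𝓘(ℝ, F →L[ℝ] F) ∞ P U' ∧
      ∀ x ∈ U', P x * P x = P x ∧ ∀ y, P x y = y ↔ ∃ a, S x a = y := by
  -- A left inverse `T` of `S x₀` makes `T S_x` invertible for `x` near `x₀`; then `P = S (T S)⁻¹ T`
  -- is idempotent with the range of `S`.
  obtain ⟨T', hT'⟩ := (S x₀ : (Fin k → ℝ) →ₗ[ℝ] F).exists_leftInverse_of_injective
    (LinearMap.ker_eq_bot.2 h)
  let T : F →L[ℝ] (Fin k → ℝ) := LinearMap.toContinuousLinearMap T'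
  have hT : ∀ a, T (S x₀ a) = a := fun a => DFunLike.congr_fun hT' a
  have hG : ContMDiffOn J 𝓘(ℝ, (Fin k → ℝ) →L[ℝ] (Fin k → ℝ)) ∞ (fun x => T ∘L S x) U :=
    contMDiffOn_const.clm_comp hS
  obtain ⟨U', hU'U, hU', hx, K, hK, hKG⟩ := exists_smooth_inverse hU hG hx₀ (by
    have : T ∘L S x₀ = 1 := by ext1 a; exact hT a
    rw [this]
    exact isUnit_one)
  refine ⟨U', hU'U, hU', hx, fun x => S x ∘L K x ∘L T,
    (hS.mono hU'U).clm_comp (hK.clm_comp contMDiffOn_const), fun x hx => ?_⟩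
  have hKS : ∀ a, K x (T (S x a)) = a := fun a => DFunLike.congr_fun (hKG x hx).2 a
  refine ⟨by ext y; simp [hKS], fun y => ⟨fun hy => ⟨K x (T y), hy⟩, ?_⟩⟩
  rintro ⟨a, rfl⟩
  simp [hKS]

/-- A smooth family of idempotents is locally conjugate to a constant one. -/
theorem exists_conj_projector {P : N → F →L[ℝ] F} {U : Set N} (hU : IsOpen U)
    (hP : ContMDiffOn J 𝓘(ℝ, F →L[ℝ] F) ∞ P U) (hPP : ∀ x ∈ U, P x * P x = P x) {x₀ : N}
    (hx₀ : x₀ ∈ U) :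
    ∃ U' ⊆ U, IsOpen U' ∧ x₀ ∈ U' ∧ ∃ g k : N → F →L[ℝ] F,
      ContMDiffOn J 𝓘(ℝ, F →L[ℝ] F) ∞ g U' ∧ ContMDiffOn J 𝓘(ℝ, F →L[ℝ] F) ∞ k U' ∧
      ∀ x ∈ U', g x * k x = 1 ∧ k x * g x = 1 ∧ P x * g x = g x * P x₀ := by
  have := FiniteDimensional.complete ℝ F
  -- The standard intertwiner `P P₀ + (1 - P)(1 - P₀)`: it is the identity at `x₀`, so invertible
  -- nearby, and carries the range of `P₀` to that of `P`.
  have hg : ContMDiffOn J 𝓘(ℝ, F →L[ℝ] F) ∞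
      (fun x => P x ∘L P x₀ + (1 - P x) ∘L (1 - P x₀)) U :=
    (hP.clm_comp contMDiffOn_const).add ((contMDiffOn_const.sub hP).clm_comp contMDiffOn_const)
  obtain ⟨U', hU'U, hU', hx, k, hk, hgk⟩ := exists_smooth_inverse hU hg hx₀ (by
    have : P x₀ ∘L P x₀ + (1 - P x₀) ∘L (1 - P x₀) = 1 := by
      change P x₀ * P x₀ + (1 - P x₀) * (1 - P x₀) = 1
      have := hPP x₀ hx₀
      rw [mul_sub, sub_mul, sub_mul, this]
      simp
    rw [this]
    exact isUnit_one)
  refine ⟨U', hU'U, hU', hx, _, k, hg.mono hU'U, hk, fun x hx => ⟨(hgk x hx).1, (hgk x hx).2, ?_⟩⟩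
  change P x * (P x * P x₀ + (1 - P x) * (1 - P x₀)) = (P x * P x₀ + (1 - P x) * (1 - P x₀)) * P x₀
  have h1 := hPP x (hU'U hx)
  have h0 := hPP x₀ hx₀
  have h2 : P x * (1 - P x) = 0 := by rw [mul_sub, h1, mul_one, sub_self]
  have h3 : (1 - P x₀) * P x₀ = 0 := by rw [sub_mul, h0, one_mul, sub_self]
  rw [mul_add, ← mul_assoc, h1, ← mul_assoc, h2, zero_mul, add_mul, mul_assoc, h0, mul_assoc, h3,
    mul_zero]

/-- If the maps `A x` have the same range as the idempotents `P x`, then `A` has a smooth right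
inverse over that range. -/
theorem exists_smooth_rightInverse {G : Type*} [NormedAddCommGroup G] [NormedSpace ℝ G]
    {A : N → G →L[ℝ] F} {P : N → F →L[ℝ] F} {U : Set N} (hU : IsOpen U)
    (hA : ContMDiffOn J 𝓘(ℝ, G →L[ℝ] F) ∞ A U)
    (hP : ContMDiffOn J 𝓘(ℝ, F →L[ℝ] F) ∞ P U) (hPP : ∀ x ∈ U, P x * P x = P x)
    (hPA : ∀ x ∈ U, P x ∘L A x = A x) {x₀ : N} (hx₀ : x₀ ∈ U) (hAP : ∀ y, ∃ z, A x₀ z = P x₀ y) :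
    ∃ U' ⊆ U, IsOpen U' ∧ x₀ ∈ U' ∧ ∃ R : N → F →L[ℝ] G,
      ContMDiffOn J 𝓘(ℝ, F →L[ℝ] G) ∞ R U' ∧ ∀ x ∈ U', A x ∘L R x ∘L P x = P x := by
  have := FiniteDimensional.complete ℝ F
  let bF := Module.finBasis ℝ F
  choose z hz using hAP
  -- `R₀` solves `A R₀ = P` at `x₀` alone. Nearby, `g = A R₀ P + (1 - P)` is invertible, and `R₀ P
  -- g⁻¹` corrects `R₀` smoothly.
  let R₀ : F →L[ℝ] G := LinearMap.toContinuousLinearMap (bF.constr ℝ fun i => z (bF i))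
  have hR₀ : A x₀ ∘L R₀ = P x₀ := by
    ext y
    have : (A x₀ : G →ₗ[ℝ] F) ∘ₗ (R₀ : F →ₗ[ℝ] G) = (P x₀ : F →ₗ[ℝ] F) :=
      bF.ext fun i => by simp [R₀, hz]
    exact DFunLike.congr_fun this y
  have hg : ContMDiffOn J 𝓘(ℝ, F →L[ℝ] F) ∞ (fun x => A x ∘L R₀ ∘L P x + (1 - P x)) U :=
    (hA.clm_comp (contMDiffOn_const.clm_comp hP)).add (contMDiffOn_const.sub hP)
  obtain ⟨U', hU'U, hU', hx, k, hk, hgk⟩ := exists_smooth_inverse hU hg hx₀ (by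
    have : A x₀ ∘L R₀ ∘L P x₀ + (1 - P x₀) = 1 := by
      rw [← ContinuousLinearMap.comp_assoc, hR₀]
      change P x₀ * P x₀ + (1 - P x₀) = 1
      rw [hPP x₀ hx₀]
      simp
    rw [this]
    exact isUnit_one)
  refine ⟨U', hU'U, hU', hx, fun x => R₀ ∘L P x ∘L k x,
    contMDiffOn_const.clm_comp ((hP.mono hU'U).clm_comp hk), fun x hx => ?_⟩
  set g : F →L[ℝ] F := A x ∘L R₀ ∘L P x + (1 - P x) with hgdef
  have hp := hPP x (hU'U hx)
  have hgP : g * P x = A x ∘L R₀ ∘L P x := by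
    rw [hgdef, add_mul, sub_mul, hp]
    ext y
    have := DFunLike.congr_fun hp y
    simp only [mul_apply_eq_comp] at this
    simp [this]
  have hPg : P x * g = A x ∘L R₀ ∘L P x := by
    rw [hgdef, mul_add, mul_sub, hp]
    ext y
    have := DFunLike.congr_fun (hPA x (hU'U hx)) (R₀ (P x y))
    simpa using this
  -- Both `g P` and `P g` equal `A R₀ P`, so `g` commutes with `P`, and so does its inverse `k`.
  have hkP : k x * P x = P x * k x := by
    calc k x * P x = k x * P x * (g * k x) := by rw [(hgk x hx).1, mul_one]
      _ = k x * (P x * g) * k x := by simp only [mul_assoc]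
      _ = (k x * g) * P x * k x := by rw [hPg, ← hgP]; simp only [mul_assoc]
      _ = P x * k x := by rw [(hgk x hx).2, one_mul]
  calc A x ∘L (R₀ ∘L P x ∘L k x) ∘L P x = (A x ∘L R₀ ∘L P x) * (k x * P x) := rfl
    _ = g * P x * (P x * k x) := by rw [hkP, hgP]
    _ = g * (P x * P x) * k x := by simp only [mul_assoc]
    _ = P x * (g * k x) := by rw [hp, hgP, ← hPg, mul_assoc]
    _ = P x := by rw [(hgk x hx).1, mul_one]

section Subbundles

variable {V : N → Type*} [TopologicalSpace (TotalSpace F V)]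
  [∀ x, AddCommGroup (V x)] [∀ x, Module ℝ (V x)] [∀ x, TopologicalSpace (V x)]
  [FiberBundle F V] [VectorBundle ℝ F V] [ContMDiffVectorBundle ∞ F V J]

theorem contMDiffOn_section_co {x₀ : N} {U : Set N} (hU : IsOpen U)
    (hU' : U ⊆ (trivializationAt F V x₀).baseSet) {s : ∀ x, V x} :
    ContMDiffOn J (J.prod 𝓘(ℝ, F)) ∞ (fun x => TotalSpace.mk' F x (s x)) U ↔
      ContMDiffOn J 𝓘(ℝ, F) ∞ (fun x => co F x₀ x (s x)) U := by
  rw [(trivializationAt F V x₀).contMDiffOn_section_iff hU hU']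
  exact contMDiffOn_congr fun x hx => (co_apply (hU' hx) (s x)).symm

/-- A smooth vector subbundle is locally the range of a smooth family of idempotents, in the
coordinates of the trivialization at the point. -/
theorem IsSmoothSubbundle.exists_projector {S : ∀ x, Submodule ℝ (V x)}
    (hS : IsSmoothSubbundle J F V S) (x₀ : N) :
    ∃ U : Set N, IsOpen U ∧ x₀ ∈ U ∧ U ⊆ (trivializationAt F V x₀).baseSet ∧
      ∃ P : N → F →L[ℝ] F, ContMDiffOn J 𝓘(ℝ, F →L[ℝ] F) ∞ P U ∧
      ∀ x ∈ U, P x * P x = P x ∧ ∀ v, v ∈ S x ↔ P x (co F x₀ x v) = co F x₀ x v := by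
  obtain ⟨U, hU, hx₀, k, s, hs, hsS⟩ := hS x₀
  set U₁ := U ∩ (trivializationAt F V x₀).baseSet with hU₁
  have hU₁o : IsOpen U₁ := hU.inter (trivializationAt F V x₀).open_baseSet
  let A : N → (Fin k → ℝ) →L[ℝ] F := fun x =>
    ∑ i, (ContinuousLinearMap.proj i : (Fin k → ℝ) →L[ℝ] ℝ).smulRight (co F x₀ x (s i x))
  have hA : ∀ x a, A x a = co F x₀ x (∑ i, a i • s i x) := fun x a => by
    simp [A, map_sum]
  have hinj : ∀ x ∈ U₁, Function.Injective (co F x₀ x : V x → F) := fun x hx y z h => by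
    rw [← coSymm_co hx.2 y, h, coSymm_co hx.2]
  have hAs : ContMDiffOn J 𝓘(ℝ, (Fin k → ℝ) →L[ℝ] F) ∞ A U₁ := by
    refine contMDiffOn_finsetSum fun i _ => ?_
    have h1 := (contMDiffOn_section_co (J := J) hU₁o inter_subset_right).1
      ((hs i).mono inter_subset_left)
    exact (((ContinuousLinearMap.smulRightL ℝ (Fin k → ℝ) F)
      (ContinuousLinearMap.proj i : (Fin k → ℝ) →L[ℝ] ℝ)).contMDiff).comp_contMDiffOn h1
  have hx₁ : x₀ ∈ U₁ := ⟨hx₀, mem_baseSet_trivializationAt F V x₀⟩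
  obtain ⟨U', hU'U, hU', hx, P, hP, h⟩ := exists_projector_of_injective hU₁o hAs hx₁ (by
    rw [← ContinuousLinearMap.coe_coe, ← LinearMap.ker_eq_bot, LinearMap.ker_eq_bot']
    intro a ha
    have h0 : ∑ i, a i • s i x₀ = 0 := hinj x₀ hx₁ (by
      rw [← hA, map_zero]
      exact ha)
    funext i
    exact Fintype.linearIndependent_iff.1 (hsS x₀ hx₀).1 a h0 i)
  refine ⟨U', hU', hx, fun x hx => (hU'U hx).2, P, hP, fun x hx => ⟨(h x hx).1, fun v => ?_⟩⟩
  rw [(h x hx).2, ← (hsS x (hU'U hx).1).2, Submodule.mem_span_range_iff_exists_fun]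
  exact exists_congr fun a => ⟨fun h => by rw [hA, h], fun h => hinj x (hU'U hx) (by rw [← hA, h])⟩

/-- Conjugating the idempotents to the one at `x₀` turns a basis of the fixed range of `P x₀` into a
smooth frame of the moving ranges. -/
theorem IsSmoothSubbundle.of_projector {S : ∀ x, Submodule ℝ (V x)}
    (h : ∀ x₀ : N, ∃ x₁ : N, ∃ U : Set N, IsOpen U ∧ x₀ ∈ U ∧
      U ⊆ (trivializationAt F V x₁).baseSet ∧
      ∃ P : N → F →L[ℝ] F, ContMDiffOn J 𝓘(ℝ, F →L[ℝ] F) ∞ P U ∧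
      ∀ x ∈ U, P x * P x = P x ∧ ∀ v, v ∈ S x ↔ P x (co F x₁ x v) = co F x₁ x v) :
    IsSmoothSubbundle J F V S := by
  intro x₀
  obtain ⟨x₁, U₁, hU₁, hx₁, hUb, P, hP, hPS⟩ := h x₀
  obtain ⟨U, hUU₁, hU, hx₀, g, k, hg, hk, hgk⟩ :=
    exists_conj_projector hU₁ hP (fun x hx => (hPS x hx).1) hx₁
  let R := LinearMap.range (P x₀ : F →ₗ[ℝ] F)
  let bR := Module.finBasis ℝ R
  have hbR : ∀ i, P x₀ (bR i) = bR i := fun i => by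
    obtain ⟨y, hy⟩ := (bR i).2
    rw [← hy]
    exact DFunLike.congr_fun (hPS x₀ hx₁).1 y
  refine ⟨U, hU, hx₀, Module.finrank ℝ R, fun i x => coSymm F V x₁ x (g x (bR i)), fun i => ?_,
    fun x hx => ?_⟩
  · rw [contMDiffOn_section_co hU (hUU₁.trans hUb)]
    refine (hg.clm_apply (contMDiffOn_const (c := (bR i : F)))).congr fun x hx => ?_
    rw [co_coSymm (hUb (hUU₁ hx))]
  · have hxb := hUb (hUU₁ hx)
    have hkg : ∀ y, k x (g x y) = y := fun y => DFunLike.congr_fun (hgk x hx).2.1 y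
    have hgk' : ∀ y, g x (k x y) = y := fun y => DFunLike.congr_fun (hgk x hx).1 y
    have hPg : ∀ y, P x (g x y) = g x (P x₀ y) := fun y => DFunLike.congr_fun (hgk x hx).2.2 y
    let T : R →ₗ[ℝ] V x := ((coSymm F V x₁ x : F →ₗ[ℝ] V x) ∘ₗ (g x : F →ₗ[ℝ] F)) ∘ₗ R.subtype
    constructor
    · have hT : Function.Injective T := fun y z hyz => by
        have : coSymm F V x₁ x (g x y) = coSymm F V x₁ x (g x z) := hyz
        have := congrArg (co F x₁ x) this
        rw [co_coSymm hxb, co_coSymm hxb] at this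
        exact Subtype.ext (by rw [← hkg y, this, hkg])
      exact bR.linearIndependent.map' T (LinearMap.ker_eq_bot.2 hT)
    · apply le_antisymm
      · rw [Submodule.span_le]
        rintro _ ⟨i, rfl⟩
        refine ((hPS x (hUU₁ hx)).2 _).2 ?_
        rw [co_coSymm hxb, hPg, hbR]
      · intro v hv
        have hv' := ((hPS x (hUU₁ hx)).2 v).1 hv
        have hc : P x₀ (k x (co F x₁ x v)) = k x (co F x₁ x v) := by
          rw [← hkg (P x₀ _), ← hPg, hgk', hv']
        let c : R := ⟨k x (co F x₁ x v), _, hc⟩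
        rw [Submodule.mem_span_range_iff_exists_fun]
        refine ⟨bR.repr c, ?_⟩
        have hTc : T c = v := by
          change coSymm F V x₁ x (g x (k x (co F x₁ x v))) = v
          rw [hgk', coSymm_co hxb]
        change ∑ i, bR.repr c i • T (bR i) = v
        rw [← hTc]
        simp only [← map_smul, ← map_sum, bR.sum_repr]

end Subbundles

end SmoothFamilies

/-! ### Parametrization of the fibres of `TB → TM` -/

section Parametrization

variable {E H M : Type*} [NormedAddCommGroup E] [NormedSpace ℝ E] [TopologicalSpace H]
  {I : ModelWithCorners ℝ E H} [TopologicalSpace M] [ChartedSpace H M] [IsManifold I ∞ M]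
  {F : Type*} [NormedAddCommGroup F] [NormedSpace ℝ F]
  {B : M → Type*} [TopologicalSpace (TotalSpace F B)]
  [∀ m, AddCommGroup (B m)] [∀ m, Module ℝ (B m)] [∀ m, TopologicalSpace (B m)]
  [FiberBundle F B] [VectorBundle ℝ F B] [ContMDiffVectorBundle ∞ F B I]

theorem fcoord_coSymm {m₀ m : M} (hm : m ∈ (trivializationAt F B m₀).baseSet) (y : F) :
    fcoord F B m₀ ⟨m, coSymm F B m₀ m y⟩ = y := by
  rw [← co_apply hm, co_coSymm hm]

theorem contMDiffAt_hco {m₀ : M} {v : TangentBundle I M} (hv : v.1 ∈ (chartAt H m₀).source) :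
    ContMDiffAt I.tangent 𝓘(ℝ, E) ∞ (fun v : TangentBundle I M => hco I m₀ v.1 v.2) v := by
  have hv' : v.1 ∈ (trivializationAt E (TangentSpace I : M → Type _) m₀).baseSet := by
    simpa using hv
  refine (contMDiffAt_fcoord (I := I) (F := E) (B := (TangentSpace I : M → Type _))
    hv').congr_of_eventuallyEq ?_
  filter_upwards [eventually_proj_mem
    (trivializationAt E (TangentSpace I : M → Type _) m₀).open_baseSet hv'] with v' hv''
  exact co_apply (B := (TangentSpace I : M → Type _)) hv'' v'.2

variable (F B) in
/-- The vector of `TB` over `v ∈ TM` with fibre coordinates `b` and vertical coordinates `u` with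
respect to the preferred trivialization at `m₀`. -/
def par (m₀ : M) (v : TangentBundle I M) (b u : F) : TTot I F B :=
  ⟨⟨v.1, coSymm F B m₀ v.1 b⟩,
    ofCoords I F B m₀ ⟨v.1, coSymm F B m₀ v.1 b⟩ (hco I m₀ v.1 v.2, u)⟩

variable {m₀ : M} {v : TangentBundle I M} (hv : v.1 ∈ dom (H := H) F B m₀)

include hv

theorem dq_par (b u : F) : dq I F ⟨v.1, coSymm F B m₀ v.1 b⟩ (par F B m₀ v b u).2 = v.2 :=
  dq_ofCoords (e := ⟨v.1, _⟩) hv _ _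

theorem vcoord_par (b u : F) :
    vcoord I F m₀ (par F B m₀ v b u).1 (par F B m₀ v b u).2 = u :=
  vcoord_ofCoords (e := ⟨v.1, _⟩) hv _

theorem tproj_par (b u : F) : tproj I F B (par F B m₀ v b u) = v :=
  congrArg (fun z => (⟨v.1, z⟩ : TangentBundle I M)) (dq_par hv b u)

theorem fcoord_par (b u : F) : fcoord F B m₀ (par F B m₀ v b u).1 = b := fcoord_coSymm hv.2 b

theorem isTSum_par (b u b' u' : F) : IsTSum I F (par F B m₀ v b u) (par F B m₀ v b' u')
    (par F B m₀ v (b + b') (u + u')) := by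
  have h : par F B m₀ v (b + b') (u + u') = ⟨⟨v.1, coSymm F B m₀ v.1 b + coSymm F B m₀ v.1 b'⟩,
      ofCoords I F B m₀ _ (hco I m₀ v.1 v.2, u + u')⟩ :=
    ttot_ext hv (map_add _ _ _)
      (by rw [dq_ofCoords (e := ⟨v.1, _⟩) hv, dq_ofCoords (e := ⟨v.1, _⟩) hv])
      (by rw [vcoord_ofCoords (e := ⟨v.1, _⟩) hv, vcoord_ofCoords (e := ⟨v.1, _⟩) hv])
  rw [h]
  refine (isTSum_iff hv).2 ⟨?_, ?_, ?_⟩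
  · rw [dq_ofCoords (e := ⟨v.1, _⟩) hv, dq_ofCoords (e := ⟨v.1, _⟩) hv]
  · rw [dq_ofCoords (e := ⟨v.1, _⟩) hv, dq_ofCoords (e := ⟨v.1, _⟩) hv]
  · rw [vcoord_ofCoords (e := ⟨v.1, _⟩) hv, vcoord_ofCoords (e := ⟨v.1, _⟩) hv,
      vcoord_ofCoords (e := ⟨v.1, _⟩) hv]

theorem tsmul_par (r : ℝ) (b u : F) :
    tsmul I F r (par F B m₀ v b u) = par F B m₀ v (r • b) (r • u) := by
  refine ttot_ext hv (map_smul _ _ _).symm ?_ ?_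
  · exact (dq_tsmul r (par F B m₀ v b u)).trans ((dq_par hv _ _).trans (dq_par hv _ _).symm)
  · refine (vcoord_tsmul (m₀ := m₀) r (par F B m₀ v b u) hv.2).trans ?_
    rw [vcoord_par hv]
    exact (vcoord_par hv _ _).symm

omit hv in
theorem par_eta {w : TTot I F B} (hw : w.1.1 ∈ dom (H := H) F B m₀) :
    par F B m₀ (tproj I F B w) (fcoord F B m₀ w.1) (vcoord I F m₀ w.1 w.2) = w := by
  have hv' : (tproj I F B w).1 ∈ dom (H := H) F B m₀ := hw
  refine ttot_ext (b' := w.1.2) (w' := w.2) hw ?_ (dq_par hv' _ _) (vcoord_par hv' _ _)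
  change coSymm F B m₀ w.1.1 _ = _
  rw [← co_apply hw.2]
  exact coSymm_co hw.2 _

omit hv in
theorem contMDiffAt_par {E' H' N : Type*} [NormedAddCommGroup E'] [NormedSpace ℝ E']
    [TopologicalSpace H'] {J : ModelWithCorners ℝ E' H'} [TopologicalSpace N] [ChartedSpace H' N]
    {f : N → TangentBundle I M} {b u : N → F} {n : N} (hn : (f n).1 ∈ dom (H := H) F B m₀)
    (hf : ContMDiffAt J I.tangent ∞ f n) (hb : ContMDiffAt J 𝓘(ℝ, F) ∞ b n)
    (hu : ContMDiffAt J 𝓘(ℝ, F) ∞ u n) :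
    ContMDiffAt J (I.prod 𝓘(ℝ, F)).tangent ∞ (fun n => par F B m₀ (f n) (b n) (u n)) n := by
  have hfp : ContMDiffAt J I ∞ (fun n => (f n).1) n :=
    (contMDiffAt_proj (TangentSpace I : M → Type _)).comp n hf
  have hev : ∀ᶠ n' in 𝓝 n, (f n').1 ∈ dom (H := H) F B m₀ :=
    hfp.continuousAt.eventually ((isOpen_dom m₀).mem_nhds hn)
  refine (contMDiffAt_ttot_iff (m₀ := m₀) hn).2 ⟨?_, ?_, ?_⟩
  · refine (contMDiffAt_total_iff (m₀ := m₀) hn.2).2 ⟨hfp, hb.congr_of_eventuallyEq ?_⟩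
    filter_upwards [hev] with n' hn'
    exact fcoord_par hn' _ _
  · refine ((contMDiffAt_hco hn.1).comp n hf).congr_of_eventuallyEq ?_
    filter_upwards [hev] with n' hn'
    exact congrArg (hco I m₀ (f n').1) (dq_par hn' _ _)
  · refine hu.congr_of_eventuallyEq ?_
    filter_upwards [hev] with n' hn'
    exact vcoord_par hn' _ _

end Parametrization

/-! ### From local bilinear forms to linear distributions -/

section LocalForm

variable {E H M : Type*} [NormedAddCommGroup E] [NormedSpace ℝ E] [TopologicalSpace H]
  {I : ModelWithCorners ℝ E H} [TopologicalSpace M] [ChartedSpace H M] [IsManifold I ∞ M]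
  {F : Type*} [NormedAddCommGroup F] [NormedSpace ℝ F]
  {B : M → Type*} [TopologicalSpace (TotalSpace F B)]
  [∀ m, AddCommGroup (B m)] [∀ m, Module ℝ (B m)] [∀ m, TopologicalSpace (B m)]
  [FiberBundle F B] [VectorBundle ℝ F B] [ContMDiffVectorBundle ∞ F B I]

variable {ΔM : ∀ m : M, Submodule ℝ (TangentSpace I m)} {C : ∀ m, Submodule ℝ (B m)}

/-- Near `m₀`, the family `S` consists of the vectors with horizontal part `v` in `ΔM` and
vertical part in `-ℓ(v, b) + C`, for a smooth family `ℓ` of bilinear maps. -/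
def HasLocalForm (ΔM : ∀ m : M, Submodule ℝ (TangentSpace I m)) (C : ∀ m, Submodule ℝ (B m))
    (S : ∀ e : TotalSpace F B, Submodule ℝ (TangentSpace (I.prod 𝓘(ℝ, F)) e)) (m₀ : M) : Prop :=
  ∃ U : Set M, IsOpen U ∧ m₀ ∈ U ∧ U ⊆ dom (H := H) F B m₀ ∧ ∃ ℓ : M → F →L[ℝ] E →L[ℝ] F,
    ContMDiffOn I 𝓘(ℝ, F →L[ℝ] E →L[ℝ] F) ∞ ℓ U ∧
    ∀ e : TotalSpace F B, e.1 ∈ U → ∀ w, w ∈ S e ↔ dq I F e w ∈ ΔM e.1 ∧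
      coSymm F B m₀ e.1 (vcoord I F m₀ e w +
        ℓ e.1 (fcoord F B m₀ e) (hco I m₀ e.1 (dq I F e w))) ∈ C e.1

variable [FiniteDimensional ℝ E] [FiniteDimensional ℝ F]
  {S : ∀ e : TotalSpace F B, Submodule ℝ (TangentSpace (I.prod 𝓘(ℝ, F)) e)}

-- The shear `(y, u) ↦ (y, u + ℓ(b)(y))` carries `S` to `ΔM × C`. The idempotent `R` is the
-- conjugate of `P × Q` by this shear, where `P` and `Q` project to `ΔM` and `C`.
set_option synthInstance.maxHeartbeats 200000 in
theorem HasLocalForm.isSmoothSubbundle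
    (hΔM : IsSmoothSubbundle I E (TangentSpace I : M → Type _) ΔM)
    (hC : IsSmoothSubbundle I F B C) (hS : ∀ m₀, HasLocalForm ΔM C S m₀) :
    IsSmoothSubbundle (I.prod 𝓘(ℝ, F)) (E × F)
      (fun e : TotalSpace F B => TangentSpace (I.prod 𝓘(ℝ, F)) e) S := by
  refine IsSmoothSubbundle.of_projector fun e₀ => ?_
  obtain ⟨U, hU, hmU, hUd, ℓ, hℓ, hSℓ⟩ := hS e₀.1
  obtain ⟨U₁, hU₁, hmU₁, hU₁d, P, hP, hPM⟩ := hΔM.exists_projector e₀.1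
  obtain ⟨U₂, hU₂, hmU₂, hU₂d, Q, hQ, hQC⟩ := hC.exists_projector e₀.1
  let W : Set (TotalSpace F B) := TotalSpace.proj ⁻¹' (U ∩ U₁ ∩ U₂)
  have hWo : IsOpen W := ((hU.inter hU₁).inter hU₂).preimage (FiberBundle.continuous_proj F B)
  let Λ : TotalSpace F B → E →L[ℝ] F := fun e => ℓ e.1 (fcoord F B e₀.1 e)
  let R : TotalSpace F B → E × F →L[ℝ] E × F := fun e =>
    ContinuousLinearMap.inl ℝ E F ∘L P e.1 ∘L ContinuousLinearMap.fst ℝ E F +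
    ContinuousLinearMap.inr ℝ E F ∘L (Q e.1 ∘L
      (ContinuousLinearMap.snd ℝ E F + Λ e ∘L ContinuousLinearMap.fst ℝ E F) -
      Λ e ∘L P e.1 ∘L ContinuousLinearMap.fst ℝ E F)
  have hR : ∀ e v u, R e (v, u) = (P e.1 v, Q e.1 (u + ℓ e.1 (fcoord F B e₀.1 e) v) -
      ℓ e.1 (fcoord F B e₀.1 e) (P e.1 v)) := fun e v u => by
    simp [R, Λ]
  have hproj : ContMDiffOn (I.prod 𝓘(ℝ, F)) I ∞ (TotalSpace.proj : TotalSpace F B → M) W :=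
    contMDiffOn_proj B
  have hPs := hP.comp hproj (fun e he => he.1.2)
  have hQs := hQ.comp hproj (fun e he => he.2)
  have hΛs : ContMDiffOn (I.prod 𝓘(ℝ, F)) 𝓘(ℝ, E →L[ℝ] F) ∞ Λ W := by
    exact (hℓ.comp hproj (fun e he => he.1.1)).clm_apply fun e he =>
      (contMDiffAt_fcoord (hUd he.1.1).2).contMDiffWithinAt
  have hRs : ContMDiffOn (I.prod 𝓘(ℝ, F)) 𝓘(ℝ, E × F →L[ℝ] E × F) ∞ R W :=
    (contMDiffOn_const.clm_comp (hPs.clm_comp contMDiffOn_const)).add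
      (contMDiffOn_const.clm_comp ((hQs.clm_comp (contMDiffOn_const.add
        (hΛs.clm_comp contMDiffOn_const))).sub (hΛs.clm_comp (hPs.clm_comp contMDiffOn_const))))
  refine ⟨e₀, W, hWo, ⟨⟨hmU, hmU₁⟩, hmU₂⟩, fun e he => ?_, R, hRs, fun e he => ⟨?_, fun w => ?_⟩⟩
  · simpa using mem_chart_source_total.2 (hUd he.1.1)
  · have hPP : ∀ y, P e.1 (P e.1 y) = P e.1 y := DFunLike.congr_fun (hPM e.1 he.1.2).1
    have hQQ : ∀ y, Q e.1 (Q e.1 y) = Q e.1 y := DFunLike.congr_fun (hQC e.1 he.2).1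
    refine ContinuousLinearMap.ext fun ⟨v, u⟩ => ?_
    change R e (R e (v, u)) = R e (v, u)
    rw [hR, hR, hPP, sub_add_cancel, hQQ]
  · rw [hSℓ e he.1.1, hco_total (hUd he.1.1).1 (hUd he.1.1).2, hR,
      (hPM e.1 he.1.2).2, (hQC e.1 he.2).2, co_coSymm (hUd he.1.1).2, Prod.mk.injEq]
    refine and_congr_right fun h => ?_
    rw [h, sub_eq_iff_eq_add]

-- The fibre of `S` over `v` is parametrized by `b ∈ F` and `c ∈ C_m`, with vertical coordinate `c -
-- ℓ(b)(v)`. The conjugation `g` identifies `C_m` with the fixed space `R`, so the model fibre is `F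
-- × R`.
set_option synthInstance.maxHeartbeats 200000 in
theorem HasLocalForm.locally_trivial
    (hC : IsSmoothSubbundle I F B C) (hS : ∀ m₀, HasLocalForm ΔM C S m₀)
    (m₀ : M) :
    ∃ U : Set M, IsOpen U ∧ m₀ ∈ U ∧
    ∃ (k : ℕ) (Φ : TangentBundle I M × (Fin k → ℝ) → TTot I F B),
      ContMDiffOn (I.tangent.prod 𝓘(ℝ, Fin k → ℝ)) (I.prod 𝓘(ℝ, F)).tangent ∞ Φ
        ((TotalSpace.proj ⁻¹' U) ×ˢ univ) ∧
      ∀ v : TangentBundle I M, v.1 ∈ U → v.2 ∈ ΔM v.1 →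
        BijOn (fun a => Φ (v, a)) univ {w | w.2 ∈ S w.1 ∧ tproj I F B w = v} ∧
        (∀ a a', IsTSum I F (Φ (v, a)) (Φ (v, a')) (Φ (v, a + a'))) ∧
        ∀ (r : ℝ) a, Φ (v, r • a) = tsmul I F r (Φ (v, a)) := by
  obtain ⟨U, hU, hmU, hUd, ℓ, hℓ, hSℓ⟩ := hS m₀
  obtain ⟨U₁, hU₁, hmU₁, hU₁d, P, hP, hPC⟩ := hC.exists_projector m₀
  obtain ⟨U₂, hU₂₁, hU₂, hmU₂, g, k, hg, hk, hgk⟩ :=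
    exists_conj_projector hU₁ hP (fun x hx => (hPC x hx).1) hmU₁
  let R := LinearMap.range (P m₀ : F →ₗ[ℝ] F)
  have hR : ∀ c : R, P m₀ c = c := by
    rintro ⟨_, y, rfl⟩
    exact DFunLike.congr_fun (hPC m₀ hmU₁).1 y
  let θ := (Module.finBasis ℝ (F × R)).equivFunL.symm
  let pr : TangentBundle I M × (Fin (Module.finrank ℝ (F × R)) → ℝ) → TangentBundle I M :=
    Prod.fst
  let Φ : TangentBundle I M × (Fin (Module.finrank ℝ (F × R)) → ℝ) → TTot I F B := fun p =>
    par F B m₀ p.1 (θ p.2).1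
      (g p.1.1 (θ p.2).2 - ℓ p.1.1 (θ p.2).1 (hco I m₀ p.1.1 p.1.2))
  refine ⟨U ∩ U₂, hU.inter hU₂, ⟨hmU, hmU₂⟩, _, Φ, ?_,
    fun v hv hvΔ => ⟨⟨?_, ?_, ?_⟩, fun a a' => ?_, fun r a => ?_⟩⟩
  · rintro ⟨v, a⟩ ⟨hv : v.1 ∈ U ∩ U₂, -⟩
    refine ContMDiffAt.contMDiffWithinAt ?_
    have h1 : ContMDiffAt (I.tangent.prod 𝓘(ℝ, Fin (Module.finrank ℝ (F × R)) → ℝ)) I.tangent ∞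
        pr (v, a) := contMDiffAt_fst
    have h2 : ContMDiffAt (I.tangent.prod 𝓘(ℝ, Fin (Module.finrank ℝ (F × R)) → ℝ)) I ∞
        (fun p => (pr p).1) (v, a) := (contMDiffAt_proj (TangentSpace I : M → Type _)).comp _ h1
    have h3 : ContMDiffAt (I.tangent.prod 𝓘(ℝ, Fin (Module.finrank ℝ (F × R)) → ℝ)) 𝓘(ℝ, F) ∞
        (fun p => (θ p.2).1) (v, a) :=
      (((ContinuousLinearMap.fst ℝ F R).comp θ.toContinuousLinearMap).contMDiff.contMDiffAt).comp
        (v, a) contMDiffAt_snd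
    have h4 : ContMDiffAt (I.tangent.prod 𝓘(ℝ, Fin (Module.finrank ℝ (F × R)) → ℝ)) 𝓘(ℝ, F) ∞
        (fun p => ((θ p.2).2 : F)) (v, a) :=
      ((R.subtypeL.comp ((ContinuousLinearMap.snd ℝ F R).comp
        θ.toContinuousLinearMap)).contMDiff.contMDiffAt).comp (v, a) contMDiffAt_snd
    have h5 := ((hg.contMDiffAt (hU₂.mem_nhds hv.2)).comp (v, a) h2).clm_apply h4
    have h6 := (((hℓ.contMDiffAt (hU.mem_nhds hv.1)).comp (v, a) h2).clm_apply h3).clm_apply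
      ((contMDiffAt_hco (hUd hv.1).1).comp (v, a) h1)
    exact contMDiffAt_par (hUd hv.1) h1 h3 (h5.sub h6)
  · intro a _
    refine ⟨?_, tproj_par (hUd hv.1) _ _⟩
    have hd : dq I F (Φ (v, a)).1 (Φ (v, a)).2 = v.2 := dq_par (hUd hv.1) _ _
    have h1 := DFunLike.congr_fun (hgk v.1 hv.2).2.2 ((θ a).2 : F)
    rw [mul_apply_eq_comp, mul_apply_eq_comp, hR] at h1
    refine (hSℓ (Φ (v, a)).1 hv.1 _).2 ⟨?_, ((hPC v.1 (hU₂₁ hv.2)).2 _).2 ?_⟩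
    · exact hd.symm ▸ hvΔ
    · have h2 : vcoord I F m₀ (Φ (v, a)).1 (Φ (v, a)).2 + ℓ v.1 (fcoord F B m₀ (Φ (v, a)).1)
          (hco I m₀ v.1 (dq I F (Φ (v, a)).1 (Φ (v, a)).2)) = g v.1 (θ a).2 := by
        rw [fcoord_par (hUd hv.1), vcoord_par (hUd hv.1)]
        change _ - _ + ℓ v.1 (θ a).1 (hco I m₀ v.1 (dq I F (Φ (v, a)).1 (Φ (v, a)).2)) = _
        rw [hd, sub_add_cancel]
      refine (congrArg (fun y => P v.1 (co F m₀ v.1 (coSymm F B m₀ v.1 y))) h2).trans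
        (Eq.trans ?_ (congrArg (fun y => co F m₀ v.1 (coSymm F B m₀ v.1 y)) h2.symm))
      rw [co_coSymm (hUd hv.1).2, h1]
  · intro a _ a' _ h
    have h1 : (θ a).1 = (θ a').1 := by
      have := congrArg (fun w : TTot I F B => fcoord F B m₀ w.1) h
      simpa only [Φ, fcoord_par (hUd hv.1)] using this
    have h2 := congrArg (fun w : TTot I F B => vcoord I F m₀ w.1 w.2) h
    simp only [Φ, vcoord_par (hUd hv.1), h1, sub_left_inj] at h2
    have h3 := congrArg (k v.1) h2
    have hkg : ∀ y, k v.1 (g v.1 y) = y := fun y => DFunLike.congr_fun (hgk v.1 hv.2).2.1 y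
    rw [hkg, hkg] at h3
    exact θ.injective (Prod.ext h1 (Subtype.ext h3))
  · rintro w ⟨hw, rfl⟩
    have hwU : w.1.1 ∈ U := hv.1
    have hwU₂ : w.1.1 ∈ U₂ := hv.2
    rw [hSℓ w.1 hwU, (hPC _ (hU₂₁ hwU₂)).2, co_coSymm (hUd hwU).2] at hw
    set y := vcoord I F m₀ w.1 w.2 +
      ℓ w.1.1 (fcoord F B m₀ w.1) (hco I m₀ w.1.1 (dq I F w.1 w.2)) with hy
    have hgk' : ∀ y, g w.1.1 (k w.1.1 y) = y := fun y => DFunLike.congr_fun (hgk _ hwU₂).1 y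
    have hkg : ∀ y, k w.1.1 (g w.1.1 y) = y := fun y => DFunLike.congr_fun (hgk _ hwU₂).2.1 y
    have hPg : ∀ y, P w.1.1 (g w.1.1 y) = g w.1.1 (P m₀ y) := fun y =>
      DFunLike.congr_fun (hgk _ hwU₂).2.2 y
    have hc : P m₀ (k w.1.1 y) = k w.1.1 y := by rw [← hkg (P m₀ _), ← hPg, hgk', hw.2]
    let c : R := ⟨k w.1.1 y, _, hc⟩
    refine ⟨θ.symm (fcoord F B m₀ w.1, c), trivial, ?_⟩
    have hcy : g w.1.1 c = y := hgk' y
    refine Eq.trans ?_ (par_eta (hUd hwU))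
    simp only [Φ, ContinuousLinearEquiv.apply_symm_apply]
    refine congrArg (par F B m₀ (tproj I F B w) (fcoord F B m₀ w.1)) ?_
    change g w.1.1 c - ℓ w.1.1 (fcoord F B m₀ w.1) (hco I m₀ w.1.1 (dq I F w.1 w.2)) = _
    rw [hcy, hy, add_sub_cancel_right]
  · have h := isTSum_par (hUd hv.1) (θ a).1 (g v.1 (θ a).2 - ℓ v.1 (θ a).1 (hco I m₀ v.1 v.2))
      (θ a').1 (g v.1 (θ a').2 - ℓ v.1 (θ a').1 (hco I m₀ v.1 v.2))
    have e : Φ (v, a + a') = par F B m₀ v ((θ a).1 + (θ a').1)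
        ((g v.1 (θ a).2 - ℓ v.1 (θ a).1 (hco I m₀ v.1 v.2)) +
          (g v.1 (θ a').2 - ℓ v.1 (θ a').1 (hco I m₀ v.1 v.2))) := by
      simp only [Φ, map_add, Prod.snd_add, Prod.fst_add, Submodule.coe_add, add_apply]
      rw [add_sub_add_comm]
    rw [e]
    exact h
  · rw [tsmul_par (hUd hv.1)]
    simp only [Φ, map_smul, Prod.smul_fst, Prod.smul_snd, Submodule.coe_smul, smul_sub, smul_apply]

/-- A family of subspaces of `TB` with local forms is a linear distribution. -/
def LinearDistribution.ofLocalForm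
    (S : ∀ e : TotalSpace F B, Submodule ℝ (TangentSpace (I.prod 𝓘(ℝ, F)) e))
    (hΔM : IsSmoothSubbundle I E (TangentSpace I : M → Type _) ΔM)
    (hC : IsSmoothSubbundle I F B C) (hS : ∀ m₀, HasLocalForm ΔM C S m₀) :
    LinearDistribution I F ΔM C where
  space := S
  subbundle := HasLocalForm.isSmoothSubbundle hΔM hC hS
  proj_mem w hw := by
    obtain ⟨U, -, hmU, -, ℓ, -, hSℓ⟩ := hS w.1.1
    exact ((hSℓ w.1 hmU w.2).1 hw).1
  proj_surj v hv := by
    obtain ⟨U, -, hmU, hUd, ℓ, -, hSℓ⟩ := hS v.1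
    refine ⟨par F B v.1 v 0 0, (hSℓ (par F B v.1 v 0 0).1 hmU _).2 ⟨?_, ?_⟩,
      tproj_par (hUd hmU) 0 0⟩
    · exact (dq_par (F := F) (B := B) (hUd hmU) 0 0).symm ▸ hv
    · rw [fcoord_par (hUd hmU), vcoord_par (hUd hmU)]
      simp
  add_mem w₁ w₂ w h h₁ h₂ := by
    obtain ⟨m, b, b', z₁, z₂, z, rfl, rfl, rfl⟩ := h.exists_base
    obtain ⟨U, -, hmU, hUd, ℓ, -, hSℓ⟩ := hS m
    obtain ⟨e₁, e₂, e₃⟩ := (isTSum_iff (hUd hmU)).1 h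
    have k₁ := (hSℓ ⟨m, b⟩ hmU z₁).1 h₁
    have k₂ := (hSℓ ⟨m, b'⟩ hmU z₂).1 h₂
    refine (hSℓ ⟨m, b + b'⟩ hmU z).2 ⟨e₂ ▸ k₁.1, ?_⟩
    have k₃ := (C m).add_mem k₁.2 k₂.2
    rw [← map_add, ← e₁] at k₃
    rw [e₂, e₃, fcoord_add (hUd hmU).2, map_add (ℓ _), add_apply, add_add_add_comm]
    exact k₃
  smul_mem r w hw := by
    obtain ⟨U, -, hmU, hUd, ℓ, -, hSℓ⟩ := hS w.1.1
    have k := (hSℓ w.1 hmU w.2).1 hw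
    refine (hSℓ ⟨w.1.1, r • w.1.2⟩ hmU _).2 ⟨(dq_tsmul r w).symm ▸ k.1, ?_⟩
    have k' := (C w.1.1).smul_mem r k.2
    rw [← map_smul] at k'
    rw [dq_tsmul, vcoord_tsmul r w (hUd hmU).2, fcoord_smul (hUd hmU).2, map_smul, smul_apply,
      ← smul_add]
    exact k'
  locally_trivial v₀ _ := by
    obtain ⟨U, hU, hmU, k, Φ, hΦ, h⟩ := HasLocalForm.locally_trivial hC hS v₀.1
    exact ⟨TotalSpace.proj ⁻¹' U,
      hU.preimage (FiberBundle.continuous_proj E (TangentSpace I : M → Type _)), hmU, k, Φ, hΦ, h⟩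
  core m c := by
    obtain ⟨U, -, hmU, hUd, ℓ, -, hSℓ⟩ := hS m
    have h0 : fcoord F B m ⟨m, 0⟩ = 0 := by rw [← co_apply (hUd hmU).2, map_zero]
    rw [hSℓ ⟨m, 0⟩ hmU, dq_verticalLift, vcoord_verticalLift (e := ⟨m, 0⟩) (hUd hmU).2, h0,
      map_zero,
      zero_apply, add_zero, coSymm_co (hUd hmU).2]
    exact ⟨fun h => ⟨zero_mem _, h⟩, fun h => h.2⟩

end LocalForm

/-- Rank-nullity for the restriction of `f` to each of the two subspaces. -/
theorem finrank_map_eq_of_inf_ker {W W' : Type*} [AddCommGroup W] [Module ℝ W]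
    [FiniteDimensional ℝ W] [AddCommGroup W'] [Module ℝ W'] (f : W →ₗ[ℝ] W')
    {D D' : Submodule ℝ W} (hk : D ⊓ LinearMap.ker f = D' ⊓ LinearMap.ker f)
    (h : Module.finrank ℝ D = Module.finrank ℝ D') :
    Module.finrank ℝ (D.map f) = Module.finrank ℝ (D'.map f) := by
  have key : ∀ D : Submodule ℝ W, Module.finrank ℝ (D.map f) +
      Module.finrank ℝ (D ⊓ LinearMap.ker f : Submodule ℝ W) = Module.finrank ℝ D := fun D => by
    have h1 := LinearMap.finrank_range_add_finrank_ker (f.domRestrict D)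
    have h2 : LinearMap.ker (f.domRestrict D) =
        (D ⊓ LinearMap.ker f).comap D.subtype := by
      ext x
      simp [LinearMap.domRestrict_apply]
    rw [LinearMap.range_domRestrict, h2,
      (Submodule.comapSubtypeEquivOfLe (inf_le_left : D ⊓ LinearMap.ker f ≤ D)).finrank_eq] at h1
    exact h1
  have h1 := key D
  have h2 := key D'
  rw [hk] at h1
  omega

/-! ### Pointwise structure of a linear distribution -/

section Fibres

variable {E H M : Type*} [NormedAddCommGroup E] [NormedSpace ℝ E] [TopologicalSpace H]
  {I : ModelWithCorners ℝ E H} [TopologicalSpace M] [ChartedSpace H M] [IsManifold I ∞ M]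
  {F : Type*} [NormedAddCommGroup F] [NormedSpace ℝ F]
  {B : M → Type*} [TopologicalSpace (TotalSpace F B)]
  [∀ m, AddCommGroup (B m)] [∀ m, Module ℝ (B m)] [∀ m, TopologicalSpace (B m)]
  [FiberBundle F B] [VectorBundle ℝ F B] [ContMDiffVectorBundle ∞ F B I]

variable {ΔM : ∀ m : M, Submodule ℝ (TangentSpace I m)} {C : ∀ m, Submodule ℝ (B m)}

theorem ofCoords_coords {m₀ : M} {e : TotalSpace F B} (he : e.1 ∈ dom (H := H) F B m₀)
    (w : TangentSpace (I.prod 𝓘(ℝ, F)) e) :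
    ofCoords I F B m₀ e (hco I m₀ e.1 (dq I F e w), vcoord I F m₀ e w) = w :=
  tangent_ext he (dq_ofCoords he _ _) (vcoord_ofCoords he _)

theorem dq_ofCoords' {m₀ : M} {e : TotalSpace F B} (he : e.1 ∈ dom (H := H) F B m₀) (p : E × F) :
    dq I F e (ofCoords I F B m₀ e p) = coSymm E (TangentSpace I : M → Type _) m₀ e.1 p.1 := by
  rw [← coSymm_hco he.1 (dq I F e _), hco_dq_ofCoords he]

namespace LinearDistribution

variable (Δ : LinearDistribution I F ΔM C)

/-- The space `Δ_e` in the coordinates given by the preferred trivialization at `m₀`. -/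
def coordSpace (m₀ : M) (e : TotalSpace F B) : Submodule ℝ (E × F) :=
  (Δ.space e).comap (coSymm (E × F)
    (TangentSpace (I.prod 𝓘(ℝ, F)) : TotalSpace F B → Type _) ⟨m₀, 0⟩ e).toLinearMap

variable {Δ} {m₀ m : M}

theorem mem_coordSpace {e : TotalSpace F B} {p : E × F} :
    p ∈ Δ.coordSpace m₀ e ↔ ofCoords I F B m₀ e p ∈ Δ.space e := Iff.rfl

theorem coords_mem_coordSpace {e : TotalSpace F B} (he : e.1 ∈ dom (H := H) F B m₀)
    {w : TangentSpace (I.prod 𝓘(ℝ, F)) e} :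
    (hco I m₀ e.1 (dq I F e w), vcoord I F m₀ e w) ∈ Δ.coordSpace m₀ e ↔ w ∈ Δ.space e := by
  rw [mem_coordSpace, ofCoords_coords he]

theorem finrank_coordSpace {e : TotalSpace F B} (he : e.1 ∈ dom (H := H) F B m₀) :
    Module.finrank ℝ (Δ.coordSpace m₀ e) = Module.finrank ℝ (Δ.space e) := by
  let f := (coSymm (E × F)
    (TangentSpace (I.prod 𝓘(ℝ, F)) : TotalSpace F B → Type _) ⟨m₀, 0⟩ e).toLinearMap
  have hf : Function.Injective f := fun p p' h => by
    rw [← hco_total_ofCoords (I := I) he p, ← hco_total_ofCoords (I := I) he p']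
    exact congrArg (fun w => (hco I m₀ e.1 (dq I F e w), vcoord I F m₀ e w)) h
  have hf' : Function.Surjective f := fun w => ⟨_, ofCoords_coords he w⟩
  rw [(Submodule.equivMapOfInjective f hf (Δ.coordSpace m₀ e)).finrank_eq]
  exact congrArg (fun S : Submodule ℝ (TangentSpace (I.prod 𝓘(ℝ, F)) e) => Module.finrank ℝ S)
    (Submodule.map_comap_eq_of_surjective hf' _)

section Pointwise

variable (hm : m ∈ dom (H := H) F B m₀)
include hm

theorem coordSpace_side {b : B m} {p : E × F} (h : p ∈ Δ.coordSpace m₀ ⟨m, b⟩) :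
    coSymm E (TangentSpace I : M → Type _) m₀ m p.1 ∈ ΔM m := by
  have := Δ.proj_mem ⟨⟨m, b⟩, ofCoords I F B m₀ ⟨m, b⟩ p⟩ h
  have h' : dq I F ⟨m, b⟩ (ofCoords I F B m₀ ⟨m, b⟩ p) ∈ ΔM m := this
  rwa [dq_ofCoords' (e := ⟨m, b⟩) hm] at h'

theorem coordSpace_add {b b' : B m} {y : E} {u u' : F} (h : (y, u) ∈ Δ.coordSpace m₀ ⟨m, b⟩)
    (h' : (y, u') ∈ Δ.coordSpace m₀ ⟨m, b'⟩) :
    (y, u + u') ∈ Δ.coordSpace m₀ ⟨m, b + b'⟩ := by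
  refine Δ.add_mem ⟨⟨m, b⟩, ofCoords I F B m₀ ⟨m, b⟩ (y, u)⟩
    ⟨⟨m, b'⟩, ofCoords I F B m₀ ⟨m, b'⟩ (y, u')⟩
    ⟨⟨m, b + b'⟩, ofCoords I F B m₀ ⟨m, b + b'⟩ (y, u + u')⟩ ((isTSum_iff hm).2 ⟨?_, ?_, ?_⟩) h h'
  · rw [dq_ofCoords' (e := ⟨m, b⟩) hm, dq_ofCoords' (e := ⟨m, b'⟩) hm]
  · rw [dq_ofCoords' (e := ⟨m, b⟩) hm, dq_ofCoords' (e := ⟨m, b + b'⟩) hm]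
  · rw [vcoord_ofCoords (e := ⟨m, b⟩) hm, vcoord_ofCoords (e := ⟨m, b'⟩) hm,
      vcoord_ofCoords (e := ⟨m, b + b'⟩) hm]

theorem coordSpace_smul (r : ℝ) {b : B m} {y : E} {u : F}
    (h : (y, u) ∈ Δ.coordSpace m₀ ⟨m, b⟩) : (y, r • u) ∈ Δ.coordSpace m₀ ⟨m, r • b⟩ := by
  let w : TTot I F B := ⟨⟨m, b⟩, ofCoords I F B m₀ ⟨m, b⟩ (y, u)⟩
  let z : TangentSpace (I.prod 𝓘(ℝ, F)) (⟨m, r • b⟩ : TotalSpace F B) := (tsmul I F r w).2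
  have hz : z ∈ Δ.space ⟨m, r • b⟩ := Δ.smul_mem r w h
  have h1 : dq I F ⟨m, r • b⟩ z = dq I F ⟨m, b⟩ w.2 := dq_tsmul r w
  have h2 : vcoord I F m₀ ⟨m, r • b⟩ z = r • vcoord I F m₀ ⟨m, b⟩ w.2 := vcoord_tsmul r w hm.2
  rw [← coords_mem_coordSpace (e := ⟨m, r • b⟩) hm, h1, h2] at hz
  have h3 : hco I m₀ m (dq I F ⟨m, b⟩ w.2) = y := hco_dq_ofCoords (e := ⟨m, b⟩) hm _
  have h4 : vcoord I F m₀ ⟨m, b⟩ w.2 = u := vcoord_ofCoords (e := ⟨m, b⟩) hm _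
  rwa [h3, h4] at hz

/-- Surjectivity onto `ΔM` provides a vector over `y` at an unknown point of the fibre;
multiplication by `0` in `TB → TM` moves it to `0_m` and kills its vertical part. -/
theorem coordSpace_zero_base {y : E}
    (hy : coSymm E (TangentSpace I : M → Type _) m₀ m y ∈ ΔM m) :
    (y, (0 : F)) ∈ Δ.coordSpace m₀ ⟨m, 0⟩ := by
  obtain ⟨⟨⟨m', b⟩, w⟩, hw, hwv⟩ := Δ.proj_surj
    ⟨m, coSymm E (TangentSpace I : M → Type _) m₀ m y⟩ hy
  have e1 : m' = m := congrArg (fun v : TangentBundle I M => v.1) hwv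
  subst e1
  have e2 : dq I F ⟨m', b⟩ w = coSymm E (TangentSpace I : M → Type _) m₀ m' y :=
    eq_of_heq (TotalSpace.mk.inj hwv).2
  have h1 := (coords_mem_coordSpace (Δ := Δ) (e := ⟨m', b⟩) hm).2 hw
  rw [e2, hco_coSymm hm.1] at h1
  have h2 := coordSpace_smul hm 0 h1
  rwa [zero_smul, zero_smul] at h2

theorem coordSpace_core_zero {u : F} :
    ((0 : E), u) ∈ Δ.coordSpace m₀ ⟨m, 0⟩ ↔ coSymm F B m₀ m u ∈ C m := by
  rw [Δ.core m, mem_coordSpace]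
  have : ofCoords I F B m₀ ⟨m, 0⟩ (0, u) =
      verticalLift I F (⟨m, 0⟩ : TotalSpace F B) (coSymm F B m₀ m u) := by
    refine tangent_ext (e := ⟨m, 0⟩) hm ?_ ?_
    · rw [dq_ofCoords' (e := ⟨m, 0⟩) hm, map_zero, dq_verticalLift]
    · rw [vcoord_ofCoords (e := ⟨m, 0⟩) hm, vcoord_verticalLift (e := ⟨m, 0⟩) hm.2]
      exact (co_coSymm hm.2 u).symm
  rw [this]

/-- Adding in `TB → TM` the zero tangent vector at `b` or `-b` translates the base point and leaves
the vertical part alone. So the core, prescribed only at `0_m`, is the same at every point of the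
fibre. -/
theorem coordSpace_core {b : B m} {u : F} :
    ((0 : E), u) ∈ Δ.coordSpace m₀ ⟨m, b⟩ ↔ coSymm F B m₀ m u ∈ C m := by
  rw [← coordSpace_core_zero (Δ := Δ) hm]
  constructor
  · intro h
    have h1 := coordSpace_add hm h (zero_mem (Δ.coordSpace m₀ ⟨m, -b⟩))
    simpa using h1
  · intro h
    have h1 := coordSpace_add hm h (zero_mem (Δ.coordSpace m₀ ⟨m, b⟩))
    simpa using h1

theorem coordSpace_sum {ι : Type*} (s : Finset ι) (c : ι → ℝ) (β : ι → B m) {y : E} (u : ι → F)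
    (hy : coSymm E (TangentSpace I : M → Type _) m₀ m y ∈ ΔM m)
    (h : ∀ i, (y, u i) ∈ Δ.coordSpace m₀ ⟨m, β i⟩) :
    (y, ∑ i ∈ s, c i • u i) ∈ Δ.coordSpace m₀ ⟨m, ∑ i ∈ s, c i • β i⟩ := by
  classical
  induction s using Finset.induction_on with
  -- The empty combination lives at `0_m`, with horizontal part `y`; this is where `hy` enters.
  | empty => simpa using coordSpace_zero_base (Δ := Δ) hm hy
  | insert i s hi ih =>
    rw [Finset.sum_insert hi, Finset.sum_insert hi]
    exact coordSpace_add hm (coordSpace_smul hm _ (h i)) ih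

end Pointwise

variable [FiniteDimensional ℝ E] [FiniteDimensional ℝ F]

/-- Local frames make the rank locally constant on `B`, hence constant along the connected line `t ↦
t b`. -/
theorem finrank_coordSpace_eq_zero_base (hm : m ∈ dom (H := H) F B m₀) (b : B m) :
    Module.finrank ℝ (Δ.coordSpace m₀ ⟨m, b⟩) = Module.finrank ℝ (Δ.coordSpace m₀ ⟨m, 0⟩) := by
  rw [finrank_coordSpace (e := ⟨m, b⟩) hm, finrank_coordSpace (e := ⟨m, 0⟩) hm]
  have hloc : ∀ e : TotalSpace F B, ∀ᶠ e' in 𝓝 e,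
      Module.finrank ℝ (Δ.space e') = Module.finrank ℝ (Δ.space e) := by
    intro e
    obtain ⟨U, hU, he, k, s, -, hs⟩ := Δ.subbundle e
    have hk : ∀ x ∈ U, Module.finrank ℝ (Δ.space x) = k := fun x hx => by
      rw [← (hs x hx).2, finrank_span_eq_card (hs x hx).1, Fintype.card_fin]
    filter_upwards [hU.mem_nhds he] with e' he'
    rw [hk e' he', hk e he]
  have hcont : Continuous fun t : ℝ => (⟨m, 0 + t • b⟩ : TotalSpace F B) :=
    (contMDiff_verticalLine (I := I) ⟨m, 0⟩ b).continuous
  have hlc : IsLocallyConstant fun t : ℝ =>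
      Module.finrank ℝ (Δ.space (⟨m, 0 + t • b⟩ : TotalSpace F B)) :=
    (IsLocallyConstant.iff_eventually_eq _).2 fun t => hcont.continuousAt.eventually (hloc _)
  have h := hlc.apply_eq_of_isPreconnected isPreconnected_univ (mem_univ (1 : ℝ)) (mem_univ 0)
  have h1 : 0 + (1 : ℝ) • b = b := by simp
  have h0 : 0 + (0 : ℝ) • b = 0 := by simp
  rwa [h1, h0] at h

/-- `Δ_b` and `Δ_{0_m}` have the same rank and the same intersection with the vertical space, so
their projections have equal dimension. One projection is contained in the other, and the one at
`0_m` is all of `ΔM`. -/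
theorem exists_mem_coordSpace (hm : m ∈ dom (H := H) F B m₀) (b : B m) {y : E}
    (hy : coSymm E (TangentSpace I : M → Type _) m₀ m y ∈ ΔM m) :
    ∃ u, (y, u) ∈ Δ.coordSpace m₀ ⟨m, b⟩ := by
  have hmap : (Δ.coordSpace m₀ ⟨m, b⟩).map (LinearMap.fst ℝ E F) =
      (Δ.coordSpace m₀ ⟨m, 0⟩).map (LinearMap.fst ℝ E F) := by
    refine Submodule.eq_of_le_of_finrank_eq ?_ (finrank_map_eq_of_inf_ker _ ?_
      (finrank_coordSpace_eq_zero_base hm b))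
    · rintro _ ⟨p, hp, rfl⟩
      exact ⟨_, coordSpace_zero_base hm (coordSpace_side hm hp), rfl⟩
    · ext ⟨y, u⟩
      simp only [Submodule.mem_inf, LinearMap.mem_ker, LinearMap.fst_apply]
      constructor
      · rintro ⟨h, rfl⟩
        exact ⟨(coordSpace_core_zero hm).2 ((coordSpace_core hm).1 h), rfl⟩
      · rintro ⟨h, rfl⟩
        exact ⟨(coordSpace_core hm).2 ((coordSpace_core_zero hm).1 h), rfl⟩
  have h1 : y ∈ (Δ.coordSpace m₀ ⟨m, b⟩).map (LinearMap.fst ℝ E F) := by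
    rw [hmap]
    exact ⟨_, coordSpace_zero_base hm hy, rfl⟩
  obtain ⟨⟨y', u⟩, hp, rfl⟩ := h1
  exact ⟨u, hp⟩

end LinearDistribution

end Fibres

theorem contMDiffOn_smulRight {EN HN N V W : Type*} [NormedAddCommGroup EN] [NormedSpace ℝ EN]
    [TopologicalSpace HN] {J : ModelWithCorners ℝ EN HN} [TopologicalSpace N] [ChartedSpace HN N]
    [NormedAddCommGroup V] [NormedSpace ℝ V] [NormedAddCommGroup W] [NormedSpace ℝ W]
    (c : V →L[ℝ] ℝ) {u : N → W} {U : Set N} (hu : ContMDiffOn J 𝓘(ℝ, W) ∞ u U) :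
    ContMDiffOn J 𝓘(ℝ, V →L[ℝ] W) ∞ (fun x => c.smulRight (u x)) U :=
  ((ContinuousLinearMap.smulRightL ℝ V W) c).contMDiff.comp_contMDiffOn hu

/-! ### Every linear distribution has local bilinear forms -/

section ToLocalForm

variable {E H M : Type*} [NormedAddCommGroup E] [NormedSpace ℝ E] [TopologicalSpace H]
  {I : ModelWithCorners ℝ E H} [TopologicalSpace M] [ChartedSpace H M] [IsManifold I ∞ M]
  {F : Type*} [NormedAddCommGroup F] [NormedSpace ℝ F]
  {B : M → Type*} [TopologicalSpace (TotalSpace F B)]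
  [∀ m, AddCommGroup (B m)] [∀ m, Module ℝ (B m)] [∀ m, TopologicalSpace (B m)]
  [FiberBundle F B] [VectorBundle ℝ F B] [ContMDiffVectorBundle ∞ F B I]

variable {ΔM : ∀ m : M, Submodule ℝ (TangentSpace I m)} {C : ∀ m, Submodule ℝ (B m)}

variable (I) in
theorem contMDiffAt_constInCoords {m₀ m : M} (hm : m ∈ dom (H := H) F B m₀) (f : F) :
    ContMDiffAt I (I.prod 𝓘(ℝ, F)) ∞
      (fun m => (⟨m, coSymm F B m₀ m f⟩ : TotalSpace F B)) m := by
  refine (contMDiffAt_total_iff (m₀ := m₀) hm.2).2 ⟨contMDiffAt_id, ?_⟩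
  refine (contMDiffAt_const (c := f)).congr_of_eventuallyEq ?_
  filter_upwards [(isOpen_dom m₀).mem_nhds hm] with m' hm'
  exact fcoord_coSymm hm'.2 f

variable [FiniteDimensional ℝ E] [FiniteDimensional ℝ F]

/-- Smooth choice, for the points with constant fibre coordinates `f`, of vectors in `Δ` over given
vectors in `ΔM`. -/
theorem LinearDistribution.exists_smooth_lift (Δ : LinearDistribution I F ΔM C)
    (hΔM : IsSmoothSubbundle I E (TangentSpace I : M → Type _) ΔM) (m₀ : M) (f : F) :
    ∃ U : Set M, IsOpen U ∧ m₀ ∈ U ∧ U ⊆ dom (H := H) F B m₀ ∧ ∃ u : M → E →L[ℝ] F,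
      ContMDiffOn I 𝓘(ℝ, E →L[ℝ] F) ∞ u U ∧ ∀ m ∈ U, ∀ v ∈ ΔM m,
        (hco I m₀ m v, u m (hco I m₀ m v)) ∈ Δ.coordSpace m₀ ⟨m, coSymm F B m₀ m f⟩ := by
  let ε : M → TotalSpace F B := fun m => ⟨m, coSymm F B m₀ m f⟩
  obtain ⟨W, hW, hεW, hWd, R, hR, hRΔ⟩ := Δ.subbundle.exists_projector (ε m₀)
  obtain ⟨U₁, hU₁, hmU₁, hU₁d, P, hP, hPM⟩ := hΔM.exists_projector m₀
  have hεs : ContMDiffOn I (I.prod 𝓘(ℝ, F)) ∞ ε (dom (H := H) F B m₀) := fun m hm =>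
    (contMDiffAt_constInCoords I hm f).contMDiffWithinAt
  set U₂ := (dom (H := H) F B m₀ ∩ ε ⁻¹' W) ∩ U₁ with hU₂
  have hU₂o : IsOpen U₂ := (hεs.continuousOn.isOpen_inter_preimage (isOpen_dom m₀) hW).inter hU₁
  have hmem : ∀ m ∈ U₂, ∀ p, p ∈ Δ.coordSpace m₀ (ε m) ↔ R (ε m) p = p := by
    intro m hm p
    rw [LinearDistribution.mem_coordSpace, (hRΔ (ε m) hm.1.2).2]
    have h1 := hco_total (I := I) (e₀ := ε m₀) (e := ε m) hm.1.1.1 hm.1.1.2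
      (ofCoords I F B m₀ (ε m) p)
    have h2 := hco_total_ofCoords (I := I) (m₀ := m₀) (e := ε m) hm.1.1 p
    rw [h1.trans h2]
  have hRR : ∀ m ∈ U₂, ∀ p, R (ε m) (R (ε m) p) = R (ε m) p := fun m hm =>
    DFunLike.congr_fun (hRΔ (ε m) hm.1.2).1
  have hPfix : ∀ m ∈ U₂, ∀ y, P m y = y ↔
      coSymm E (TangentSpace I : M → Type _) m₀ m y ∈ ΔM m := fun m hm y => by
    rw [(hPM m hm.2).2]
    erw [hco_coSymm hm.1.1.1]
  have hRs : ContMDiffOn I 𝓘(ℝ, E × F →L[ℝ] E × F) ∞ (fun m => R (ε m)) U₂ :=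
    hR.comp (hεs.mono fun m hm => hm.1.1) fun m hm => hm.1.2
  have hPs := hP.mono (inter_subset_right : U₂ ⊆ U₁)
  have hAs : ContMDiffOn I 𝓘(ℝ, E × F →L[ℝ] E) ∞
      (fun m => ContinuousLinearMap.fst ℝ E F ∘L R (ε m)) U₂ := contMDiffOn_const.clm_comp hRs
  have hmU₂ : m₀ ∈ U₂ := ⟨⟨mem_dom_self m₀, hεW⟩, hmU₁⟩
  -- The horizontal part of the projector `R` onto `Δ` along `ε` takes values in the range of `P`,
  -- that is, in `ΔM`. Surjectivity is needed only at `m₀`, where it is `exists_mem_coordSpace`; the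
  -- right inverse `K` then lifts smoothly nearby.
  obtain ⟨U, hUU₂, hU, hmU, K, hK, hAK⟩ := exists_smooth_rightInverse (P := P) hU₂o hAs hPs
    (fun m hm => (hPM m hm.2).1)
    (fun m hm => by
      refine ContinuousLinearMap.ext fun p => ?_
      exact (hPfix m hm _).2 (LinearDistribution.coordSpace_side hm.1.1
        ((hmem m hm _).2 (hRR m hm p))))
    hmU₂
    (fun y => by
      have hy : P m₀ (P m₀ y) = P m₀ y := DFunLike.congr_fun (hPM m₀ hmU₁).1 y
      obtain ⟨u, hu⟩ := LinearDistribution.exists_mem_coordSpace (Δ := Δ) hmU₂.1.1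
        (coSymm F B m₀ m₀ f) ((hPfix m₀ hmU₂ _).1 hy)
      exact ⟨_, congrArg Prod.fst ((hmem m₀ hmU₂ _).1 hu)⟩)
  refine ⟨U, hU, hmU, fun m hm => (hUU₂ hm).1.1,
    fun m => ContinuousLinearMap.snd ℝ E F ∘L R (ε m) ∘L K m ∘L P m,
    contMDiffOn_const.clm_comp ((hRs.mono hUU₂).clm_comp (hK.clm_comp (hPs.mono hUU₂))),
    fun m hm v hv => ?_⟩
  have hPv : P m (hco I m₀ m v) = hco I m₀ m v := ((hPM m (hUU₂ hm).2).2 v).1 hv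
  have h1 := (hmem m (hUU₂ hm) _).2 (hRR m (hUU₂ hm) (K m (P m (hco I m₀ m v))))
  have h2 : (R (ε m) (K m (P m (hco I m₀ m v)))).1 = hco I m₀ m v :=
    (DFunLike.congr_fun (hAK m hm) (hco I m₀ m v)).trans hPv
  have h3 : R (ε m) (K m (P m (hco I m₀ m v))) =
      (hco I m₀ m v, (R (ε m) (K m (P m (hco I m₀ m v)))).2) := Prod.ext h2 rfl
  rw [h3] at h1
  exact h1

-- Closure under linear combinations extends the lifts `u i` at the frame points to a lift at every
-- `b`, linear in `b`. Any other vector of `Δ_b` over the same `v` differs from it by a core vector.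
-- The sign in `ℓ` reflects that the lift has vertical part `-ℓ(b)(v)`.
set_option synthInstance.maxHeartbeats 200000 in
theorem LinearDistribution.hasLocalForm (Δ : LinearDistribution I F ΔM C)
    (hΔM : IsSmoothSubbundle I E (TangentSpace I : M → Type _) ΔM) (m₀ : M) :
    HasLocalForm ΔM C Δ.space m₀ := by
  let f := Module.finBasis ℝ F
  choose U hU hmU hUd u hu hΔu using fun i => Δ.exists_smooth_lift hΔM m₀ (f i)
  let φ : Fin (Module.finrank ℝ F) → F →L[ℝ] ℝ := fun i =>
    LinearMap.toContinuousLinearMap (f.coord i)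
  let ℓ : M → F →L[ℝ] E →L[ℝ] F := fun m => -∑ i, (φ i).smulRight (u i m)
  have hℓ : ∀ m b y, ℓ m b y = -∑ i, f.repr b i • u i m y := fun m b y => by
    simp [ℓ, φ, sum_apply]
  refine ⟨dom (H := H) F B m₀ ∩ ⋂ i, U i, (isOpen_dom m₀).inter (isOpen_iInter_of_finite hU),
    ⟨mem_dom_self m₀, mem_iInter.2 hmU⟩, inter_subset_left, ℓ, ?_, ?_⟩
  · refine ContMDiffOn.neg (contMDiffOn_finsetSum fun i _ => ?_)
    exact contMDiffOn_smulRight (φ i)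
      ((hu i).mono (inter_subset_right.trans (iInter_subset U i)))
  · rintro ⟨m, b⟩ hm w
    have hmd : m ∈ dom (H := H) F B m₀ := hm.1
    have hsum : ∀ v ∈ ΔM m, (hco I m₀ m v, -ℓ m (fcoord F B m₀ ⟨m, b⟩) (hco I m₀ m v)) ∈
        Δ.coordSpace m₀ ⟨m, b⟩ := by
      intro v hv
      have h1 := LinearDistribution.coordSpace_sum (Δ := Δ) hmd Finset.univ
        (fun i => f.repr (fcoord F B m₀ ⟨m, b⟩) i) (fun i => coSymm F B m₀ m (f i))
        (y := hco I m₀ m v) (fun i => u i m (hco I m₀ m v)) (by rwa [coSymm_hco hmd.1])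
        (fun i => hΔu i m (mem_iInter.1 hm.2 i) v hv)
      have h2 : ∑ i, f.repr (fcoord F B m₀ ⟨m, b⟩) i • coSymm F B m₀ m (f i) = b := by
        simp only [← map_smul, ← map_sum, f.sum_repr]
        rw [← co_apply hmd.2, coSymm_co hmd.2]
      rw [h2] at h1
      rwa [hℓ, neg_neg]
    rw [← LinearDistribution.coords_mem_coordSpace (e := ⟨m, b⟩) hmd]
    set v := dq I F ⟨m, b⟩ w with hv
    set z := vcoord I F m₀ ⟨m, b⟩ w
    have hcore := LinearDistribution.coordSpace_core (Δ := Δ) hmd (b := b)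
      (u := z + ℓ m (fcoord F B m₀ ⟨m, b⟩) (hco I m₀ m v))
    constructor
    · intro h
      have hvΔ : v ∈ ΔM m := by
        have := LinearDistribution.coordSpace_side hmd h
        rwa [coSymm_hco hmd.1] at this
      refine ⟨hvΔ, hcore.1 ?_⟩
      have := sub_mem h (hsum v hvΔ)
      simpa using this
    · rintro ⟨hvΔ, h⟩
      have := Submodule.add_mem _ (hcore.2 h) (hsum v hvΔ)
      simpa using this

end ToLocalForm

/-! ### Extension of local sections and functions -/

section Extension

variable {E H M : Type*} [NormedAddCommGroup E] [NormedSpace ℝ E] [TopologicalSpace H]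
  {I : ModelWithCorners ℝ E H} [TopologicalSpace M] [ChartedSpace H M] [IsManifold I ∞ M]
  {F : Type*} [NormedAddCommGroup F] [NormedSpace ℝ F]
  {B : M → Type*} [TopologicalSpace (TotalSpace F B)]
  [∀ m, AddCommGroup (B m)] [∀ m, Module ℝ (B m)] [∀ m, TopologicalSpace (B m)]
  [FiberBundle F B] [VectorBundle ℝ F B] [ContMDiffVectorBundle ∞ F B I]

variable [FiniteDimensional ℝ E] [T2Space M]

theorem exists_smooth_bump {m₀ : M} {U : Set M} (hU : U ∈ 𝓝 m₀) :
    ∃ χ : C^∞⟮I, M; ℝ⟯, tsupport χ ⊆ U ∧ ∀ᶠ m in 𝓝 m₀, χ m = 1 := by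
  obtain ⟨f, -, hf⟩ := (SmoothBumpFunction.nhds_basis_tsupport (I := I) m₀).mem_iff.1 hU
  exact ⟨⟨f, f.contMDiff⟩, hf, f.eventuallyEq_one⟩

/-- A local smooth section of a subbundle extends, after shrinking, to a global one. -/
theorem exists_section_extension {m₀ : M} {U : Set M} (hU : IsOpen U) (hm₀ : m₀ ∈ U)
    {s : ∀ m, B m} (hs : ContMDiffOn I (I.prod 𝓘(ℝ, F)) ∞ (fun m => TotalSpace.mk' F m (s m)) U)
    {S : ∀ m, Submodule ℝ (B m)} (hS : ∀ m ∈ U, s m ∈ S m) :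
    ∃ t : Cₛ^∞⟮I; F, B⟯, (∀ m, t m ∈ S m) ∧ ∀ᶠ m in 𝓝 m₀, t m = s m := by
  obtain ⟨χ, hχ, hχ1⟩ := exists_smooth_bump (I := I) (hU.mem_nhds hm₀)
  refine ⟨⟨(χ : M → ℝ) • s, χ.contMDiff.contMDiffOn.smul_section_of_tsupport hU hχ hs⟩,
    fun m => ?_, ?_⟩
  · change χ m • s m ∈ S m
    by_cases hm : m ∈ U
    · exact (S m).smul_mem _ (hS m hm)
    · rw [image_eq_zero_of_notMem_tsupport fun h => hm (hχ h), zero_smul]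
      exact zero_mem _
  · filter_upwards [hχ1] with m hm
    change χ m • s m = s m
    rw [hm, one_smul]

theorem exists_function_extension {m₀ : M} {U : Set M} (hU : IsOpen U) (hm₀ : m₀ ∈ U)
    {g : M → ℝ} (hg : ContMDiffOn I 𝓘(ℝ, ℝ) ∞ g U) :
    ∃ h : C^∞⟮I, M; ℝ⟯, ∀ᶠ m in 𝓝 m₀, h m = g m := by
  obtain ⟨χ, hχ, hχ1⟩ := exists_smooth_bump (I := I) (hU.mem_nhds hm₀)
  refine ⟨⟨fun m => χ m • g m, ?_⟩, ?_⟩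
  · refine contMDiff_of_tsupport fun m hm => ?_
    have hm' : m ∈ tsupport χ := closure_mono (Function.support_smul_subset_left χ g) hm
    exact χ.contMDiff.contMDiffAt.smul (hg.contMDiffAt (hU.mem_nhds (hχ hm')))
  · filter_upwards [hχ1] with m hm
    change χ m • g m = g m
    rw [hm, one_smul]

variable (I) in
theorem exists_section_const (m₀ : M) (f : F) :
    ∃ t : Cₛ^∞⟮I; F, B⟯, ∀ᶠ m in 𝓝 m₀, t m = coSymm F B m₀ m f := by
  obtain ⟨t, -, ht⟩ := exists_section_extension (I := I) (F := F) (isOpen_dom (H := H) (F := F)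
    (B := B) m₀) (mem_dom_self m₀) (s := fun m => coSymm F B m₀ m f)
    (fun m hm => (contMDiffAt_constInCoords I hm f).contMDiffWithinAt) (S := fun _ => ⊤)
    (fun _ _ => trivial)
  exact ⟨t, ht⟩

variable (I F) in
theorem exists_section_eq {m : M} (b : B m) : ∃ t : Cₛ^∞⟮I; F, B⟯, t m = b := by
  obtain ⟨t, ht⟩ := exists_section_const (F := F) (B := B) I m (co F m m b)
  refine ⟨t, ht.self_of_nhds.trans ?_⟩
  rw [coSymm_co (mem_baseSet_trivializationAt F B m)]

variable {ΔM : ∀ m : M, Submodule ℝ (TangentSpace I m)} {C : ∀ m, Submodule ℝ (B m)}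

/-- Sections of `ΔM` with prescribed values after projection in coordinates. -/
theorem exists_sideSection_const (hΔM : IsSmoothSubbundle I E (TangentSpace I : M → Type _) ΔM)
    (m₀ : M) :
    ∃ P : M → E →L[ℝ] E, (∀ᶠ m in 𝓝 m₀, ∀ v ∈ ΔM m, P m (hco I m₀ m v) = hco I m₀ m v) ∧
      ∀ y, ∃ x : SideSection ΔM, ∀ᶠ m in 𝓝 m₀,
        x.1 m = coSymm E (TangentSpace I : M → Type _) m₀ m (P m y) := by
  obtain ⟨U, hU, hm₀, hUd, P, hP, hPM⟩ := hΔM.exists_projector m₀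
  refine ⟨P, ?_, fun y => ?_⟩
  · filter_upwards [hU.mem_nhds hm₀] with m hm v hv
    exact ((hPM m hm).2 v).1 hv
  · obtain ⟨t, ht, hts⟩ := exists_section_extension (I := I) (F := E)
      (B := (TangentSpace I : M → Type _)) hU hm₀
      (s := fun m => coSymm E (TangentSpace I : M → Type _) m₀ m (P m y)) (S := ΔM)
      ((contMDiffOn_section_co hU hUd).2 ((hP.clm_apply (contMDiffOn_const (c := y))).congr
        fun m hm => co_coSymm (hUd hm) _))
      (fun m hm => by
        rw [(hPM m hm).2, co_coSymm (hUd hm)]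
        exact DFunLike.congr_fun (hPM m hm).1 y)
    exact ⟨⟨t, ht⟩, hts⟩

theorem exists_sideSection_eq (hΔM : IsSmoothSubbundle I E (TangentSpace I : M → Type _) ΔM)
    {m : M} {v : TangentSpace I m} (hv : v ∈ ΔM m) : ∃ x : SideSection ΔM, x.1 m = v := by
  obtain ⟨P, hP, hx⟩ := exists_sideSection_const hΔM m
  obtain ⟨x, hx⟩ := hx (hco I m m v)
  refine ⟨x, hx.self_of_nhds.trans ?_⟩
  rw [hP.self_of_nhds v hv, coSymm_hco (mem_chart_source H m)]

end Extension

/-! ### Locality and the local formula for Spencer operators -/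

section Spencer

variable {E H M : Type*} [NormedAddCommGroup E] [NormedSpace ℝ E] [TopologicalSpace H]
  {I : ModelWithCorners ℝ E H} [TopologicalSpace M] [ChartedSpace H M] [IsManifold I ∞ M]
  {F : Type*} [NormedAddCommGroup F] [NormedSpace ℝ F]
  {B : M → Type*} [TopologicalSpace (TotalSpace F B)]
  [∀ m, AddCommGroup (B m)] [∀ m, Module ℝ (B m)] [∀ m, TopologicalSpace (B m)]
  [FiberBundle F B] [VectorBundle ℝ F B] [ContMDiffVectorBundle ∞ F B I]

variable [FiniteDimensional ℝ E] [T2Space M]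
  {ΔM : ∀ m : M, Submodule ℝ (TangentSpace I m)} {C : ∀ m, Submodule ℝ (B m)}

namespace SpencerOperator

variable (D : SpencerOperator I F ΔM C)

theorem map_zero (m : M) : (D.toFun 0).1 m = 0 := by
  have := D.map_add 0 0 m
  rwa [add_zero, left_eq_add] at this

theorem map_sum {ι : Type*} (t : Finset ι) (s : ι → Cₛ^∞⟮I; F, B⟯) (m : M) :
    (D.toFun (∑ i ∈ t, s i)).1 m = ∑ i ∈ t, (D.toFun (s i)).1 m := by
  classical
  induction t using Finset.induction_on with
  | empty => simpa using D.map_zero m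
  | insert i t hi ih => rw [Finset.sum_insert hi, Finset.sum_insert hi, D.map_add, ih]

variable (hΔM : IsSmoothSubbundle I E (TangentSpace I : M → Type _) ΔM)
include hΔM

/-- Every vector of `ΔM` is the value of a global section, so the rule for sections holds pointwise.
-/
theorem leibniz' (f : C^∞⟮I, M; ℝ⟯) (b : Cₛ^∞⟮I; F, B⟯) {m : M} (v : ΔM m) :
    (D.toFun (fsmul f b)).1 m v =
      f m • (D.toFun b).1 m v + mvfderiv I f m (v : TangentSpace I m) • (C m).mkQ (b m) := by
  obtain ⟨x, hx⟩ := exists_sideSection_eq hΔM v.2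
  have := D.leibniz x f b m
  have hxv : x.val m = v := Subtype.ext hx
  rwa [hxv, hx] at this

/-- `D` is a local operator. -/
theorem congr_of_eventuallyEq {b b' : Cₛ^∞⟮I; F, B⟯} {m : M} (h : ∀ᶠ m' in 𝓝 m, b m' = b' m') :
    (D.toFun b).1 m = (D.toFun b').1 m := by
  -- With `χ` supported where `b = b'`, the section `χ (b - b')` vanishes. The Leibniz rule at `m`,
  -- where `χ = 1` and `b - b' = 0`, then leaves only `D (b - b')`.
  obtain ⟨χ, hχ, hχ1⟩ := exists_smooth_bump (I := I) h
  have h0 : fsmul χ (b - b') = 0 := by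
    ext m'
    change χ m' • (b m' - b' m') = 0
    by_cases hm : m' ∈ tsupport χ
    · rw [show b m' = b' m' from hχ hm, sub_self, smul_zero]
    · rw [image_eq_zero_of_notMem_tsupport hm, zero_smul]
  have h1 : (D.toFun (b - b')).1 m = 0 := by
    ext v
    have h2 := D.leibniz' hΔM χ (b - b') v
    have h3 : (b - b') m = 0 := by
      change b m - b' m = 0
      rw [h.self_of_nhds, sub_self]
    rw [h0, D.map_zero, hχ1.self_of_nhds, h3, _root_.map_zero, smul_zero, add_zero, one_smul] at h2
    exact h2.symm
  have h2 := D.map_add (b - b') b' m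
  rwa [sub_add_cancel, h1, zero_add] at h2

/-- Near `m`, `s = ∑ gᵢ eᵢ` with global functions `gᵢ` extending the components of `s`. By locality
and the Leibniz rule, `D s` is the sum of the terms `gᵢ D eᵢ` and of `π(dgᵢ ⊗ eᵢ)`; the latter add
up to `π(ds)`. -/
theorem eq_of_local_frame [FiniteDimensional ℝ F] {m₀ m : M} (hm : m ∈ dom (H := H) F B m₀)
    {ι : Type*} [Fintype ι] (f : Module.Basis ι ℝ F) (e : ι → Cₛ^∞⟮I; F, B⟯)
    (he : ∀ᶠ m' in 𝓝 m, ∀ i, e i m' = coSymm F B m₀ m' (f i)) (s : Cₛ^∞⟮I; F, B⟯) (v : ΔM m) :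
    (D.toFun s).1 m v = ∑ i, f.repr (co F m₀ m (s m)) i • (D.toFun (e i)).1 m v +
      (C m).mkQ (coSymm F B m₀ m (mvfderiv I (fun m => fcoord F B m₀ ⟨m, s m⟩) m v)) := by
  let φ : ι → F →L[ℝ] ℝ := fun i => LinearMap.toContinuousLinearMap (f.coord i)
  have hφ : ∀ y, ∑ i, φ i y • f i = y := f.sum_repr
  have hsm : ContMDiffOn I 𝓘(ℝ, F) ∞ (fun m => fcoord F B m₀ ⟨m, s m⟩) (dom (H := H) F B m₀) :=
    fun m hm => ((contMDiffAt_total_iff (g := fun m => (⟨m, s m⟩ : TotalSpace F B)) hm.2).1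
      (s.contMDiff m)).2.contMDiffWithinAt
  choose g hg using fun i => exists_function_extension (I := I) (isOpen_dom m₀) hm
    ((φ i).contMDiff.comp_contMDiffOn hsm)
  have hsum : ∀ (t : Finset ι) (h : ι → Cₛ^∞⟮I; F, B⟯) (m : M),
      (∑ i ∈ t, h i) m = ∑ i ∈ t, h i m := by
    classical
    intro t h m
    induction t using Finset.induction_on with
    | empty => simp
    | insert i t hi ih => rw [Finset.sum_insert hi, Finset.sum_insert hi, ← ih]; rfl
  have hloc : ∀ᶠ m' in 𝓝 m, s m' = (∑ i, fsmul (g i) (e i)) m' := by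
    filter_upwards [he, Filter.eventually_all.2 hg, (isOpen_dom m₀).mem_nhds hm]
      with m' he' hg' hm'
    rw [hsum]
    have : ∀ i, fsmul (g i) (e i) m' = coSymm F B m₀ m' (φ i (fcoord F B m₀ ⟨m', s m'⟩) • f i) := by
      intro i
      change g i m' • e i m' = _
      rw [he', hg', map_smul]
      rfl
    simp only [this, ← _root_.map_sum, hφ]
    rw [← co_apply hm'.2, coSymm_co hm'.2]
  have hd : ∀ i, mvfderiv I (g i) m (v : TangentSpace I m) =
      φ i (mvfderiv I (fun m => fcoord F B m₀ ⟨m, s m⟩) m v) := fun i => by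
    rw [mvfderiv_congr (hg i)]
    exact mvfderiv_clm_comp (φ i)
      ((hsm.contMDiffAt ((isOpen_dom m₀).mem_nhds hm)).mdifferentiableAt (by simp)) _
  rw [D.congr_of_eventuallyEq hΔM hloc, D.map_sum, LinearMap.sum_apply]
  simp only [D.leibniz' hΔM, hd, Finset.sum_add_distrib]
  congr 1
  · refine Finset.sum_congr rfl fun i _ => ?_
    rw [(hg i).self_of_nhds]
    change φ i (fcoord F B m₀ ⟨m, s m⟩) • _ = _
    rw [co_apply hm.2]
    rfl
  · simp only [he.self_of_nhds, ← map_smul, ← _root_.map_sum, hφ]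

end SpencerOperator

end Spencer

/-! ### Every Spencer operator is locally `π ∘ (d + ℓ)` -/

section SpencerForm

variable {E H M : Type*} [NormedAddCommGroup E] [NormedSpace ℝ E] [TopologicalSpace H]
  {I : ModelWithCorners ℝ E H} [TopologicalSpace M] [ChartedSpace H M] [IsManifold I ∞ M]
  {F : Type*} [NormedAddCommGroup F] [NormedSpace ℝ F]
  {B : M → Type*} [TopologicalSpace (TotalSpace F B)]
  [∀ m, AddCommGroup (B m)] [∀ m, Module ℝ (B m)] [∀ m, TopologicalSpace (B m)]
  [FiberBundle F B] [VectorBundle ℝ F B] [ContMDiffVectorBundle ∞ F B I]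

variable {ΔM : ∀ m : M, Submodule ℝ (TangentSpace I m)} {C : ∀ m, Submodule ℝ (B m)}

variable (I) in
/-- The connection `d + ℓ` in the coordinates at `m₀`, applied to the section `s`. -/
def localConn (m₀ : M) (ℓ : F →L[ℝ] E →L[ℝ] F) (s : Cₛ^∞⟮I; F, B⟯) (m : M) :
    TangentSpace I m →L[ℝ] B m :=
  coSymm F B m₀ m ∘L (mvfderiv I (fun m => fcoord F B m₀ ⟨m, s m⟩) m +
    ℓ (co F m₀ m (s m)) ∘L hco I m₀ m)

theorem localConn_apply (m₀ : M) (ℓ : F →L[ℝ] E →L[ℝ] F) (s : Cₛ^∞⟮I; F, B⟯) (m : M)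
    (v : TangentSpace I m) : localConn I m₀ ℓ s m v =
      coSymm F B m₀ m (mvfderiv I (fun m => fcoord F B m₀ ⟨m, s m⟩) m v +
        ℓ (co F m₀ m (s m)) (hco I m₀ m v)) := rfl

/-- In the coordinates at `m₀`, the operator `D` has the form `π ∘ (d + ℓ)`. -/
def HasLocalSymbol (D : SpencerOperator I F ΔM C) (m₀ : M) : Prop :=
  ∃ U : Set M, IsOpen U ∧ m₀ ∈ U ∧ U ⊆ dom (H := H) F B m₀ ∧ ∃ ℓ : M → F →L[ℝ] E →L[ℝ] F,
    ContMDiffOn I 𝓘(ℝ, F →L[ℝ] E →L[ℝ] F) ∞ ℓ U ∧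
    ∀ m ∈ U, ∀ (s : Cₛ^∞⟮I; F, B⟯) (v : ΔM m),
      (D.toFun s).1 m v = (C m).mkQ (localConn I m₀ (ℓ m) s m v)

variable [FiniteDimensional ℝ E] [T2Space M] [FiniteDimensional ℝ F]

-- The coefficient of `ℓ` at `(f i, g j)` is a smooth local lift `t i j` to `B` of the quotient
-- section `D_{x j} (e i)`, read in coordinates. The choice of lift does not matter after applying
-- `π`.
set_option synthInstance.maxHeartbeats 200000 in
theorem SpencerOperator.hasLocalSymbol (D : SpencerOperator I F ΔM C)
    (hΔM : IsSmoothSubbundle I E (TangentSpace I : M → Type _) ΔM) (m₀ : M) :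
    HasLocalSymbol D m₀ := by
  let f := Module.finBasis ℝ F
  let g := Module.finBasis ℝ E
  let φ := fun i => LinearMap.toContinuousLinearMap (f.coord i)
  let γ := fun j => LinearMap.toContinuousLinearMap (g.coord j)
  choose e he using fun i => exists_section_const (F := F) (B := B) I m₀ (f i)
  obtain ⟨P, hP, hx⟩ := exists_sideSection_const hΔM m₀
  choose x hx using fun j => hx (g j)
  choose W hW hmW t ht htD using fun i j => (D.toFun (e i)).2 (x j) m₀
  have hev : ∀ᶠ m in 𝓝 m₀, m ∈ dom (H := H) F B m₀ ∧ (∀ i j, m ∈ W i j) ∧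
      (∀ᶠ m' in 𝓝 m, ∀ i, e i m' = coSymm F B m₀ m' (f i)) ∧
      (∀ v ∈ ΔM m, P m (hco I m₀ m v) = hco I m₀ m v) ∧
      ∀ j, (x j).1 m = coSymm E (TangentSpace I : M → Type _) m₀ m (P m (g j)) := by
    filter_upwards [(isOpen_dom (H := H) (F := F) (B := B) m₀).mem_nhds (mem_dom_self m₀),
      Filter.eventually_all.2 fun i => Filter.eventually_all.2 fun j => (hW i j).mem_nhds (hmW i j),
      (Filter.eventually_all.2 he).eventually_nhds, hP, Filter.eventually_all.2 hx]
      with m h1 h2 h3 h4 h5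
    exact ⟨h1, h2, h3, h4, h5⟩
  obtain ⟨U, hUs, hU, hm₀⟩ := mem_nhds_iff.1 hev
  refine ⟨U, hU, hm₀, fun m hm => (hUs hm).1, fun m => ∑ i, (φ i).smulRight
    (∑ j, (γ j).smulRight (co F m₀ m (t i j m))), ?_, fun m hm s v => ?_⟩
  · refine contMDiffOn_finsetSum fun i _ => contMDiffOn_smulRight _ (contMDiffOn_finsetSum
      fun j _ => contMDiffOn_smulRight _ ?_)
    exact (contMDiffOn_section_co hU fun m hm => (hUs hm).1.2).1
      ((ht i j).mono fun m hm => (hUs hm).2.1 i j)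
  · obtain ⟨hmd, hmW, hme, hmP, hmx⟩ := hUs hm
    -- The sections `x j` are projections of a constant frame of `TM` and need not be independent;
    -- they still span, because `P` fixes the coordinates of `v ∈ ΔM`.
    have hv : v = ∑ j, γ j (hco I m₀ m v) • (x j).val m := by
      apply Subtype.ext
      rw [Submodule.coe_sum]
      change (v : TangentSpace I m) = ∑ j, γ j (hco I m₀ m v) • (x j).1 m
      simp only [hmx, ← map_smul, ← _root_.map_sum]
      rw [show ∑ j, γ j (hco I m₀ m v) • g j = hco I m₀ m v from g.sum_repr _, hmP v v.2,
        coSymm_hco hmd.1]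
    have hDe : ∀ i, (D.toFun (e i)).1 m v =
        (C m).mkQ (∑ j, γ j (hco I m₀ m v) • t i j m) := fun i => by
      conv_lhs => rw [hv]
      simp only [_root_.map_sum, map_smul]
      exact Finset.sum_congr rfl fun j _ => by rw [htD i j m (hmW i j)]
    rw [D.eq_of_local_frame hΔM hmd f e hme s v]
    simp only [hDe, ← map_smul, ← _root_.map_sum, ← _root_.map_add]
    refine congrArg (C m).mkQ ?_
    rw [localConn_apply, _root_.map_add, add_comm]
    refine congrArg _ ?_
    simp only [sum_apply, ContinuousLinearMap.smulRight_apply,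
      _root_.map_sum, map_smul, coSymm_co hmd.2, smul_apply]
    rfl

end SpencerForm

/-! ### The relation between distributions and operators -/

section Correspondence

variable {E H M : Type*} [NormedAddCommGroup E] [NormedSpace ℝ E] [TopologicalSpace H]
  {I : ModelWithCorners ℝ E H} [TopologicalSpace M] [ChartedSpace H M] [IsManifold I ∞ M]
  {F : Type*} [NormedAddCommGroup F] [NormedSpace ℝ F]
  {B : M → Type*} [TopologicalSpace (TotalSpace F B)]
  [∀ m, AddCommGroup (B m)] [∀ m, Module ℝ (B m)] [∀ m, TopologicalSpace (B m)]
  [FiberBundle F B] [VectorBundle ℝ F B] [ContMDiffVectorBundle ∞ F B I]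

variable {ΔM : ∀ m : M, Submodule ℝ (TangentSpace I m)} {C : ∀ m, Submodule ℝ (B m)}

/-- The tangent map `T_m s : T_m M → T_{s(m)} B` of a section. -/
abbrev sectionTangent (s : Cₛ^∞⟮I; F, B⟯) (m : M) :
    TangentSpace I m →L[ℝ] TangentSpace (I.prod 𝓘(ℝ, F)) (⟨m, s m⟩ : TotalSpace F B) :=
  mfderiv I (I.prod 𝓘(ℝ, F)) (fun m => (⟨m, s m⟩ : TotalSpace F B)) m

theorem dq_sub_verticalLift (s : Cₛ^∞⟮I; F, B⟯) {m : M} (v : TangentSpace I m) (c : B m) :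
    dq I F ⟨m, s m⟩ (sectionTangent s m v - verticalLift I F ⟨m, s m⟩ c) = v := by
  have h := dq_verticalLift (I := I) (⟨m, s m⟩ : TotalSpace F B) c
  rw [map_sub, dq_mfderiv_section, h, sub_zero]

theorem vcoord_sub_verticalLift {m₀ m : M} (hm : m ∈ (trivializationAt F B m₀).baseSet)
    (s : Cₛ^∞⟮I; F, B⟯) (v : TangentSpace I m) (c : B m) :
    vcoord I F m₀ ⟨m, s m⟩ (sectionTangent s m v - verticalLift I F ⟨m, s m⟩ c) =
      mvfderiv I (fun m => fcoord F B m₀ ⟨m, s m⟩) m v - co F m₀ m c := by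
  have h := vcoord_verticalLift (I := I) (e := (⟨m, s m⟩ : TotalSpace F B)) hm c
  rw [map_sub, vcoord_mfderiv_section hm, h]

theorem sub_verticalLift_eq_add (s : Cₛ^∞⟮I; F, B⟯) {m : M} (v : TangentSpace I m) (c c' : B m) :
    sectionTangent s m v - verticalLift I F ⟨m, s m⟩ c + verticalLift I F ⟨m, s m⟩ c' =
      sectionTangent s m v - verticalLift I F ⟨m, s m⟩ (c - c') := by
  have hm := mem_dom_self (H := H) (F := F) (B := B) m
  refine tangent_ext (e := ⟨m, s m⟩) hm ?_ ?_
  · rw [map_add, dq_sub_verticalLift, dq_sub_verticalLift, dq_verticalLift, add_zero]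
  · rw [map_add, vcoord_sub_verticalLift hm.2, vcoord_sub_verticalLift hm.2,
      vcoord_verticalLift (e := ⟨m, s m⟩) hm.2, map_sub]
    abel

/-- Every tangent vector of `B` is of the form `Ts(v) - c^↑`. -/
theorem exists_eq_sub_verticalLift (s : Cₛ^∞⟮I; F, B⟯) {m : M}
    (w : TangentSpace (I.prod 𝓘(ℝ, F)) (⟨m, s m⟩ : TotalSpace F B)) :
    ∃ c, w = sectionTangent s m (dq I F ⟨m, s m⟩ w) - verticalLift I F ⟨m, s m⟩ c := by
  have hm := mem_dom_self (H := H) (F := F) (B := B) m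
  refine ⟨coSymm F B m m (mvfderiv I (fun m' => fcoord F B m ⟨m', s m'⟩) m (dq I F ⟨m, s m⟩ w) -
    vcoord I F m ⟨m, s m⟩ w), tangent_ext (e := ⟨m, s m⟩) hm ?_ ?_⟩
  · rw [dq_sub_verticalLift]
  · rw [vcoord_sub_verticalLift hm.2, co_coSymm hm.2, sub_sub_cancel]

variable (I F) in
/-- The subspace of `T_e B` of the vectors over `ΔM` that are horizontal, up to `C`, for the
connection `d + ℓ` in the coordinates at `m₀`. -/
def localSpace (ΔM : ∀ m : M, Submodule ℝ (TangentSpace I m)) (C : ∀ m, Submodule ℝ (B m)) (m₀ : M)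
    (ℓ : F →L[ℝ] E →L[ℝ] F) (e : TotalSpace F B) :
    Submodule ℝ (TangentSpace (I.prod 𝓘(ℝ, F)) e) :=
  (ΔM e.1).comap (dq I F e).toLinearMap ⊓ (C e.1).comap (coSymm F B m₀ e.1 ∘L
    (vcoord I F m₀ e + (ℓ (fcoord F B m₀ e) ∘L hco I m₀ e.1) ∘L dq I F e)).toLinearMap

theorem mem_localSpace {m₀ : M} {ℓ : F →L[ℝ] E →L[ℝ] F} {e : TotalSpace F B}
    {w : TangentSpace (I.prod 𝓘(ℝ, F)) e} :
    w ∈ localSpace I F ΔM C m₀ ℓ e ↔ dq I F e w ∈ ΔM e.1 ∧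
      coSymm F B m₀ e.1 (vcoord I F m₀ e w +
        ℓ (fcoord F B m₀ e) (hco I m₀ e.1 (dq I F e w))) ∈ C e.1 := Iff.rfl

/-- The vertical coordinate of `Ts(v) - c^↑` is `ds(v) - c`; adding `ℓ(s)(v)` gives `∇_v s - c` for
`∇ = d + ℓ`. Hence the same `ℓ` describes `Δ` and `D`. -/
theorem sub_mem_localSpace {m₀ m : M} (hm : m ∈ dom (H := H) F B m₀) {ℓ : F →L[ℝ] E →L[ℝ] F}
    (s : Cₛ^∞⟮I; F, B⟯) {v : TangentSpace I m} (c : B m) :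
    sectionTangent s m v - verticalLift I F ⟨m, s m⟩ c ∈ localSpace I F ΔM C m₀ ℓ ⟨m, s m⟩ ↔
      v ∈ ΔM m ∧ (C m).mkQ (localConn I m₀ ℓ s m v) = (C m).mkQ c := by
  rw [mem_localSpace, dq_sub_verticalLift, vcoord_sub_verticalLift hm.2]
  refine and_congr_right fun _ => ?_
  rw [Submodule.mkQ_apply, Submodule.mkQ_apply, Submodule.Quotient.eq, ← co_apply hm.2,
    sub_add_eq_add_sub, map_sub, coSymm_co hm.2]
  rfl

/-- `Δ` corresponds to `D` if the horizontal vectors `Ts(v) - (D_v s)^↑` lie in `Δ`. -/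
def Corresponds (Δ : LinearDistribution I F ΔM C) (D : SpencerOperator I F ΔM C) : Prop :=
  ∀ (s : Cₛ^∞⟮I; F, B⟯) (m : M) (v : ΔM m) (c : B m),
    sectionTangent s m (v : TangentSpace I m) - verticalLift I F ⟨m, s m⟩ c ∈ Δ.space ⟨m, s m⟩ ↔
      (D.toFun s).1 m v = (C m).mkQ c

theorem SpencerOperator.ext' {D D' : SpencerOperator I F ΔM C}
    (h : ∀ s m v, (D.toFun s).1 m v = (D'.toFun s).1 m v) : D = D' := by
  have h' : D.toFun = D'.toFun :=
    funext fun s => Subtype.ext (funext fun m => LinearMap.ext (h s m))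
  cases D
  cases D'
  cases h'
  rfl

theorem LinearDistribution.ext' {Δ Δ' : LinearDistribution I F ΔM C} (h : Δ.space = Δ'.space) :
    Δ = Δ' := by
  cases Δ
  cases Δ'
  cases h
  rfl

theorem Corresponds.operator_eq {Δ : LinearDistribution I F ΔM C} {D D' : SpencerOperator I F ΔM C}
    (h : Corresponds Δ D) (h' : Corresponds Δ D') : D = D' :=
  SpencerOperator.ext' fun s m v => by
    obtain ⟨c, hc⟩ := (C m).mkQ_surjective ((D.toFun s).1 m v)
    rw [← hc]
    exact ((h' s m v c).1 ((h s m v c).2 hc.symm)).symm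

/-- A subspace over `ΔM` of the tangent space of `B` is determined by the vectors
`Ts(v) - c^↑` in it, for `v ∈ ΔM`. -/
theorem space_eq {s : Cₛ^∞⟮I; F, B⟯} {m : M}
    {S S' : Submodule ℝ (TangentSpace (I.prod 𝓘(ℝ, F)) (⟨m, s m⟩ : TotalSpace F B))}
    (hS : ∀ w ∈ S, dq I F ⟨m, s m⟩ w ∈ ΔM m) (hS' : ∀ w ∈ S', dq I F ⟨m, s m⟩ w ∈ ΔM m)
    (h : ∀ v ∈ ΔM m, ∀ c, sectionTangent s m v - verticalLift I F ⟨m, s m⟩ c ∈ S ↔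
      sectionTangent s m v - verticalLift I F ⟨m, s m⟩ c ∈ S') : S = S' := by
  ext w
  obtain ⟨c, hc⟩ := exists_eq_sub_verticalLift s w
  by_cases hw : dq I F ⟨m, s m⟩ w ∈ ΔM m
  · rw [hc]
    exact h _ hw c
  · exact ⟨fun h => (hw (hS w h)).elim, fun h => (hw (hS' w h)).elim⟩

theorem Corresponds.distribution_eq [FiniteDimensional ℝ E] [T2Space M]
    {Δ Δ' : LinearDistribution I F ΔM C} {D : SpencerOperator I F ΔM C}
    (h : Corresponds Δ D) (h' : Corresponds Δ' D) : Δ = Δ' :=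
  LinearDistribution.ext' <| funext fun ⟨m, b⟩ => by
    obtain ⟨s, rfl⟩ := exists_section_eq I F b
    exact space_eq (fun w hw => Δ.proj_mem ⟨⟨m, s m⟩, w⟩ hw)
      (fun w hw => Δ'.proj_mem ⟨⟨m, s m⟩, w⟩ hw)
      fun v hv c => (h s m ⟨v, hv⟩ c).trans (h' s m ⟨v, hv⟩ c).symm

end Correspondence

/-! ### The bijection and adapted connections -/

section Bijection

variable {E H M : Type*} [NormedAddCommGroup E] [NormedSpace ℝ E] [TopologicalSpace H]
  {I : ModelWithCorners ℝ E H} [TopologicalSpace M] [ChartedSpace H M] [IsManifold I ∞ M]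
  {F : Type*} [NormedAddCommGroup F] [NormedSpace ℝ F]
  {B : M → Type*} [TopologicalSpace (TotalSpace F B)]
  [∀ m, AddCommGroup (B m)] [∀ m, Module ℝ (B m)] [∀ m, TopologicalSpace (B m)]
  [FiberBundle F B] [VectorBundle ℝ F B] [ContMDiffVectorBundle ∞ F B I]

variable {ΔM : ∀ m : M, Submodule ℝ (TangentSpace I m)} {C : ∀ m, Submodule ℝ (B m)}

theorem mdifferentiableAt_fcoord_section {m₀ m : M} (hm : m ∈ (trivializationAt F B m₀).baseSet)
    (s : Cₛ^∞⟮I; F, B⟯) :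
    MDifferentiableAt I 𝓘(ℝ, F) (fun m => fcoord F B m₀ ⟨m, s m⟩) m :=
  ((contMDiffAt_total_iff (g := fun m => (⟨m, s m⟩ : TotalSpace F B)) hm).1
    (s.contMDiff m)).2.mdifferentiableAt (by simp)

theorem localConn_add {m₀ m : M} (hm : m ∈ dom (H := H) F B m₀) (ℓ : F →L[ℝ] E →L[ℝ] F)
    (s s' : Cₛ^∞⟮I; F, B⟯) (v : TangentSpace I m) :
    localConn I m₀ ℓ (s + s') m v = localConn I m₀ ℓ s m v + localConn I m₀ ℓ s' m v := by
  have h : mvfderiv I (fun m => fcoord F B m₀ ⟨m, (s + s') m⟩) m v =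
      mvfderiv I (fun m => fcoord F B m₀ ⟨m, s m⟩) m v +
        mvfderiv I (fun m => fcoord F B m₀ ⟨m, s' m⟩) m v := by
    have h1 := mvfderiv_add (mdifferentiableAt_fcoord_section (I := I) hm.2 s)
      (mdifferentiableAt_fcoord_section (I := I) hm.2 s')
    refine (mvfderiv_congr ?_ v).trans (DFunLike.congr_fun h1 v)
    filter_upwards [(isOpen_dom m₀).mem_nhds hm] with m' hm'
    exact fcoord_add hm'.2 _ _
  have h' : co F m₀ m ((s + s') m) = co F m₀ m (s m) + co F m₀ m (s' m) := map_add _ _ _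
  rw [localConn_apply, localConn_apply, localConn_apply, ← map_add, h, h', map_add ℓ,
    add_apply, add_add_add_comm]

theorem localConn_fsmul {m₀ m : M} (hm : m ∈ dom (H := H) F B m₀) (ℓ : F →L[ℝ] E →L[ℝ] F)
    (f : C^∞⟮I, M; ℝ⟯) (s : Cₛ^∞⟮I; F, B⟯) (v : TangentSpace I m) :
    localConn I m₀ ℓ (fsmul f s) m v = f m • localConn I m₀ ℓ s m v + mvfderiv I f m v • s m := by
  have h : mvfderiv I (fun m => fcoord F B m₀ ⟨m, fsmul f s m⟩) m v =
      f m • mvfderiv I (fun m => fcoord F B m₀ ⟨m, s m⟩) m v +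
        mvfderiv I f m v • fcoord F B m₀ ⟨m, s m⟩ := by
    have h1 := mvfderiv_smul ((f.contMDiff m).mdifferentiableAt (by simp))
      (mdifferentiableAt_fcoord_section (I := I) hm.2 s)
    refine (mvfderiv_congr ?_ v).trans (DFunLike.congr_fun h1 v)
    filter_upwards [(isOpen_dom m₀).mem_nhds hm] with m' hm'
    exact fcoord_smul hm'.2 _ _
  have h' : co F m₀ m (fsmul f s m) = f m • co F m₀ m (s m) := map_smul _ _ _
  rw [localConn_apply, localConn_apply, h, h', map_smul, smul_apply, add_right_comm, ← smul_add,
    map_add, map_smul, map_smul, ← co_apply hm.2, coSymm_co hm.2]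

variable [FiniteDimensional ℝ E] [FiniteDimensional ℝ F]

theorem contMDiffOn_localConn {m₀ : M} {U : Set M} (hU : IsOpen U)
    (hUd : U ⊆ dom (H := H) F B m₀) {ℓ : M → F →L[ℝ] E →L[ℝ] F}
    (hℓ : ContMDiffOn I 𝓘(ℝ, F →L[ℝ] E →L[ℝ] F) ∞ ℓ U) (s : Cₛ^∞⟮I; F, B⟯)
    (x : Cₛ^∞⟮I; E, (TangentSpace I : M → Type _)⟯) :
    ContMDiffOn I (I.prod 𝓘(ℝ, F)) ∞
      (fun m => TotalSpace.mk' F m (localConn I m₀ (ℓ m) s m (x m))) U := by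
  refine (contMDiffOn_section_co hU fun m hm => (hUd hm).2).2 ?_
  -- The derivative `ds(x)` is smooth because it is the vertical coordinate of the smooth map `Ts ∘
  -- x` into `TB`.
  have h1 : ContMDiff I (I.prod 𝓘(ℝ, F)).tangent ∞ (fun m => (⟨⟨m, s m⟩,
      sectionTangent s m (x m)⟩ : TTot I F B)) :=
    (s.contMDiff.contMDiff_tangentMap (m := ∞) le_rfl).comp x.contMDiff
  have h2 : ContMDiffOn I 𝓘(ℝ, F) ∞
      (fun m => mvfderiv I (fun m => fcoord F B m₀ ⟨m, s m⟩) m (x m)) U := fun m hm => by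
    refine (((contMDiffAt_ttot_iff (m₀ := m₀) (g := fun m => (⟨⟨m, s m⟩,
      sectionTangent s m (x m)⟩ : TTot I F B)) (hUd hm)).1
      (h1 m)).2.2.congr_of_eventuallyEq ?_).contMDiffWithinAt
    filter_upwards [hU.mem_nhds hm] with m' hm'
    exact (vcoord_mfderiv_section (hUd hm').2 s (x m')).symm
  have h3 : ContMDiffOn I 𝓘(ℝ, F) ∞ (fun m => co F m₀ m (s m)) U :=
    (contMDiffOn_section_co hU fun m hm => (hUd hm).2).1 s.contMDiff.contMDiffOn
  have h4 : ContMDiffOn I 𝓘(ℝ, E) ∞ (fun m => hco I m₀ m (x m)) U :=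
    (contMDiffOn_section_co (F := E) (V := (TangentSpace I : M → Type _)) (x₀ := m₀) hU
      fun m hm => by simpa using (hUd hm).1).1 x.contMDiff.contMDiffOn
  refine (h2.add ((hℓ.clm_apply h3).clm_apply h4)).congr fun m hm => ?_
  rw [localConn_apply, co_coSymm (hUd hm).2]
  rfl

/-- `D` is defined at each `m` with the form `ℓ m` of the trivialization centred at `m` itself.
Additivity and the Leibniz rule are then pointwise; only smoothness requires a fixed trivialization
nearby. -/
theorem LinearDistribution.exists_corresponds (Δ : LinearDistribution I F ΔM C)
    (hΔM : IsSmoothSubbundle I E (TangentSpace I : M → Type _) ΔM) :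
    ∃ D : SpencerOperator I F ΔM C, Corresponds Δ D := by
  have hform : ∀ m₀ : M, ∃ U : Set M, IsOpen U ∧ m₀ ∈ U ∧ U ⊆ dom (H := H) F B m₀ ∧
      ∃ ℓ : M → F →L[ℝ] E →L[ℝ] F, ContMDiffOn I 𝓘(ℝ, F →L[ℝ] E →L[ℝ] F) ∞ ℓ U ∧
      ∀ e : TotalSpace F B, e.1 ∈ U → ∀ w, w ∈ Δ.space e ↔ w ∈ localSpace I F ΔM C m₀ (ℓ e.1) e :=
    fun m₀ => Δ.hasLocalForm hΔM m₀
  choose U hU hmU hUd ℓ hℓ hmem using hform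
  have key : ∀ m₀, ∀ m ∈ U m₀, ∀ (s : Cₛ^∞⟮I; F, B⟯) (v : ΔM m) (c : B m),
      sectionTangent s m (v : TangentSpace I m) - verticalLift I F ⟨m, s m⟩ c ∈
        Δ.space ⟨m, s m⟩ ↔ (C m).mkQ (localConn I m₀ (ℓ m₀ m) s m v) = (C m).mkQ c :=
    fun m₀ m hm s v c => by
      rw [hmem m₀ ⟨m, s m⟩ hm, sub_mem_localSpace (hUd m₀ hm)]
      exact and_iff_right v.2
  -- Membership in `Δ` does not depend on the trivialization, so the class modulo `C` does not
  -- either.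
  have hind : ∀ m₀, ∀ m ∈ U m₀, ∀ (s : Cₛ^∞⟮I; F, B⟯) (v : ΔM m),
      (C m).mkQ (localConn I m (ℓ m m) s m v) = (C m).mkQ (localConn I m₀ (ℓ m₀ m) s m v) :=
    fun m₀ m hm s v => (key m m (hmU m) s v _).1 ((key m₀ m hm s v _).2 rfl)
  refine ⟨⟨fun s => ⟨fun m => (C m).mkQ ∘ₗ (localConn I m (ℓ m m) s m).toLinearMap ∘ₗ
    (ΔM m).subtype, fun x m₀ => ⟨U m₀, hU m₀, hmU m₀, _,
      contMDiffOn_localConn (hU m₀) (hUd m₀) (hℓ m₀) s x.1, fun m hm =>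
        (hind m₀ m hm s (x.val m)).symm⟩⟩, fun s s' m => LinearMap.ext fun v => ?_,
      fun x f s m => ?_⟩, fun s m v c => key m m (hmU m) s v c⟩
  · change (C m).mkQ (localConn I m (ℓ m m) (s + s') m v) = _
    rw [localConn_add (mem_dom_self m), map_add]
    rfl
  · change (C m).mkQ (localConn I m (ℓ m m) (fsmul f s) m (x.1 m)) = _
    rw [localConn_fsmul (mem_dom_self m), map_add, map_smul, map_smul]
    rfl

variable [T2Space M]

/-- The space at `e` is built from the local symbol centred at `e.1`. As `D` itself fixes which
vectors `Ts(v) - c^↑` belong to it, any nearby trivialization gives the same space by `space_eq`,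
and thus smooth local forms. -/
theorem SpencerOperator.exists_corresponds (D : SpencerOperator I F ΔM C)
    (hΔM : IsSmoothSubbundle I E (TangentSpace I : M → Type _) ΔM)
    (hC : IsSmoothSubbundle I F B C) :
    ∃ Δ : LinearDistribution I F ΔM C, Corresponds Δ D := by
  choose U hU hmU hUd ℓ hℓ hD using fun m₀ => D.hasLocalSymbol hΔM m₀
  let S : ∀ e : TotalSpace F B, Submodule ℝ (TangentSpace (I.prod 𝓘(ℝ, F)) e) := fun e =>
    localSpace I F ΔM C e.1 (ℓ e.1 e.1) e
  have hS : ∀ m₀, HasLocalForm ΔM C S m₀ := fun m₀ => by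
    refine ⟨U m₀, hU m₀, hmU m₀, hUd m₀, ℓ m₀, hℓ m₀, fun ⟨m, b⟩ hm w => ?_⟩
    obtain ⟨s, rfl⟩ := exists_section_eq I F b
    have : S ⟨m, s m⟩ = localSpace I F ΔM C m₀ (ℓ m₀ m) ⟨m, s m⟩ :=
      space_eq (fun w hw => hw.1) (fun w hw => hw.1) fun v hv c => by
        have h1 := hD m m (hmU m) s ⟨v, hv⟩
        rw [hD m₀ m hm s ⟨v, hv⟩] at h1
        rw [sub_mem_localSpace (mem_dom_self m), sub_mem_localSpace (hUd m₀ hm), ← h1]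
    rw [this]
    rfl
  refine ⟨LinearDistribution.ofLocalForm S hΔM hC hS, fun s m v c => ?_⟩
  refine (sub_mem_localSpace (mem_dom_self m) s c).trans ?_
  rw [hD m m (hmU m) s v]
  exact and_iff_right v.2

/-- The bijection between linear distributions and Spencer operators. -/
theorem exists_equiv_corresponds
    (hΔM : IsSmoothSubbundle I E (TangentSpace I : M → Type _) ΔM)
    (hC : IsSmoothSubbundle I F B C) :
    ∃ 𝔻 : LinearDistribution I F ΔM C ≃ SpencerOperator I F ΔM C, ∀ Δ, Corresponds Δ (𝔻 Δ) := by
  choose f hf using fun Δ : LinearDistribution I F ΔM C => Δ.exists_corresponds hΔM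
  choose g hg using fun D : SpencerOperator I F ΔM C => D.exists_corresponds hΔM hC
  exact ⟨⟨f, g, fun Δ => (hg (f Δ)).distribution_eq (hf Δ), fun D => (hf (g D)).operator_eq (hg D)⟩,
    hf⟩

/-- By `hdec`, `σ_∇(v, s(m), c)` lies in `Δ` iff `D_v s = π(∇_v s - c)`. Taking `c = 0` gives one
direction; conversely, each vector of `Δ` is `Ts(v) - c^↑` with `∇_v s - c ∈ C`. -/
theorem isAdapted_iff [∀ m, IsTopologicalAddGroup (B m)] [∀ m, ContinuousSMul ℝ (B m)]
    (hΔM : IsSmoothSubbundle I E (TangentSpace I : M → Type _) ΔM)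
    {Δ : LinearDistribution I F ΔM C} {D : SpencerOperator I F ΔM C} (h : Corresponds Δ D)
    (cov : CovariantDerivative I F B) :
    IsAdapted cov Δ ↔ ∀ (x : SideSection ΔM) (b : Cₛ^∞⟮I; F, B⟯) (m : M),
      (C m).mkQ (cov b m (x.1 m)) = D.eval x b m := by
  have hdec : ∀ {m : M} (v : TangentSpace I m) (s : Cₛ^∞⟮I; F, B⟯) (c : B m),
      decomposition cov v s c =
        sectionTangent s m v - verticalLift I F ⟨m, s m⟩ (cov s m v - c) :=
    fun v s c => sub_verticalLift_eq_add s v _ c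
  constructor
  · intro hA x b m
    refine ((h b m (x.val m) _).1 ?_).symm
    rw [← SetLike.mem_coe, ← hA m b]
    exact ⟨x.1 m, x.2 m, 0, zero_mem _, by rw [hdec, sub_zero]; rfl⟩
  · intro hD m s
    have hD' : ∀ v : ΔM m, (C m).mkQ (cov s m v) = (D.toFun s).1 m v := fun v => by
      obtain ⟨x, hx⟩ := exists_sideSection_eq hΔM v.2
      have hxv : x.val m = v := Subtype.ext hx
      rw [← hx, hD x s m, SpencerOperator.eval, hxv]
    ext w
    constructor
    · rintro ⟨v, hv, c, hc, rfl⟩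
      rw [hdec]
      refine (h s m ⟨v, hv⟩ _).2 ?_
      rw [← hD', map_sub, (C m).mkQ_apply c, (Submodule.Quotient.mk_eq_zero _).2 hc, sub_zero]
    · intro hw
      obtain ⟨c, hc⟩ := exists_eq_sub_verticalLift s w
      have hv : dq I F ⟨m, s m⟩ w ∈ ΔM m := Δ.proj_mem ⟨⟨m, s m⟩, w⟩ hw
      refine ⟨_, hv, cov s m (dq I F ⟨m, s m⟩ w) - c, ?_, ?_⟩
      · have h1 : (D.toFun s).1 m ⟨_, hv⟩ = (C m).mkQ c := (h s m ⟨_, hv⟩ c).1 (hc ▸ hw)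
        rw [← hD'] at h1
        exact (Submodule.Quotient.eq _).1 h1
      · rw [hdec, sub_sub_cancel, ← hc]

end Bijection

/-! ### The Lie bracket of vector fields in coordinates -/

section LieBracket

variable {EN HN N : Type*} [NormedAddCommGroup EN] [NormedSpace ℝ EN] [TopologicalSpace HN]
  {J : ModelWithCorners ℝ EN HN} [J.Boundaryless] [TopologicalSpace N] [ChartedSpace HN N]
  [IsManifold J ∞ N]

theorem inverse_mfderivWithin_extChartAt_symm {n : N} {y : EN}
    (hy : y ∈ (extChartAt J n).target) :
    (mfderivWithin 𝓘(ℝ, EN) J (extChartAt J n).symm (range J) y).inverse =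
      hco J n ((extChartAt J n).symm y) := by
  have hs : (extChartAt J n).symm y ∈ (chartAt HN n).source := by
    simpa using (extChartAt J n).map_target hy
  rw [hco_eq hs]
  exact ContinuousLinearMap.inverse_eq
    (mfderivWithin_extChartAt_symm_comp_mfderiv_extChartAt (I := J) hy)
    (mfderiv_extChartAt_comp_mfderivWithin_extChartAt_symm hy)

theorem hco_self (n : N) (v : TangentSpace J n) : hco J n n v = v := by
  rw [hco_eq (mem_chart_source HN n), mfderiv_extChartAt_self]
  rfl

/-- The bracket on a manifold is computed after pulling back to the model space. The pulled-back
field is the coordinate expression of `V`, so its derivative is a manifold derivative at `n`. -/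
theorem fderiv_mpullbackWithin_extChartAt {V : ∀ n : N, TangentSpace J n} {n : N}
    (hV : MDifferentiableAt J 𝓘(ℝ, EN) (fun n' => hco J n n' (V n')) n) (v : TangentSpace J n) :
    fderiv ℝ (VectorField.mpullbackWithin 𝓘(ℝ, EN) J (extChartAt J n).symm V (range J))
      (extChartAt J n n) v = mvfderiv J (fun n' => hco J n n' (V n')) n v := by
  have h : (VectorField.mpullbackWithin 𝓘(ℝ, EN) J (extChartAt J n).symm V (range J)) =ᶠ[
      𝓝 (extChartAt J n n)] (fun n' => (hco J n n' (V n') : EN)) ∘ (extChartAt J n).symm := by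
    filter_upwards [extChartAt_target_mem_nhds n] with y hy
    rw [VectorField.mpullbackWithin_apply, inverse_mfderivWithin_extChartAt_symm hy]
    rfl
  rw [h.fderiv_eq]
  have h1 := hV.mfderiv
  rw [J.range_eq_univ, fderivWithin_univ] at h1
  exact (DFunLike.congr_fun h1 v).symm

/-- The Lie bracket in the coordinates at the point where it is computed. -/
theorem hco_mlieBracket {V W : ∀ n : N, TangentSpace J n} {n : N}
    (hV : MDifferentiableAt J 𝓘(ℝ, EN) (fun n' => hco J n n' (V n')) n)
    (hW : MDifferentiableAt J 𝓘(ℝ, EN) (fun n' => hco J n n' (W n')) n) :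
    hco J n n (VectorField.mlieBracket J V W n) =
      mvfderiv J (fun n' => hco J n n' (W n')) n (V n) -
        mvfderiv J (fun n' => hco J n n' (V n')) n (W n) := by
  have hp : ∀ V : ∀ n : N, TangentSpace J n, VectorField.mpullbackWithin 𝓘(ℝ, EN) J
      (extChartAt J n).symm V (range J) (extChartAt J n n) = V n := fun V => by
    rw [VectorField.mpullbackWithin_apply,
      inverse_mfderivWithin_extChartAt_symm (mem_extChartAt_target n),
      extChartAt_to_inv]
    exact hco_self n (V n)
  -- At its own centre the chart has derivative the identity, so transporting the bracket back
  -- changes nothing.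
  have hi : ∀ z : EN, ((mfderiv J 𝓘(ℝ, EN) (extChartAt J n) n).inverse z : EN) = z := fun z => by
    rw [mfderiv_extChartAt_self]
    exact DFunLike.congr_fun (ContinuousLinearMap.inverse_id (R := ℝ) (M := EN)) z
  rw [hco_self, ← VectorField.mlieBracketWithin_univ, VectorField.mlieBracketWithin_apply]
  have hl : ∀ (X Y : EN → EN) (y : EN), VectorField.lieBracketWithin ℝ X Y
      ((extChartAt J n).symm ⁻¹' univ ∩ range J) y = fderiv ℝ Y y (X y) - fderiv ℝ X y (Y y) :=
    fun X Y y => by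
      rw [J.range_eq_univ, preimage_univ, inter_univ, VectorField.lieBracketWithin_univ,
        VectorField.lieBracket_eq]
  refine (hi _).trans ((hl _ _ _).trans ?_)
  rw [hp, hp, ← fderiv_mpullbackWithin_extChartAt hV, ← fderiv_mpullbackWithin_extChartAt hW]

end LieBracket

/-! ### The derivation of a linear vector field -/

section Derivation

variable {E H M : Type*} [NormedAddCommGroup E] [NormedSpace ℝ E] [TopologicalSpace H]
  {I : ModelWithCorners ℝ E H} [TopologicalSpace M] [ChartedSpace H M] [IsManifold I ∞ M]
  {F : Type*} [NormedAddCommGroup F] [NormedSpace ℝ F]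
  {B : M → Type*} [TopologicalSpace (TotalSpace F B)]
  [∀ m, AddCommGroup (B m)] [∀ m, Module ℝ (B m)] [∀ m, TopologicalSpace (B m)]
  [FiberBundle F B] [VectorBundle ℝ F B] [ContMDiffVectorBundle ∞ F B I]

variable {ΔM : ∀ m : M, Submodule ℝ (TangentSpace I m)} {C : ∀ m, Submodule ℝ (B m)}
  {Δ : LinearDistribution I F ΔM C} {x : SideSection ΔM}
  {X : ∀ e : TotalSpace F B, TangentSpace (I.prod 𝓘(ℝ, F)) e}

theorem mvfderiv_comp_proj {G : Type*} [NormedAddCommGroup G] [NormedSpace ℝ G]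
    {g : M → G} {e : TotalSpace F B} (hg : MDifferentiableAt I 𝓘(ℝ, G) g e.1)
    (w : TangentSpace (I.prod 𝓘(ℝ, F)) e) :
    mvfderiv (I.prod 𝓘(ℝ, F)) (fun e' => g e'.1) e w = mvfderiv I g e.1 (dq I F e w) :=
  mfderiv_comp_apply e hg (mdifferentiableAt_proj B) w

/-- The coordinates near `e` of a vector field on `B`. -/
theorem eventually_hco_total
    (Y : ∀ e : TotalSpace F B, TangentSpace (I.prod 𝓘(ℝ, F)) e)
    (e : TotalSpace F B) : ∀ᶠ e' in 𝓝 e, hco (I.prod 𝓘(ℝ, F)) e e' (Y e') =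
      (hco I e.1 e'.1 (dq I F e' (Y e')), vcoord I F e.1 e' (Y e')) := by
  filter_upwards [eventually_proj_mem (isOpen_dom e.1)
    (mem_dom_self (H := H) (F := F) (B := B) e.1)] with e' he'
  exact hco_total he'.1 he'.2 _

namespace IsLinearSection

theorem dq_eq (hX : IsLinearSection Δ x X) (e : TotalSpace F B) : dq I F e (X e) = x.1 e.1 :=
  TotalSpace.mk_injective e.1 (hX.covers e)

theorem vcoord_add (hX : IsLinearSection Δ x X) {m₀ m : M} (hm : m ∈ dom (H := H) F B m₀)
    (b b' : B m) : vcoord I F m₀ ⟨m, b + b'⟩ (X ⟨m, b + b'⟩) =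
      vcoord I F m₀ ⟨m, b⟩ (X ⟨m, b⟩) + vcoord I F m₀ ⟨m, b'⟩ (X ⟨m, b'⟩) :=
  ((isTSum_iff hm).1 (hX.map_add m b b')).2.2

theorem vcoord_smul (hX : IsLinearSection Δ x X) {m₀ m : M} (hm : m ∈ dom (H := H) F B m₀)
    (r : ℝ) (b : B m) : vcoord I F m₀ ⟨m, r • b⟩ (X ⟨m, r • b⟩) =
      r • vcoord I F m₀ ⟨m, b⟩ (X ⟨m, b⟩) := by
  have h : X ⟨m, r • b⟩ = (tsmul I F r ⟨⟨m, b⟩, X ⟨m, b⟩⟩).2 :=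
    TotalSpace.mk_injective (⟨m, r • b⟩ : TotalSpace F B) (hX.map_smul m r b)
  rw [h]
  exact vcoord_tsmul r ⟨⟨m, b⟩, X ⟨m, b⟩⟩ hm.2

theorem contMDiffAt_vcoord (hX : IsLinearSection Δ x X) {m₀ : M} {e : TotalSpace F B}
    (he : e.1 ∈ dom (H := H) F B m₀) :
    ContMDiffAt (I.prod 𝓘(ℝ, F)) 𝓘(ℝ, F) ∞ (fun e => vcoord I F m₀ e (X e)) e :=
  ((contMDiffAt_ttot_iff (g := fun e => (⟨e, X e⟩ : TTot I F B)) he).1 (hX.smooth e)).2.2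

variable [I.Boundaryless]

/-- In coordinates `X = (x(m), X_v(e))` and `b^↑ = (0, b(m))`. The bracket has horizontal part `0`
and vertical part `db(x) - dX_v(b^↑)`, and `dX_v(b^↑) = X_v(b(m))` because `X_v` is linear on
fibres. -/
theorem coords_mlieBracket (hX : IsLinearSection Δ x X) (b : Cₛ^∞⟮I; F, B⟯) (e : TotalSpace F B) :
    dq I F e (VectorField.mlieBracket (I.prod 𝓘(ℝ, F)) X (verticalField I F b) e) = 0 ∧
    vcoord I F e.1 e (VectorField.mlieBracket (I.prod 𝓘(ℝ, F)) X (verticalField I F b) e) =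
      mvfderiv I (fun m => fcoord F B e.1 ⟨m, b m⟩) e.1 (x.1 e.1) -
        vcoord I F e.1 ⟨e.1, b e.1⟩ (X ⟨e.1, b e.1⟩) := by
  have hm := mem_dom_self (H := H) (F := F) (B := B) e.1
  have hdom : ∀ᶠ e' : TotalSpace F B in 𝓝 e, e'.1 ∈ dom (H := H) F B e.1 :=
    eventually_proj_mem (isOpen_dom e.1) hm
  have hbd := mdifferentiableAt_fcoord_section (I := I) hm.2 b
  have hVX : MDifferentiableAt (I.prod 𝓘(ℝ, F)) 𝓘(ℝ, E × F)
      (fun e' => hco (I.prod 𝓘(ℝ, F)) e e' (X e')) e :=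
    ((contMDiffAt_hco (v := ⟨e, X e⟩) (mem_chart_source _ e)).comp e
      (hX.smooth e)).mdifferentiableAt (by simp)
  have hWe : (fun e' => hco (I.prod 𝓘(ℝ, F)) e e' (verticalField I F b e')) =ᶠ[𝓝 e]
      fun e' => ContinuousLinearMap.inr ℝ E F (fcoord F B e.1 ⟨e'.1, b e'.1⟩) := by
    filter_upwards [eventually_hco_total (verticalField I F b) e, hdom] with e' h1 he'
    have h2 : dq I F e' (verticalField I F b e') = 0 := dq_verticalLift e' _
    have h3 : vcoord I F e.1 e' (verticalField I F b e') = co F e.1 e'.1 (b e'.1) :=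
      vcoord_verticalLift he'.2 _
    rw [h1, h2, h3, map_zero, co_apply he'.2]
    rfl
  have hbp : MDifferentiableAt (I.prod 𝓘(ℝ, F)) 𝓘(ℝ, F)
      (fun e' : TotalSpace F B => fcoord F B e.1 ⟨e'.1, b e'.1⟩) e :=
    hbd.comp e (mdifferentiableAt_proj B)
  have hW : MDifferentiableAt (I.prod 𝓘(ℝ, F)) 𝓘(ℝ, E × F)
      (fun e' => hco (I.prod 𝓘(ℝ, F)) e e' (verticalField I F b e')) e :=
    ((ContinuousLinearMap.inr ℝ E F).differentiableAt.mdifferentiableAt.comp e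
      hbp).congr_of_eventuallyEq hWe
  have key := hco_mlieBracket hVX hW
  rw [hco_total hm.1 hm.2] at key
  have hW' : mvfderiv (I.prod 𝓘(ℝ, F))
      (fun e' => hco (I.prod 𝓘(ℝ, F)) e e' (verticalField I F b e')) e (X e) =
        (0, mvfderiv I (fun m => fcoord F B e.1 ⟨m, b m⟩) e.1 (x.1 e.1)) := by
    rw [mvfderiv_congr hWe, mvfderiv_clm_comp _ hbp, mvfderiv_comp_proj hbd, hX.dq_eq]
    rfl
  -- The horizontal part of `X` factors through the projection to `M`, so vertical vectors do not
  -- differentiate it.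
  have hX1 : (mvfderiv (I.prod 𝓘(ℝ, F)) (fun e' => hco (I.prod 𝓘(ℝ, F)) e e' (X e'))
      e (verticalField I F b e)).1 = 0 := by
    have hx : MDifferentiableAt I 𝓘(ℝ, E) (fun m => hco I e.1 m (x.1 m)) e.1 :=
      ((contMDiffAt_hco (v := ⟨e.1, x.1 e.1⟩) hm.1).comp e.1
        (x.1.contMDiff e.1)).mdifferentiableAt (by simp)
    refine (mvfderiv_clm_comp (ContinuousLinearMap.fst ℝ E F) hVX _).symm.trans ?_
    rw [mvfderiv_congr (f' := fun e' => hco I e.1 e'.1 (x.1 e'.1)), mvfderiv_comp_proj hx]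
    · have h2 : dq I F e (verticalField I F b e) = 0 := dq_verticalLift e _
      rw [h2, map_zero]
    · filter_upwards [eventually_hco_total X e] with e' h1
      rw [h1, hX.dq_eq]
      rfl
  have hX2 : (mvfderiv (I.prod 𝓘(ℝ, F)) (fun e' => hco (I.prod 𝓘(ℝ, F)) e e' (X e'))
      e (verticalField I F b e)).2 = vcoord I F e.1 ⟨e.1, b e.1⟩ (X ⟨e.1, b e.1⟩) := by
    refine (mvfderiv_clm_comp (ContinuousLinearMap.snd ℝ E F) hVX _).symm.trans ?_
    rw [mvfderiv_congr (f' := fun e' => vcoord I F e.1 e' (X e'))]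
    · exact mvfderiv_verticalLift ((hX.contMDiffAt_vcoord hm).mdifferentiableAt (by simp))
        fun t => (hX.vcoord_add hm _ _).trans (congrArg _ (hX.vcoord_smul hm _ _))
    · filter_upwards [eventually_hco_total X e] with e' h1
      rw [h1]
      rfl
  rw [hW'] at key
  constructor
  · have h1 := congrArg Prod.fst key
    rw [Prod.fst_sub, hX1, sub_zero] at h1
    rwa [hco_self] at h1
  · have h1 := congrArg Prod.snd key
    rwa [Prod.snd_sub, hX2] at h1

variable [FiniteDimensional ℝ E] [FiniteDimensional ℝ F]

/-- The derivation `L_X` of a linear section `X`. -/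
theorem exists_derivation (hX : IsLinearSection Δ x X) :
    ∃ L : Cₛ^∞⟮I; F, B⟯ → Cₛ^∞⟮I; F, B⟯, IsDerivationOf X L ∧ ∀ b m,
      sectionTangent b m (x.1 m) - verticalLift I F ⟨m, b m⟩ (L b m) = X ⟨m, b m⟩ := by
  -- `L` is defined without the bracket: `X` and `Tb(x)` have the same horizontal part at `b(m)`, so
  -- they differ by a vertical vector. The bracket formula is verified afterwards.
  have hexists : ∀ (b : Cₛ^∞⟮I; F, B⟯) (m : M), ∃ c : B m,
      X ⟨m, b m⟩ = sectionTangent b m (x.1 m) - verticalLift I F ⟨m, b m⟩ c := fun b m => by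
    obtain ⟨c, hc⟩ := exists_eq_sub_verticalLift b (X ⟨m, b m⟩)
    exact ⟨c, by rwa [hX.dq_eq] at hc⟩
  choose L hL using hexists
  have hLc : ∀ (b : Cₛ^∞⟮I; F, B⟯) {m₀ m : M}, m ∈ dom (H := H) F B m₀ → co F m₀ m (L b m) =
      mvfderiv I (fun m => fcoord F B m₀ ⟨m, b m⟩) m (x.1 m) -
        vcoord I F m₀ ⟨m, b m⟩ (X ⟨m, b m⟩) := fun b m₀ m hm => by
    rw [hL, vcoord_sub_verticalLift hm.2, sub_sub_cancel]
  have hsmooth : ∀ b : Cₛ^∞⟮I; F, B⟯,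
      ContMDiff I (I.prod 𝓘(ℝ, F)) ∞ (fun m => TotalSpace.mk' F m (L b m)) := fun b m₀ => by
    refine ((contMDiffOn_section_co (x₀ := m₀) (isOpen_dom (H := H) (F := F) (B := B) m₀)
      fun m hm => hm.2).2 ?_).contMDiffAt ((isOpen_dom m₀).mem_nhds (mem_dom_self m₀))
    -- The choice `ℓ = 0` isolates the smoothness of `db(x)`.
    have h1 := (contMDiffOn_section_co (isOpen_dom (H := H) (F := F) (B := B) m₀)
      fun m hm => hm.2).1 (contMDiffOn_localConn (isOpen_dom m₀) Subset.rfl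
        (contMDiffOn_const (c := (0 : F →L[ℝ] E →L[ℝ] F))) b x.1)
    have h2 : ContMDiffOn I 𝓘(ℝ, F) ∞ (fun m => vcoord I F m₀ ⟨m, b m⟩ (X ⟨m, b m⟩))
        (dom (H := H) F B m₀) := fun m hm =>
      ((hX.contMDiffAt_vcoord (e := ⟨m, b m⟩) hm).comp m (b.contMDiff m)).contMDiffWithinAt
    refine (h1.sub h2).congr fun m hm => ?_
    rw [hLc b hm, localConn_apply, co_coSymm hm.2]
    simp
  refine ⟨fun b => ⟨L b, hsmooth b⟩, fun b e => ?_, fun b m => (hL b m).symm⟩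
  have hm := mem_dom_self (H := H) (F := F) (B := B) e.1
  obtain ⟨h1, h2⟩ := hX.coords_mlieBracket b e
  refine tangent_ext hm ?_ ?_
  · rw [h1]
    exact dq_verticalLift e _
  · rw [h2, ← hLc b hm]
    exact vcoord_verticalLift hm.2 _

end IsLinearSection

end Derivation

/-! ### Existence of linear sections -/

section Existence

variable {E H M : Type*} [NormedAddCommGroup E] [NormedSpace ℝ E] [TopologicalSpace H]
  {I : ModelWithCorners ℝ E H} [TopologicalSpace M] [ChartedSpace H M] [IsManifold I ∞ M]
  {F : Type*} [NormedAddCommGroup F] [NormedSpace ℝ F]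
  {B : M → Type*} [TopologicalSpace (TotalSpace F B)]
  [∀ m, AddCommGroup (B m)] [∀ m, Module ℝ (B m)] [∀ m, TopologicalSpace (B m)]
  [FiberBundle F B] [VectorBundle ℝ F B] [ContMDiffVectorBundle ∞ F B I]

variable {ΔM : ∀ m : M, Submodule ℝ (TangentSpace I m)} {C : ∀ m, Submodule ℝ (B m)}

/-- `Z` is a linear map from `B_m` to the fibre of `TB → TM` over `v ∈ T_m M`. -/
structure IsFibreLinear {m : M} (v : TangentSpace I m)
    (Z : ∀ b : B m, TangentSpace (I.prod 𝓘(ℝ, F)) (⟨m, b⟩ : TotalSpace F B)) : Prop where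
  dq_eq : ∀ b, dq I F ⟨m, b⟩ (Z b) = v
  map_add : ∀ b b', IsTSum I F ⟨⟨m, b⟩, Z b⟩ ⟨⟨m, b'⟩, Z b'⟩ ⟨⟨m, b + b'⟩, Z (b + b')⟩
  map_smul : ∀ (r : ℝ) b, (⟨⟨m, r • b⟩, Z (r • b)⟩ : TTot I F B) = tsmul I F r ⟨⟨m, b⟩, Z b⟩

theorem isFibreLinear_iff {m₀ m : M} (hm : m ∈ dom (H := H) F B m₀) {v : TangentSpace I m}
    {Z : ∀ b : B m, TangentSpace (I.prod 𝓘(ℝ, F)) (⟨m, b⟩ : TotalSpace F B)} :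
    IsFibreLinear v Z ↔ (∀ b, dq I F ⟨m, b⟩ (Z b) = v) ∧
      (∀ b b', vcoord I F m₀ ⟨m, b + b'⟩ (Z (b + b')) =
        vcoord I F m₀ ⟨m, b⟩ (Z b) + vcoord I F m₀ ⟨m, b'⟩ (Z b')) ∧
      ∀ (r : ℝ) b, vcoord I F m₀ ⟨m, r • b⟩ (Z (r • b)) = r • vcoord I F m₀ ⟨m, b⟩ (Z b) := by
  constructor
  · intro h
    refine ⟨h.dq_eq, fun b b' => ((isTSum_iff hm).1 (h.map_add b b')).2.2, fun r b => ?_⟩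
    have h1 : Z (r • b) = (tsmul I F r ⟨⟨m, b⟩, Z b⟩).2 :=
      TotalSpace.mk_injective (⟨m, r • b⟩ : TotalSpace F B) (h.map_smul r b)
    rw [h1]
    exact vcoord_tsmul r ⟨⟨m, b⟩, Z b⟩ hm.2
  · rintro ⟨h1, h2, h3⟩
    refine ⟨h1, fun b b' => (isTSum_iff hm).2 ⟨?_, ?_, h2 b b'⟩, fun r b => ?_⟩
    · rw [h1, h1]
    · rw [h1, h1]
    · refine ttot_ext (b' := r • b) (w' := (tsmul I F r ⟨⟨m, b⟩, Z b⟩).2) hm rfl ?_ ?_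
      · exact (h1 _).trans ((dq_tsmul r ⟨⟨m, b⟩, Z b⟩).trans (h1 b)).symm
      · exact (h3 r b).trans (vcoord_tsmul r ⟨⟨m, b⟩, Z b⟩ hm.2).symm

/-- Fibre-linearity over a fixed `v` is an affine condition: the vertical parts are combined
linearly, and weights of sum `1` keep the horizontal part equal to `v`. -/
theorem IsFibreLinear.sum {m : M} {v : TangentSpace I m} {ι : Type*} {t : Finset ι} {c : ι → ℝ}
    (hc : ∑ i ∈ t, c i = 1)
    {Z : ι → ∀ b : B m, TangentSpace (I.prod 𝓘(ℝ, F)) (⟨m, b⟩ : TotalSpace F B)}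
    (hZ : ∀ i ∈ t, IsFibreLinear v (Z i)) : IsFibreLinear v (fun b => ∑ i ∈ t, c i • Z i b) := by
  have hm := mem_dom_self (H := H) (F := F) (B := B) m
  have hZ' := fun i hi => (isFibreLinear_iff hm).1 (hZ i hi)
  have hv : ∀ b, vcoord I F m ⟨m, b⟩ (∑ i ∈ t, c i • Z i b) =
      ∑ i ∈ t, c i • vcoord I F m ⟨m, b⟩ (Z i b) := fun b => by
    simp only [_root_.map_sum, _root_.map_smul]
  refine (isFibreLinear_iff hm).2 ⟨fun b => ?_, fun b b' => ?_, fun r b => ?_⟩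
  · simp only [_root_.map_sum, _root_.map_smul]
    rw [Finset.sum_congr rfl fun i hi => by rw [(hZ' i hi).1 b], ← Finset.sum_smul, hc, one_smul]
  · rw [hv, hv, hv, ← Finset.sum_add_distrib]
    exact Finset.sum_congr rfl fun i hi => by rw [(hZ' i hi).2.1, smul_add]
  · rw [hv, hv, Finset.smul_sum]
    exact Finset.sum_congr rfl fun i hi => by rw [(hZ' i hi).2.2, smul_comm]

variable [FiniteDimensional ℝ E] [FiniteDimensional ℝ F]

/-- In a local form the vertical part `-ℓ(b)(x)` is linear in `b` and has core component zero, hence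
lies in `Δ`. -/
theorem exists_local_linearSection (Δ : LinearDistribution I F ΔM C)
    (hΔM : IsSmoothSubbundle I E (TangentSpace I : M → Type _) ΔM) (x : SideSection ΔM) (m₀ : M) :
    ∃ U : Set M, IsOpen U ∧ m₀ ∈ U ∧
      ∃ Y : ∀ e : TotalSpace F B, TangentSpace (I.prod 𝓘(ℝ, F)) e,
        ContMDiffOn (I.prod 𝓘(ℝ, F)) (I.prod 𝓘(ℝ, F)).tangent ∞ (fun e => (⟨e, Y e⟩ : TTot I F B))
          (TotalSpace.proj ⁻¹' U) ∧
        (∀ e, e.1 ∈ U → Y e ∈ Δ.space e) ∧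
        ∀ m ∈ U, IsFibreLinear (x.1 m) (fun b => Y ⟨m, b⟩) := by
  obtain ⟨U, hU, hm₀, hUd, ℓ, hℓ, hmem⟩ := Δ.hasLocalForm hΔM m₀
  let Y : ∀ e : TotalSpace F B, TangentSpace (I.prod 𝓘(ℝ, F)) e := fun e =>
    ofCoords I F B m₀ e (hco I m₀ e.1 (x.1 e.1),
      -ℓ e.1 (fcoord F B m₀ e) (hco I m₀ e.1 (x.1 e.1)))
  have hdq : ∀ e : TotalSpace F B, e.1 ∈ U → dq I F e (Y e) = x.1 e.1 :=
    fun e he => dq_ofCoords (hUd he) _ _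
  have hvc : ∀ e : TotalSpace F B, e.1 ∈ U → vcoord I F m₀ e (Y e) =
      -ℓ e.1 (fcoord F B m₀ e) (hco I m₀ e.1 (x.1 e.1)) := fun e he => vcoord_ofCoords (hUd he) _
  refine ⟨U, hU, hm₀, Y, fun e he => ?_, fun e he => ?_, fun m hm => ?_⟩
  · have he' : ∀ᶠ e' : TotalSpace F B in 𝓝 e, e'.1 ∈ U := eventually_proj_mem hU he
    have hp : ContMDiffAt (I.prod 𝓘(ℝ, F)) I ∞ (TotalSpace.proj : TotalSpace F B → M) e :=
      contMDiffAt_proj B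
    have hx : ContMDiffAt (I.prod 𝓘(ℝ, F)) 𝓘(ℝ, E) ∞
        (fun e : TotalSpace F B => hco I m₀ e.1 (x.1 e.1)) e :=
      ((contMDiffAt_hco (v := ⟨e.1, x.1 e.1⟩) (hUd he).1).comp e.1 (x.1.contMDiff e.1)).comp e hp
    refine ((contMDiffAt_ttot_iff (m₀ := m₀) (g := fun e => (⟨e, Y e⟩ : TTot I F B))
      (hUd he)).2 ⟨contMDiffAt_id, hx.congr_of_eventuallyEq ?_, ?_⟩).contMDiffWithinAt
    · filter_upwards [he'] with e' h
      rw [hdq e' h]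
    · have h1 : ContMDiffAt (I.prod 𝓘(ℝ, F)) 𝓘(ℝ, F →L[ℝ] E →L[ℝ] F) ∞
          (fun e : TotalSpace F B => ℓ e.1) e :=
        (hℓ.contMDiffAt (hU.mem_nhds he)).comp e hp
      refine ((h1.clm_apply (contMDiffAt_fcoord (hUd he).2)).clm_apply
        hx).neg.congr_of_eventuallyEq ?_
      filter_upwards [he'] with e' h
      exact hvc e' h
  · rw [hmem e he, hdq e he, hvc e he, neg_add_cancel, map_zero]
    exact ⟨x.2 e.1, zero_mem _⟩
  · refine (isFibreLinear_iff (hUd hm)).2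
      ⟨fun b => hdq ⟨m, b⟩ hm, fun b b' => ?_, fun r b => ?_⟩
    · rw [hvc ⟨m, b + b'⟩ hm, hvc ⟨m, b⟩ hm, hvc ⟨m, b'⟩ hm, fcoord_add (hUd hm).2, map_add (ℓ m),
        add_apply, neg_add]
    · rw [hvc ⟨m, r • b⟩ hm, hvc ⟨m, b⟩ hm, fcoord_smul (hUd hm).2, map_smul (ℓ m), smul_apply,
        smul_neg]

/-- Local linear sections are glued by a partition of unity pulled back from `M`. Its functions are
constant on the fibres of `B`, so `IsFibreLinear.sum` applies fibre by fibre. -/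
theorem exists_isLinearSection [T2Space M] [SigmaCompactSpace M] (Δ : LinearDistribution I F ΔM C)
    (hΔM : IsSmoothSubbundle I E (TangentSpace I : M → Type _) ΔM) (x : SideSection ΔM) :
    ∃ X, IsLinearSection Δ x X := by
  choose U hU hmU Y hY hmem hlin using exists_local_linearSection Δ hΔM x
  obtain ⟨ρ, hρ⟩ := SmoothPartitionOfUnity.exists_isSubordinate I isClosed_univ U hU
    fun m _ => mem_iUnion.2 ⟨m, hmU m⟩
  have hρU : ∀ i m, i ∈ ρ.finsupport m → m ∈ U i := fun i m hi =>
    hρ i (subset_closure ((ρ.mem_finsupport m).1 hi))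
  let X : ∀ e : TotalSpace F B, TangentSpace (I.prod 𝓘(ℝ, F)) e := fun e =>
    ∑ᶠ i, ρ i e.1 • Y i e
  have hX : ∀ e, X e = ∑ i ∈ ρ.finsupport e.1, ρ i e.1 • Y i e := fun e =>
    finsum_eq_sum_of_support_subset _ fun i hi => by
      rw [ρ.coe_finsupport]
      exact left_ne_zero_of_smul hi
  have hXlin : ∀ m, IsFibreLinear (x.1 m) (fun b => X ⟨m, b⟩) := fun m => by
    simp only [hX]
    exact IsFibreLinear.sum (ρ.sum_finsupport m (mem_univ m)) fun i hi => hlin i m (hρU i m hi)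
  have hproj : Continuous (TotalSpace.proj : TotalSpace F B → M) := FiberBundle.continuous_proj F B
  refine ⟨X, ?_, fun e => ?_, fun e => ?_, fun m => (hXlin m).map_add, fun m => (hXlin m).map_smul⟩
  · refine ContMDiff.finsum_section_of_locallyFinite ?_ fun i => ?_
    · exact (ρ.locallyFinite.preimage_continuous hproj).subset fun i e he =>
        left_ne_zero_of_smul he
    · refine ContMDiffOn.smul_section_of_tsupport (ψ := fun e : TotalSpace F B => ρ i e.1)
        ?_ ((hU i).preimage hproj) ?_ (hY i)
      · exact ((ρ i).contMDiff.comp (contMDiff_proj B)).contMDiffOn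
      · exact (tsupport_comp_subset_preimage (ρ i) hproj).trans (preimage_mono (hρ i))
  · rw [hX]
    exact sum_mem fun i hi => Submodule.smul_mem _ _ (hmem i e (hρU i e.1 hi))
  · exact congrArg (TotalSpace.mk e.1) ((hXlin e.1).dq_eq e.2)

end Existence

end LinDist

end

theorem mainTheorem6 {E H M F : Type*}
    [NormedAddCommGroup E] [NormedSpace ℝ E] [FiniteDimensional ℝ E] [TopologicalSpace H]
    (I : ModelWithCorners ℝ E H) [I.Boundaryless]
    [TopologicalSpace M] [ChartedSpace H M] [IsManifold I ∞ M] [T2Space M] [SigmaCompactSpace M]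
    [NormedAddCommGroup F] [NormedSpace ℝ F] [FiniteDimensional ℝ F]
    (B : M → Type*) [TopologicalSpace (TotalSpace F B)]
    [∀ m, AddCommGroup (B m)] [∀ m, Module ℝ (B m)] [∀ m, TopologicalSpace (B m)]
    [∀ m, IsTopologicalAddGroup (B m)] [∀ m, ContinuousSMul ℝ (B m)]
    [FiberBundle F B] [VectorBundle ℝ F B] [ContMDiffVectorBundle ∞ F B I]
    (ΔM : ∀ m : M, Submodule ℝ (TangentSpace I m)) (C : ∀ m, Submodule ℝ (B m))
    (hΔM : LinDist.IsSmoothSubbundle I E (TangentSpace I : M → Type _) ΔM)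
    (hC : LinDist.IsSmoothSubbundle I F B C) :
    ∃ 𝔻 : LinDist.LinearDistribution I F ΔM C ≃ LinDist.SpencerOperator I F ΔM C,
      -- `𝔻 Δ` is the operator `(x, b) ↦ π ∘ L_X (b)`, for any linear section `X` of `Δ` over `x`
      (∀ (Δ : LinDist.LinearDistribution I F ΔM C) (x : LinDist.SideSection ΔM),
        (∃ X, LinDist.IsLinearSection Δ x X) ∧
        ∀ X, LinDist.IsLinearSection Δ x X →
          ∃ L : Cₛ^∞⟮I; F, B⟯ → Cₛ^∞⟮I; F, B⟯, LinDist.IsDerivationOf X L ∧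
            ∀ b m, (𝔻 Δ).eval x b m = (C m).mkQ (L b m)) ∧
      ∀ (Δ : LinDist.LinearDistribution I F ΔM C) (cov : CovariantDerivative I F B)
        [cov.ContMDiffCovariantDerivative ∞],
        LinDist.IsAdapted cov Δ ↔
          ∀ (x : LinDist.SideSection ΔM) (b : Cₛ^∞⟮I; F, B⟯) (m : M),
            (C m).mkQ (cov b m (x.1 m)) = (𝔻 Δ).eval x b m := by
  obtain ⟨𝔻, h𝔻⟩ := LinDist.exists_equiv_corresponds hΔM hC
  refine ⟨𝔻, fun Δ x => ⟨LinDist.exists_isLinearSection Δ hΔM x, fun X hX => ?_⟩,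
    fun Δ cov _ => LinDist.isAdapted_iff hΔM (h𝔻 Δ) cov⟩
  obtain ⟨L, hL, hLX⟩ := hX.exists_derivation
  -- `X(b(m)) = Tb(x) - (L b)^↑` lies in `Δ`, and `Corresponds` reads this as `D_x b = π(L b)`.
  -- Since `𝔻` was fixed before `X`, independence of the choice of `X` is included.
  refine ⟨L, hL, fun b m => (h𝔻 Δ b m (x.val m) (L b m)).1 ?_⟩
  have h := hX.mem ⟨m, b m⟩
  rw [← hLX b m] at h
  exact h
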